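/- **Setting.** For $(x,y)\in[-\frac{\pi}{2},\frac{\pi}{2}]^2$ put $M(x,y)=\max\{|x|,|y|\}$ and $$h(x,y)=\left(\frac{x\sin M(x,y)}{\sqrt{x^2+y^2}},\ \frac{y\sin M(x,y)}{\sqrt{x^2+y^2}},\ \cos M(x,y)\right),\qquad h(0,0)=(0,0,1).$$ Let $Z:\mathbb R^3\to\mathbb R^3\setminus\{0\}$ be the Zorich map: $Z(x,y,z)=e^{z}h(x,y)$ on $[-\frac{\pi}{2},\frac{\pi}{2}]^2\times\mathbb R$, extended to $\mathbb R^3$ by repeated reflection in the planes $x=(k+\frac12)\pi$ and $y=(l+\frac12)\pi$ ($k,l\in\mathbb Z$) in the domain and in the plane $z=0$ in the image. Let $A(x,y,z)=(2rx,\,2ry,\,1-2r(z+1))$ with $r=1/(x^2+y^2+(z+1)^2)$ and $A(0,0,-1)=\infty$. Define the generalized tangent map $T:\mathbb R^3\to\mathbb R^3\cup\{\infty\}$ by $T(\mathbf x)=A(Z(2\mathbf x))$, and for $\lambda>0$ put $T_\lambda=\lambda T$ (with $\lambda\infty=\infty$). For $f:\mathbb R^3\to\mathbb R^3\cup\{\infty\}$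 let $O^-(\infty)=\bigcup_{k\ge1}f^{-k}(\infty)$, let $I(f)=\{\mathbf x\in\mathbb R^3\setminus O^-(\infty): f^k(\mathbf x)\to\infty\}$ be the escaping set, and let $\mathcal A(\mathbf x_0)=\{\mathbf x\in\mathbb R^3: f^k(\mathbf x)\to\mathbf x_0\}$ be the basin of attraction of $\mathbf x_0$. For $0<\mu<1$ let $\phi(\mu)$ be the smallest positive fixed point of $x\mapsto\mu\tan x$. For $0<\lambda<\sqrt2$ the petal set $Q=Q_\lambda$ is the set of all points $(t,\alpha t,0)$ and $(\alpha t,t,0)$ with $$\lambda^2-1<\alpha^2\le1,\qquad |t|<\min\left\{\frac{\pi}{4},\ \phi\!\left(\frac{\lambda}{\sqrt{1+\alpha^2}}\right)\right\}.$$ **Theorem.** 1. If $\lambda>\sqrt2$, then $\overline{I(T_\lambda)}=\{(x,y,0):x,y\in\mathbb R\}$. 2. If $0<\lambda<\sqrt2$, then $Q$ is contained in the basin of attraction $\mathcal A(0)$ of the origin under $T_\lambda$; the set $Q\setminus\{0\}$ is non-empty and relatively open in the $(x,y)$-plane; and $I(T_\lambda)$ is not dense in the $(x,y)$-plane, that is,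 $\{(x,y,0):x,y\in\mathbb R\}\not\subseteq\overline{I(T_\lambda)}$. 3. Consequently the constant $\sqrt2$ in part 1 cannot be replaced by any smaller value: for every real $c<\sqrt2$ there is some $\lambda>0$ with $\lambda>c$ and $\overline{I(T_\lambda)}\ne\{(x,y,0):x,y\in\mathbb R\}$. -/

import Mathlib

open Filter Topology

noncomputable section

/-- Euclidean three-space, with coordinates `x = p 0`, `y = p 1`, `z = p 2`. -/
abbrev Space3 : Type := EuclideanSpace ℝ (Fin 3)

/-! ## The Zorich map -/

/-- `M(x, y) = max {|x|, |y|}`. -/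
def maxAbs (x y : ℝ) : ℝ := max |x| |y|

/-- The bi-Lipschitz map `h` of the square `[-π/2, π/2]²` onto the closed upper unit hemisphere.
At `x = y = 0` the convention `0 / 0 = 0` gives the continuous value `(0, 0, 1)`. -/
def hemisphereMap (x y : ℝ) : Space3 :=
  !₂[x * Real.sin (maxAbs x y) / √(x ^ 2 + y ^ 2),
     y * Real.sin (maxAbs x y) / √(x ^ 2 + y ^ 2),
     Real.cos (maxAbs x y)]

/-- The index `k` of the strip `[(k - 1/2)π, (k + 1/2)π]` that contains `t`; on a common boundary
point of two strips the choice does not affect the Zorich map below. Reflecting repeatedly in the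
points `(j + 1/2)π`, it takes `|k|` reflections to bring `t` into `[-π/2, π/2]`. -/
def stripIndex (t : ℝ) : ℤ := round (t / Real.pi)

/-- The point of `[-π/2, π/2]` obtained from `t` by repeated reflection in the points
`(j + 1/2)π`, `j ∈ ℤ`. -/
def foldCoord (t : ℝ) : ℝ := (-1) ^ stripIndex t * (t - stripIndex t * Real.pi)

/-- The Zorich map `Z`: equal to `e^z h(x, y)` on the beam `[-π/2, π/2]² × ℝ`, and extended to all
of space by reflecting in the planes `x = (k + 1/2)π`, `y = (l + 1/2)π` in the domain and in the
plane `z = 0` in the image (once for each reflection in the domain). -/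
def zorich (p : Space3) : Space3 :=
  let w : Space3 := Real.exp (p 2) • hemisphereMap (foldCoord (p 0)) (foldCoord (p 1))
  !₂[w 0, w 1, (-1) ^ (stripIndex (p 0) + stripIndex (p 1)) * w 2]

/-! ## The generalized tangent map -/

/-- The Möbius map `A(x, y, z) = (2rx, 2ry, 1 - 2r(z + 1))`, where
`r = 1 / (x² + y² + (z + 1)²)`; it sends `(0, 0, -1)` to `∞`. -/
def moebiusA (p : Space3) : OnePoint Space3 :=
  open Classical in
  if p = !₂[0, 0, -1] then OnePoint.infty
  else
    let r : ℝ := 1 / (p 0 ^ 2 + p 1 ^ 2 + (p 2 + 1) ^ 2)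
    ((!₂[2 * r * p 0, 2 * r * p 1, 1 - 2 * r * (p 2 + 1)] : Space3) : OnePoint Space3)

/-- The generalized tangent map `T(p) = A(Z(2p))`. -/
def genTan (p : Space3) : OnePoint Space3 := moebiusA (zorich ((2 : ℝ) • p))

/-- `T_lam = lam · T`, where `lam · ∞ = ∞`. -/
def genTanScaled (lam : ℝ) (p : Space3) : OnePoint Space3 :=
  OnePoint.map (fun v : Space3 => lam • v) (genTan p)

/-! ## Iteration of maps with poles -/

/-- The `k`-th iterate of `f : ℝ³ → ℝ³ ∪ {∞}`. An orbit that lands on `∞` is recorded as staying at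
`∞`; so the iterate is genuinely defined at `p` as long as no earlier one equals `∞`. -/
def orbit (f : Space3 → OnePoint Space3) : ℕ → Space3 → OnePoint Space3
  | 0, p => (p : OnePoint Space3)
  | k + 1, p => (orbit f k p).elim OnePoint.infty f

/-- The backward orbit `O⁻(∞) = ⋃_{k ≥ 1} f^{-k}(∞)` of infinity. -/
def backwardOrbitInfty (f : Space3 → OnePoint Space3) : Set Space3 :=
  {p | ∃ k : ℕ, 1 ≤ k ∧ orbit f k p = OnePoint.infty}

/-- The escaping set `I(f)`: the points whose orbits tend to `∞` without ever landing on `∞`. -/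
def escapingSet (f : Space3 → OnePoint Space3) : Set Space3 :=
  {p | p ∉ backwardOrbitInfty f ∧
    Tendsto (fun k => orbit f k p) atTop (𝓝 (OnePoint.infty : OnePoint Space3))}

/-- The basin of attraction of `p₀`. All iterates are automatically defined at its points, as an
orbit that has landed on `∞` does not converge to `p₀`. -/
def basin (f : Space3 → OnePoint Space3) (p₀ : Space3) : Set Space3 :=
  {p | Tendsto (fun k => orbit f k p) atTop (𝓝 (p₀ : OnePoint Space3))}

/-! ## The plane and the petal set -/

/-- The `(x, y)`-plane `{(x, y, 0) : x, y ∈ ℝ}`. -/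
def xyPlane : Set Space3 := {p | p 2 = 0}

/-- For `0 < μ < 1`, the smallest positive fixed point `φ(μ)` of `x ↦ μ tan x`. -/
def smallestFixedPt (μ : ℝ) : ℝ := sInf {x : ℝ | 0 < x ∧ μ * Real.tan x = x}

/-- The bound `min {π/4, φ(lam / √(1 + α²))}` on the petal set in the direction of slope `α`. -/
def petalBound (lam α : ℝ) : ℝ :=
  min (Real.pi / 4) (smallestFixedPt (lam / √(1 + α ^ 2)))

/-- The petal set `Q = Q₁ ∪ Q₂`, where `Q₁` consists of the points `(t, αt, 0)` and `Q₂` of the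
points `(αt, t, 0)` with `lam² - 1 < α² ≤ 1` and `|t| < min {π/4, φ(lam / √(1 + α²))}`. -/
def petalSet (lam : ℝ) : Set Space3 :=
  {p | ∃ t α : ℝ, lam ^ 2 - 1 < α ^ 2 ∧ α ^ 2 ≤ 1 ∧ |t| < petalBound lam α ∧
    p = !₂[t, α * t, 0]} ∪
  {p | ∃ t α : ℝ, lam ^ 2 - 1 < α ^ 2 ∧ α ^ 2 ≤ 1 ∧ |t| < petalBound lam α ∧
    p = !₂[α * t, t, 0]}

end

/-! On the plane `z = 0` the Zorich map lands on the unit sphere and the Möbius map sends that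
sphere back to the plane. In the chamber `0 ≤ y ≤ x`, `x + y ≤ π/2` the result is `sectorMap`: its
value has norm `lam * tan x`, and each ray of slope `s ∈ [0, 1]` with `x ≤ π/4` is mapped into
itself by `x ↦ lam / √(1 + s²) * tan x`. Reflections and translations carry the chamber over the
plane, so the planar dynamics is `sectorMap` followed by folding. The gain `lam / √(1 + s²)` is
least on the diagonal, where it equals `lam / √2`; this is the source of the constant `√2`.

Escaping points lie in the plane: an escaping orbit eventually stays close to the poles, where
nonzero heights at least double while remaining bounded. Let `C` be the closure of the escaping set
in the plane. It is invariant under the symmetries and completely invariant under `sectorMap`, and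
it contains the axis, since `lam * tan` is expanding for `lam > 1`.

For `lam > √2`, `IsTangentInvariant.eq_univ` shows that such a `C` is the whole plane. If `C`
contains the diagonal, then it contains every wall of the symmetry group; a ball in the complement
folds isometrically into the chamber, its area grows by the factor `lam² / 2 > 1` at each step, and
the chamber has finite area (`eq_univ_of_diagonal`). If `C` misses some diagonal point, the
expanding map `κ tan` with `κ = lam / √2` forces `κ < π/2` and `C` to miss the whole open segment
from `0` to `(π/2, π/2)` (`IsDiagonalTrace.Ioo_subset`). This is impossible by
`exists_diagonal_mem`: among the rays below the diagonal that meet `C` near the origin there is a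
steepest one, and reflection in the antidiagonal, followed if necessary by an inverse branch at the
pole, produces a steeper one.

For `lam < √2` the gain is below `1` on rays close to the diagonals, so orbits there decrease to the
origin below the first fixed point of the gain times `tan`. Off the origin, the petal condition says
exactly that the radius decreases under one step with `M < π/4`, which is an open condition; hence
escaping points cannot accumulate at a petal. -/

/-! ### The expanding map `κ tan` on the diagonal -/

/-- The addition formula gives `tan b - tan a = tan (b - a) * (1 + tan a * tan b)`, and `tan θ ≥ θ`.
Keeping the second factor, rather than using only slope at least `1`, is what makes the length
estimates in `IsDiagonalTrace.Ioo_subset` close. -/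
theorem tan_sub_tan_ge {a b : ℝ} (ha : 0 ≤ a) (hab : a ≤ b) (hb : b < Real.pi / 2) :
    (b - a) * (1 + Real.tan a * Real.tan b) ≤ Real.tan b - Real.tan a := by
  have hpi := Real.pi_pos
  have hca : 0 < Real.cos a := Real.cos_pos_of_mem_Ioo ⟨by linarith, by linarith⟩
  have hcb : 0 < Real.cos b := Real.cos_pos_of_mem_Ioo ⟨by linarith, by linarith⟩
  have hcd : 0 < Real.cos (b - a) := Real.cos_pos_of_mem_Ioo ⟨by linarith, by linarith⟩
  have hta : 0 ≤ Real.tan a := Real.tan_nonneg_of_nonneg_of_le_pi_div_two ha (by linarith)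
  have htb : 0 ≤ Real.tan b := Real.tan_nonneg_of_nonneg_of_le_pi_div_two (by linarith) hb.le
  have hd : b - a ≤ Real.tan (b - a) := Real.le_tan (by linarith) (by linarith)
  have key : Real.tan b - Real.tan a = Real.tan (b - a) * (1 + Real.tan a * Real.tan b) := by
    have h1 : Real.cos b * Real.cos a + Real.sin b * Real.sin a = Real.cos (b - a) :=
      (Real.cos_sub b a).symm
    rw [Real.tan_eq_sin_div_cos, Real.tan_eq_sin_div_cos, Real.tan_eq_sin_div_cos]
    have h2 : 1 + Real.sin a / Real.cos a * (Real.sin b / Real.cos b)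
        = Real.cos (b - a) / (Real.cos a * Real.cos b) := by
      rw [← h1]; field_simp
    rw [h2, Real.sin_sub]
    field_simp
  rw [key]
  exact mul_le_mul_of_nonneg_right hd (by positivity)

/-- The traces on the diagonal of the complement of a closed set invariant under the tangent map. -/
structure IsDiagonalTrace (κ : ℝ) (B : Set ℝ) : Prop where
  isOpen : IsOpen B
  neg : ∀ t ∈ B, -t ∈ B
  add_half_pi : ∀ t, t ∈ B ↔ t + Real.pi / 2 ∈ B
  zero_notMem : (0 : ℝ) ∉ B
  mem_iff : ∀ t, 0 < t → t ≤ Real.pi / 4 → (t ∈ B ↔ κ * Real.tan t ∈ B)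

namespace IsDiagonalTrace

variable {κ : ℝ} {B : Set ℝ}

theorem add_int (h : IsDiagonalTrace κ B) (k : ℤ) (t : ℝ) :
    t + k * (Real.pi / 2) ∈ B ↔ t ∈ B := by
  induction k using Int.induction_on with
  | zero => simp
  | succ n ih =>
    rw [← ih, h.add_half_pi (t + ((n : ℤ) : ℝ) * (Real.pi / 2))]
    push_cast
    ring_nf
  | pred n ih =>
    rw [← ih, h.add_half_pi (t + (((-(n : ℤ) - 1 : ℤ)) : ℝ) * (Real.pi / 2))]
    push_cast
    ring_nf

theorem reflect (h : IsDiagonalTrace κ B) {t : ℝ} (ht : t ∈ B) : Real.pi / 2 - t ∈ B := by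
  have := (h.add_half_pi (-t)).1 (h.neg t ht)
  rwa [neg_add_eq_sub] at this

theorem image_subset (h : IsDiagonalTrace κ B) (hκ : 1 < κ) {u v : ℝ} (hu : 0 ≤ u)
    (hlt : u < v) (hv : v ≤ Real.pi / 4) (huv : Set.Ioo u v ⊆ B) :
    Set.Ioo (κ * Real.tan u) (κ * Real.tan v) ⊆ B := by
  intro w hw
  have hpi := Real.pi_pos
  have hκ0 : 0 < κ := by linarith
  have hu' : Real.arctan (Real.tan u) = u := Real.arctan_tan (by linarith) (by linarith)
  have hv' : Real.arctan (Real.tan v) = v := Real.arctan_tan (by linarith) (by linarith)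
  have h1 : u < Real.arctan (w / κ) := by
    rw [← hu']; apply Real.arctan_strictMono
    rw [lt_div_iff₀ hκ0]; linarith [hw.1]
  have h2 : Real.arctan (w / κ) < v := by
    rw [← hv']; apply Real.arctan_strictMono
    rw [div_lt_iff₀ hκ0]; linarith [hw.2]
  have := (h.mem_iff _ (by linarith) (by linarith)).1 (huv ⟨h1, h2⟩)
  rwa [Real.tan_arctan, mul_div_cancel₀ _ hκ0.ne'] at this

theorem length_image_ge (hκ : 1 < κ) {u v : ℝ} (hu : 0 ≤ u) (hlt : u < v)
    (hv : v ≤ Real.pi / 4) : κ * (v - u) ≤ κ * Real.tan v - κ * Real.tan u := by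
  have hpi := Real.pi_pos
  have h1 := tan_sub_tan_ge hu hlt.le (by linarith)
  have hta : 0 ≤ Real.tan u := Real.tan_nonneg_of_nonneg_of_le_pi_div_two hu (by linarith)
  have htb : 0 ≤ Real.tan v := Real.tan_nonneg_of_nonneg_of_le_pi_div_two (by linarith) (by linarith)
  have h2 : v - u ≤ Real.tan v - Real.tan u := by
    nlinarith [mul_nonneg (sub_nonneg.2 hlt.le) (mul_nonneg hta htb)]
  nlinarith

/-- An interval of `B` can be translated into `[0, π/2]`. -/
theorem exists_translate (h : IsDiagonalTrace κ B) {u v : ℝ}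
    (huv : Set.Ioo u v ⊆ B) : ∃ k : ℤ, 0 ≤ u - k * (Real.pi / 2) ∧
      v - k * (Real.pi / 2) ≤ Real.pi / 2 ∧
      Set.Ioo (u - k * (Real.pi / 2)) (v - k * (Real.pi / 2)) ⊆ B := by
  have hpi : 0 < Real.pi / 2 := by have := Real.pi_pos; linarith
  refine ⟨⌊u / (Real.pi / 2)⌋, ?_, ?_, ?_⟩
  · have := Int.floor_le (u / (Real.pi / 2))
    rw [le_div_iff₀ hpi] at this
    linarith
  · by_contra hcon
    push Not at hcon
    have h1 := Int.lt_floor_add_one (u / (Real.pi / 2))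
    rw [div_lt_iff₀ hpi] at h1
    have h2 : (0 : ℝ) + ((⌊u / (Real.pi / 2)⌋ + 1 : ℤ) : ℝ) * (Real.pi / 2) ∈ B := by
      apply huv
      push_cast
      constructor <;> linarith
    rw [h.add_int] at h2
    exact h.zero_notMem h2
  · intro t ht
    rw [← h.add_int ⌊u / (Real.pi / 2)⌋]
    exact huv ⟨by linarith [ht.1], by linarith [ht.2]⟩

/-- An interval of `B` without odd multiples of `π/4` has an isometric copy in `[0, π/4]`. -/
theorem exists_copy (h : IsDiagonalTrace κ B) {u v : ℝ} (hlt : u < v) (huv : Set.Ioo u v ⊆ B)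
    (hno : ∀ k : ℤ, Real.pi / 4 + k * (Real.pi / 2) ∉ Set.Ioo u v) :
    ∃ u' v' : ℝ, 0 ≤ u' ∧ u' < v' ∧ v' ≤ Real.pi / 4 ∧ v' - u' = v - u ∧ Set.Ioo u' v' ⊆ B := by
  obtain ⟨k, h1, h2, h3⟩ := h.exists_translate huv
  have h4 := hno k
  rcases le_or_gt (v - k * (Real.pi / 2)) (Real.pi / 4) with h5 | h5
  · exact ⟨_, _, h1, by linarith, h5, by ring, h3⟩
  · have h6 : Real.pi / 4 ≤ u - k * (Real.pi / 2) := by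
      by_contra hcon
      exact h4 ⟨by linarith, by linarith⟩
    refine ⟨Real.pi / 2 - (v - k * (Real.pi / 2)), Real.pi / 2 - (u - k * (Real.pi / 2)),
      by linarith, by linarith, by linarith, by ring, fun t ht => ?_⟩
    have := h.reflect (h3 (show Real.pi / 2 - t ∈ _ from ⟨by linarith [ht.2], by linarith [ht.1]⟩))
    rwa [sub_sub_cancel] at this

/-- Intervals of `B` grow under iteration until they meet an odd multiple of `π/4`. -/
theorem exists_fold (h : IsDiagonalTrace κ B) (hκ : 1 < κ) {u v : ℝ} (hu : 0 ≤ u) (hlt : u < v)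
    (hv : v ≤ Real.pi / 4) (huv : Set.Ioo u v ⊆ B) :
    ∃ u' v' t : ℝ, ∃ k : ℤ, 0 ≤ u' ∧ v' ≤ Real.pi / 4 ∧ v - u ≤ v' - u' ∧ Set.Ioo u' v' ⊆ B ∧
      t ∈ Set.Ioo u' v' ∧ κ * Real.tan t = Real.pi / 4 + k * (Real.pi / 2) := by
  by_contra hcon
  -- While the image contains no fold point, it has an isometric copy in `[0, π/4]`, so lengths grow
  -- by `κ` at each step; they cannot exceed `π/4`.
  have step : ∀ n : ℕ, ∃ u' v' : ℝ, 0 ≤ u' ∧ u' < v' ∧ v' ≤ Real.pi / 4 ∧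
      κ ^ n * (v - u) ≤ v' - u' ∧ Set.Ioo u' v' ⊆ B := by
    intro n
    induction n with
    | zero => exact ⟨u, v, hu, hlt, hv, by simp, huv⟩
    | succ n ih =>
      obtain ⟨a, b, ha, hab, hb, hl, hB⟩ := ih
      have hpow : v - u ≤ κ ^ n * (v - u) :=
        le_mul_of_one_le_left (by linarith) (one_le_pow₀ hκ.le)
      have hlen := length_image_ge hκ ha hab hb
      have hlt' : κ * Real.tan a < κ * Real.tan b := by nlinarith
      obtain ⟨a', b', ha', hab', hb', hl', hB'⟩ :=
        h.exists_copy hlt' (h.image_subset hκ ha hab hb hB) (fun k hk => by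
          have hκ0 : 0 < κ := by linarith
          have hpi := Real.pi_pos
          refine hcon ⟨a, b, Real.arctan ((Real.pi / 4 + k * (Real.pi / 2)) / κ), k, ha, hb,
            by linarith, hB, ⟨?_, ?_⟩, ?_⟩
          · rw [← Real.arctan_tan (x := a) (by linarith) (by linarith)]
            apply Real.arctan_strictMono
            rw [lt_div_iff₀ hκ0]; linarith [hk.1]
          · rw [← Real.arctan_tan (x := b) (by linarith) (by linarith)]
            apply Real.arctan_strictMono
            rw [div_lt_iff₀ hκ0]; linarith [hk.2]
          · rw [Real.tan_arctan, mul_div_cancel₀ _ hκ0.ne'])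
      refine ⟨a', b', ha', hab', hb', ?_, hB'⟩
      rw [hl', pow_succ]
      nlinarith
  have hlim := tendsto_pow_atTop_atTop_of_one_lt hκ
  obtain ⟨n, hn⟩ := (hlim.eventually_gt_atTop (Real.pi / 4 / (v - u))).exists
  obtain ⟨a, b, ha, hab, hb, hl, -⟩ := step n
  rw [div_lt_iff₀ (by linarith)] at hn
  linarith

/-- The gap `B` contains `π/4`, because every interval of `B` grows until it covers a fold point.
Let `(a, π/2 - a)` be the component of `π/4`, of half-length `d`. No interval of `B` reaches further
than `d` from a fold point inside it. The image of `(a, π/4)` is long compared with `d`: if it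
covers a fold point, then `a = 0` and `κ < π/2` follow; if not, then some later image is too long.
-/
theorem Ioo_subset (h : IsDiagonalTrace κ B) (hκ : 1 < κ) (hne : B.Nonempty) :
    κ < Real.pi / 2 ∧ Set.Ioo 0 (Real.pi / 2) ⊆ B := by
  have hpi := Real.pi_pos
  have hpi3 := Real.pi_gt_three
  have hκ0 : 0 < κ := by linarith
  have fold_mem : ∀ k : ℤ, Real.pi / 4 + k * (Real.pi / 2) ∈ B → Real.pi / 4 ∈ B :=
    fun k hk => (h.add_int k _).1 hk
  have hquarter : Real.pi / 4 ∈ B := by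
    obtain ⟨p, hp⟩ := hne
    obtain ⟨u, v, hpuv, huv⟩ := mem_nhds_iff_exists_Ioo_subset.1 (h.isOpen.mem_nhds hp)
    by_contra hcon
    obtain ⟨u', v', h1, h2, h3, -, h5⟩ := h.exists_copy (hpuv.1.trans hpuv.2) huv
      (fun k hk => hcon (fold_mem k (huv hk)))
    obtain ⟨a, b, t, k, h6, h7, -, h8, h9, h10⟩ := h.exists_fold hκ h1 h2 h3 h5
    apply hcon
    apply fold_mem k
    rw [← h10]
    exact (h.mem_iff t (by linarith [h9.1]) (by linarith [h9.2])).1 (h8 h9)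
  -- The number `a` is the largest point of the complement of `B` not exceeding `π/4`.
  obtain ⟨a, ha0, ha1, haB, hall⟩ : ∃ a : ℝ, 0 ≤ a ∧ a < Real.pi / 4 ∧ a ∉ B ∧
      ∀ t, a < t → t ≤ Real.pi / 4 → t ∈ B := by
    set S : Set ℝ := Bᶜ ∩ Set.Iic (Real.pi / 4) with hS
    have hScl : IsClosed S := h.isOpen.isClosed_compl.inter isClosed_Iic
    have h0S : (0 : ℝ) ∈ S := ⟨h.zero_notMem, by simp only [Set.mem_Iic]; linarith⟩
    have hbdd : BddAbove S := ⟨Real.pi / 4, fun t ht => ht.2⟩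
    have hmem : sSup S ∈ S := hScl.csSup_mem ⟨0, h0S⟩ hbdd
    refine ⟨sSup S, le_csSup hbdd h0S, lt_of_le_of_ne hmem.2 ?_, hmem.1, ?_⟩
    · intro heq
      apply hmem.1
      rwa [heq]
    · intro t ht1 ht2
      by_contra hcon
      exact absurd (le_csSup hbdd ⟨hcon, ht2⟩) (not_le.2 ht1)
  set d := Real.pi / 4 - a with hd
  have hd0 : 0 < d := by linarith
  -- The translates of `a` and of its mirror image `π/2 - a` lie outside `B`, at distance `d` on
  -- both sides of each fold point.
  have fold_bound : ∀ (u v : ℝ) (k : ℤ), Set.Ioo u v ⊆ B →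
      Real.pi / 4 + k * (Real.pi / 2) ∈ Set.Ioo u v →
      Real.pi / 4 + k * (Real.pi / 2) - d ≤ u ∧ v ≤ Real.pi / 4 + k * (Real.pi / 2) + d := by
    intro u v k huv hk
    constructor
    · by_contra hcon
      push Not at hcon
      have := huv (show a + k * (Real.pi / 2) ∈ Set.Ioo u v from
        ⟨by linarith, by linarith [hk.2]⟩)
      rw [h.add_int] at this
      exact haB this
    · by_contra hcon
      push Not at hcon
      have := huv (show (Real.pi / 2 - a) + k * (Real.pi / 2) ∈ Set.Ioo u v from
        ⟨by linarith [hk.1], by linarith⟩)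
      rw [h.add_int] at this
      apply haB
      simpa using h.reflect this
  have hta0 : 0 ≤ Real.tan a := Real.tan_nonneg_of_nonneg_of_le_pi_div_two ha0 (by linarith)
  have hlen : (1 + Real.tan a) * d ≤ 1 - Real.tan a := by
    have := tan_sub_tan_ge ha0 ha1.le (by linarith)
    rw [Real.tan_pi_div_four] at this
    rw [hd]; linarith
  have hI : Set.Ioo (κ * Real.tan a) κ ⊆ B := by
    have := h.image_subset hκ ha0 ha1 le_rfl (fun t ht => hall t ht.1 ht.2.le)
    rwa [Real.tan_pi_div_four, mul_one] at this
  have hIlt : κ * Real.tan a < κ := by nlinarith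
  have hκB : κ ∈ B := by
    have := (h.mem_iff (Real.pi / 4) (by linarith) le_rfl).1 hquarter
    rwa [Real.tan_pi_div_four, mul_one] at this
  have hpi_half : Real.pi / 2 ∉ B := fun hm =>
    h.zero_notMem ((h.add_half_pi 0).2 (by rwa [zero_add]))
  by_cases hfold : ∃ k : ℤ, Real.pi / 4 + k * (Real.pi / 2) ∈ Set.Ioo (κ * Real.tan a) κ
  · obtain ⟨k, hk⟩ := hfold
    obtain ⟨hb1, hb2⟩ := fold_bound _ _ k hI hk
    -- The image has length at least `κ (1 + tan a) d` and at most `2 d`. With `κ ≤ 2 < 3π/4`, the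
    -- fold point can only be `π/4`.
    have hκ2 : κ ≤ 2 := by
      have : κ * (1 + Real.tan a) * d ≤ 2 * d := by nlinarith
      have := le_of_mul_le_mul_right this hd0
      nlinarith
    have hkpos : 0 < Real.pi / 4 + k * (Real.pi / 2) :=
      lt_of_le_of_lt (by positivity) hk.1
    have hk0 : k = 0 := by
      have h1 : (-1 : ℝ) < k := by
        by_contra hcon
        push Not at hcon
        nlinarith
      have h2 : (k : ℝ) < 1 := by
        by_contra hcon
        push Not at hcon
        nlinarith [hk.2]
      have h1' : (-1 : ℤ) < k := by exact_mod_cast h1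
      have h2' : k < (1 : ℤ) := by exact_mod_cast h2
      omega
    subst hk0
    simp only [Int.cast_zero, zero_mul, add_zero] at hk hb1 hb2
    have hκlt : κ < Real.pi / 2 := by
      refine lt_of_le_of_ne (by linarith) ?_
      rintro rfl
      exact hpi_half hκB
    -- If `a > 0`, then `a < κ tan a < π/4`, so `κ tan a` lies in `B` and, by invariance, so does
    -- `a`.
    have ha : a = 0 := by
      by_contra hne0
      have hapos : 0 < a := lt_of_le_of_ne ha0 (Ne.symm hne0)
      apply haB
      rw [h.mem_iff a hapos ha1.le]
      apply hall _ _ hk.1.le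
      have := Real.lt_tan hapos (by linarith)
      nlinarith
    refine ⟨hκlt, fun t ht => ?_⟩
    rcases le_or_gt t (Real.pi / 4) with h4 | h4
    · exact hall t (by rw [ha]; exact ht.1) h4
    · have := h.reflect (hall (Real.pi / 2 - t) (by rw [ha]; linarith [ht.2]) (by linarith))
      rwa [sub_sub_cancel] at this
  · exfalso
    push Not at hfold
    -- Otherwise `π/4` itself would lie in the image, as `κ > 1 > π/4`.
    have hta : Real.pi / 4 ≤ κ * Real.tan a := by
      by_contra hcon
      have := Real.pi_lt_four
      exact hfold 0 ⟨by simp; linarith, by simp; linarith⟩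
    obtain ⟨u, v, h1, h2, h3, h4, h5⟩ := h.exists_copy hIlt hI hfold
    obtain ⟨u', v', t, k, h6, h7, h8, h9, h10, h11⟩ := h.exists_fold hκ h1 h2 h3 h5
    have hlt' : u' < v' := h10.1.trans h10.2
    have himg := h.image_subset hκ h6 hlt' h7 h9
    have htpos : 0 < t := lt_of_le_of_lt h6 h10.1
    have hm1 := Real.tan_lt_tan_of_lt_of_lt_pi_div_two (x := u') (y := t) (by linarith)
      (by linarith [h10.2]) h10.1
    have hm2 := Real.tan_lt_tan_of_lt_of_lt_pi_div_two (x := t) (y := v') (by linarith)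
      (by linarith) h10.2
    obtain ⟨hb1, hb2⟩ := fold_bound _ _ k himg (by
      rw [← h11]; exact ⟨by nlinarith, by nlinarith⟩)
    have htt : 0 < Real.tan t := Real.tan_pos_of_pos_of_lt_pi_div_two htpos (by linarith [h10.2])
    have hw : Real.pi / 4 ≤ κ * Real.tan t := by
      have hkpos : 0 < Real.pi / 4 + k * (Real.pi / 2) := by rw [← h11]; positivity
      have h1 : (-1 : ℝ) < k := by
        by_contra hcon
        push Not at hcon
        nlinarith
      have h1' : (-1 : ℤ) < k := by exact_mod_cast h1
      have h2' : (0 : ℝ) ≤ k := by exact_mod_cast (show (0 : ℤ) ≤ k by omega)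
      rw [h11]
      nlinarith
    have hl1 := length_image_ge hκ h6 h10.1 (by linarith [h10.2])
    have hl2 := tan_sub_tan_ge htpos.le h10.2.le (by linarith)
    -- To the right of `t` the slope of `κ tan` is at least `κ (1 + tan² t) ≥ 2 κ tan t ≥ π/2`,
    -- while the image extends at most `d` beyond the fold point.
    have hl3 : (v' - t) * (Real.pi / 2) ≤ d := by
      have e1 : κ * Real.tan v' - κ * Real.tan t ≤ d := by linarith
      have e2 : Real.tan t * Real.tan t ≤ Real.tan t * Real.tan v' := by nlinarith
      have e3 : Real.pi / 2 ≤ κ * (1 + Real.tan t * Real.tan t) := by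
        have := mul_nonneg hκ0.le (sq_nonneg (1 - Real.tan t))
        linarith
      have e4 : (v' - t) * (Real.pi / 2) ≤ (v' - t) * (κ * (1 + Real.tan t * Real.tan v')) := by
        refine mul_le_mul_of_nonneg_left (e3.trans ?_) (by linarith [h10.2])
        exact mul_le_mul_of_nonneg_left (by linarith) hκ0.le
      have e5 := mul_le_mul_of_nonneg_left hl2 hκ0.le
      linarith
    have hl4 : t - u' ≤ d := by
      have e1 : κ * (t - u') ≤ d := by linarith
      have e2 : 1 * (t - u') ≤ κ * (t - u') :=
        mul_le_mul_of_nonneg_right hκ.le (by linarith [h10.1])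
      linarith
    have hl5 : (κ + Real.pi / 4) * d ≤ v' - u' := by
      have e1 := mul_le_mul_of_nonneg_left hlen hκ0.le
      have e2 := mul_le_mul_of_nonneg_right hta hd0.le
      linarith
    -- The length exceeds `(1 + π/4) d`, whereas `hl3` and `hl4` bound it by `(1 + 2/π) d`. This
    -- contradicts `π² > 8`.
    have hl6 : (1 + Real.pi / 4) * d < v' - u' := by
      have := mul_lt_mul_of_pos_right hκ hd0
      linarith
    have hl7 : (v' - t) > Real.pi / 4 * d := by linarith
    have e1 := mul_lt_mul_of_pos_right hl7 (show 0 < Real.pi / 2 by linarith)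
    have e2 : 9 * d < Real.pi * Real.pi * d := mul_lt_mul_of_pos_right (by nlinarith) hd0
    linarith

end IsDiagonalTrace

/-! ### The planar map and its symmetric invariant sets -/

/-- The tangent map on the chamber `0 ≤ y ≤ x`, `x + y ≤ π / 2` of the plane `z = 0`. -/
noncomputable def sectorMap (lam x y : ℝ) : ℝ × ℝ :=
  (lam * Real.tan x * min x (Real.pi / 2 - x) / √(min x (Real.pi / 2 - x) ^ 2 + y ^ 2),
    lam * Real.tan x * y / √(min x (Real.pi / 2 - x) ^ 2 + y ^ 2))

/-- Sets of points of the plane that are invariant under the symmetries of the tangent map. -/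
structure IsPlanarSymmetric (C : Set (ℝ × ℝ)) : Prop where
  neg_fst : ∀ x y, (x, y) ∈ C → (-x, y) ∈ C
  swap : ∀ x y, (x, y) ∈ C → (y, x) ∈ C
  add_pi : ∀ x y, (x, y) ∈ C → (x + Real.pi, y) ∈ C
  add_half_pi : ∀ x y, (x, y) ∈ C → (x + Real.pi / 2, y + Real.pi / 2) ∈ C

/-- Closed sets of the plane that contain the real axis, are invariant under the symmetries of the
tangent map, and are completely invariant under the tangent map itself. -/
structure IsTangentInvariant (lam : ℝ) (C : Set (ℝ × ℝ)) : Prop extends IsPlanarSymmetric C where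
  isClosed : IsClosed C
  axis : ∀ x, (x, 0) ∈ C
  sector : ∀ x y, 0 ≤ y → y ≤ x → 0 < x → x < Real.pi / 2 → x + y ≤ Real.pi / 2 →
    ((x, y) ∈ C ↔ sectorMap lam x y ∈ C)

/-- For `x ≤ π/4` the direction is preserved and only the radius changes, so the dynamics on a ray
is that of a one-dimensional multiple of `tan`. -/
theorem sectorMap_ray {lam x s : ℝ} (hx : 0 < x) (hx4 : x ≤ Real.pi / 4) :
    sectorMap lam x (s * x) =
      (lam / √(1 + s ^ 2) * Real.tan x, s * (lam / √(1 + s ^ 2) * Real.tan x)) := by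
  have hm : min x (Real.pi / 2 - x) = x := min_eq_left (by linarith)
  have h1 : √(x ^ 2 + (s * x) ^ 2) = x * √(1 + s ^ 2) := by
    rw [show x ^ 2 + (s * x) ^ 2 = x ^ 2 * (1 + s ^ 2) by ring, Real.sqrt_mul (by positivity),
      Real.sqrt_sq hx.le]
  have h2 : 0 < √(1 + s ^ 2) := Real.sqrt_pos.2 (by positivity)
  unfold sectorMap
  rw [hm, h1]
  ext <;> simp only <;> field_simp

/-- Near the pole `(π/2, 0)` the ray with parameter `σ`, which leaves the pole towards the left, is
sent to the ray of slope `σ` from infinity inwards. This chart supplies the inverse branches used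
against the steepest ray. -/
theorem sectorMap_ray_right {lam M σ : ℝ} (hM : 0 < M) (hM4 : M ≤ Real.pi / 4) :
    sectorMap lam (Real.pi / 2 - M) (σ * M) =
      (lam / √(1 + σ ^ 2) / Real.tan M, σ * (lam / √(1 + σ ^ 2) / Real.tan M)) := by
  have hm : min (Real.pi / 2 - M) (Real.pi / 2 - (Real.pi / 2 - M)) = M := by
    rw [sub_sub_cancel]; exact min_eq_right (by linarith)
  have h1 : √(M ^ 2 + (σ * M) ^ 2) = M * √(1 + σ ^ 2) := by
    rw [show M ^ 2 + (σ * M) ^ 2 = M ^ 2 * (1 + σ ^ 2) by ring, Real.sqrt_mul (by positivity),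
      Real.sqrt_sq hM.le]
  have h2 : 0 < √(1 + σ ^ 2) := Real.sqrt_pos.2 (by positivity)
  have h3 : 0 < Real.tan M := Real.tan_pos_of_pos_of_lt_pi_div_two hM (by linarith [Real.pi_pos])
  unfold sectorMap
  rw [hm, h1, Real.tan_pi_div_two_sub]
  ext <;> simp only <;> field_simp

namespace IsPlanarSymmetric

variable {C : Set (ℝ × ℝ)}

theorem neg_snd (h : IsPlanarSymmetric C) {x y : ℝ} (hp : (x, y) ∈ C) : (x, -y) ∈ C :=
  h.swap _ _ (h.neg_fst _ _ (h.swap _ _ hp))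

theorem sub_half_pi (h : IsPlanarSymmetric C) {x y : ℝ} (hp : (x, y) ∈ C) :
    (x - Real.pi / 2, y - Real.pi / 2) ∈ C := by
  have h1 := h.neg_snd (h.neg_fst _ _ (h.add_half_pi _ _ (h.neg_snd (h.neg_fst _ _ hp))))
  convert h1 using 2 <;> ring

theorem sub_pi (h : IsPlanarSymmetric C) {x y : ℝ} (hp : (x, y) ∈ C) :
    (x - Real.pi, y) ∈ C := by
  have h1 := h.neg_fst _ _ (h.add_pi _ _ (h.neg_fst _ _ hp))
  convert h1 using 2; ring

theorem add_half_pi_iff (h : IsPlanarSymmetric C) {x y : ℝ} :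
    (x + Real.pi / 2, y + Real.pi / 2) ∈ C ↔ (x, y) ∈ C :=
  ⟨fun hp => by simpa using h.sub_half_pi hp, h.add_half_pi x y⟩

theorem reflect (h : IsPlanarSymmetric C) {x y : ℝ} (hp : (x, y) ∈ C) :
    (Real.pi / 2 - y, Real.pi / 2 - x) ∈ C := by
  have h1 := h.add_half_pi _ _ (h.neg_snd (h.neg_fst _ _ (h.swap _ _ hp)))
  convert h1 using 2 <;> ring

theorem add_int_mul_pi (h : IsPlanarSymmetric C) (k : ℤ) {x y : ℝ} (hp : (x, y) ∈ C) :
    (x + k * Real.pi, y) ∈ C := by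
  induction k using Int.induction_on with
  | zero => simpa using hp
  | succ n ih =>
    have := h.add_pi _ _ ih
    push_cast at this ⊢
    convert this using 2; ring
  | pred n ih =>
    have := h.sub_pi ih
    push_cast at this ⊢
    convert this using 2; ring

theorem add_int_mul_half_pi (h : IsPlanarSymmetric C) (k : ℤ) {x y : ℝ} (hp : (x, y) ∈ C) :
    (x + k * (Real.pi / 2), y + k * (Real.pi / 2)) ∈ C := by
  induction k using Int.induction_on with
  | zero => simpa using hp
  | succ n ih =>
    have := h.add_half_pi _ _ ih
    push_cast at this ⊢
    convert this using 2 <;> ring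
  | pred n ih =>
    have := h.sub_half_pi ih
    push_cast at this ⊢
    convert this using 2 <;> ring

theorem add_int_mul_pi_snd (h : IsPlanarSymmetric C) (k : ℤ) {x y : ℝ} (hp : (x, y) ∈ C) :
    (x, y + k * Real.pi) ∈ C :=
  h.swap _ _ (h.add_int_mul_pi k (h.swap _ _ hp))

end IsPlanarSymmetric

namespace IsTangentInvariant

variable {lam : ℝ} {C : Set (ℝ × ℝ)}

theorem ray_iff (h : IsTangentInvariant lam C) {x s : ℝ} (hx : 0 < x) (hx4 : x ≤ Real.pi / 4)
    (hs : 0 ≤ s) (hs1 : s ≤ 1) : (x, s * x) ∈ C ↔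
      (lam / √(1 + s ^ 2) * Real.tan x, s * (lam / √(1 + s ^ 2) * Real.tan x)) ∈ C := by
  have h1 : s * x ≤ x := mul_le_of_le_one_left hx.le hs1
  rw [h.sector x (s * x) (by positivity) h1 hx (by linarith) (by linarith), sectorMap_ray hx hx4]

theorem isDiagonalTrace (h : IsTangentInvariant lam C) :
    IsDiagonalTrace (lam / √2) {t | (t, t) ∉ C} where
  isOpen := by
    have : Continuous fun t : ℝ => (t, t) := by fun_prop
    exact (h.isClosed.preimage this).isOpen_compl
  neg := fun t ht hc => ht (by simpa using h.neg_snd (h.neg_fst _ _ hc))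
  add_half_pi := fun t => (not_congr h.add_half_pi_iff).symm
  zero_notMem := fun hc => hc (h.axis 0)
  mem_iff := fun t ht ht4 => by
    have := h.ray_iff ht ht4 zero_le_one le_rfl
    norm_num at this
    exact not_congr this

end IsTangentInvariant

/-! ### Inequalities for reflected points -/

theorem concaveOn_arctan : ConcaveOn ℝ (Set.Ici (0 : ℝ)) Real.arctan := by
  apply AntitoneOn.concaveOn_of_deriv (convex_Ici 0) Real.continuous_arctan.continuousOn
    Real.differentiable_arctan.differentiableOn
  intro a ha b hb hab
  rw [interior_Ici] at ha hb
  simp only [Real.deriv_arctan]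
  have : 0 < a := ha
  gcongr

theorem mul_le_arctan {r : ℝ} (h0 : 0 ≤ r) (h1 : r ≤ 1) : Real.pi / 4 * r ≤ Real.arctan r := by
  have := concaveOn_arctan.2 (x := 0) (y := 1) (by simp) (by simp) (sub_nonneg.2 h1) h0 (by ring)
  simp only [smul_eq_mul, Real.arctan_zero, mul_zero, Real.arctan_one, mul_one, zero_add] at this
  linarith

/-- The Bernstein basis of degree `6` on `[11/20, 1]`, up to constants. A polynomial with positive
coefficients in this basis is positive there, which reduces the inequalities below to linear
arithmetic. -/
theorem bernstein_pos {s : ℝ} (h0 : 11 / 20 ≤ s) (h1 : s ≤ 1) (k : ℕ) :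
    0 ≤ (s - 11 / 20) ^ k * (1 - s) ^ (6 - k) :=
  mul_nonneg (pow_nonneg (by linarith) _) (pow_nonneg (by linarith) _)

/-- For `s ≤ 1` both `(1 - ξ) / (s (1 - s ξ))` and `(1 - ξ)² + (1 - s ξ)²` decrease in `ξ`. On `[x₁,
x₂]` it is therefore enough to take the first at `x₂` and the second at `x₁`, which leaves a
polynomial inequality in `s` alone. -/
theorem wedge_piece {c x₁ x₂ ξ s : ℝ} (hc : 0 ≤ c) (h1 : x₁ ≤ ξ) (h2 : ξ ≤ x₂) (hx : x₂ ≤ 1 / 2)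
    (hs0 : 11 / 20 ≤ s) (hs : s ≤ 1)
    (hp : c * (s * (1 - s * x₂)) ^ 2 * ((1 - x₁) ^ 2 + (1 - s * x₁) ^ 2)
      < (s * (1 - s * x₂) + (1 - x₂)) ^ 2) :
    c * (s * (1 - s * ξ)) ^ 2 * ((1 - ξ) ^ 2 + (1 - s * ξ) ^ 2)
      < (s * (1 - s * ξ) + (1 - ξ)) ^ 2 := by
  have hs' : 0 < s := by linarith
  have ha : 0 < 1 - s * x₂ := by nlinarith
  have ha' : 0 < 1 - s * ξ := by nlinarith
  have hsx : s * x₁ ≤ s * ξ := mul_le_mul_of_nonneg_left h1 hs'.le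
  set a := s * (1 - s * ξ) with hadef
  set b := s * (1 - s * x₂) with hbdef
  have hb0 : 0 < b := by positivity
  have ha0 : 0 < a := by positivity
  have hn : (1 - ξ) ^ 2 + (1 - s * ξ) ^ 2 ≤ (1 - x₁) ^ 2 + (1 - s * x₁) ^ 2 := by
    have e1 : 0 ≤ 1 - ξ := by linarith
    gcongr
  have hk : (b + (1 - x₂)) * a ≤ (a + (1 - ξ)) * b := by
    have : (1 - ξ) * (1 - s * x₂) - (1 - x₂) * (1 - s * ξ) = (x₂ - ξ) * (1 - s) := by ring
    have h3 : 0 ≤ s * ((x₂ - ξ) * (1 - s)) :=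
      mul_nonneg hs'.le (mul_nonneg (by linarith) (by linarith))
    rw [← this] at h3
    rw [hadef, hbdef]
    linarith
  have hk2 : ((b + (1 - x₂)) * a) ^ 2 ≤ ((a + (1 - ξ)) * b) ^ 2 := by
    have : 0 ≤ (b + (1 - x₂)) * a := mul_nonneg (by linarith) ha0.le
    gcongr
  have h5 : c * b ^ 2 * ((1 - x₁) ^ 2 + (1 - s * x₁) ^ 2) * a ^ 2 < (b + (1 - x₂)) ^ 2 * a ^ 2 :=
    mul_lt_mul_of_pos_right hp (by positivity)
  have h6 : c * a ^ 2 * ((1 - ξ) ^ 2 + (1 - s * ξ) ^ 2) * b ^ 2 ≤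
      c * b ^ 2 * ((1 - x₁) ^ 2 + (1 - s * x₁) ^ 2) * a ^ 2 := by
    have := mul_le_mul_of_nonneg_left hn (show 0 ≤ c * a ^ 2 * b ^ 2 by positivity)
    linarith
  have h7 : c * a ^ 2 * ((1 - ξ) ^ 2 + (1 - s * ξ) ^ 2) * b ^ 2 < (a + (1 - ξ)) ^ 2 * b ^ 2 := by
    rw [mul_pow, mul_pow] at hk2
    linarith
  exact lt_of_mul_lt_mul_right h7 (by positivity)

/-- This is `reflection_bound` squared and rescaled, with `ξ = x / (π/2)`, `h2 = (π/2)²` and `L =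
lam²`. The ratio `h2 / L` is bounded in two ways: by `8 ξ²`, which is effective for small `ξ`, and
by `24675 / 20000`, which is effective for large `ξ`. -/
theorem wedge_inequality {ξ s h2 L : ℝ} (hξ0 : 1 / 4 ≤ ξ) (hξ1 : ξ ≤ 1 / 2) (hs0 : 11 / 20 ≤ s)
    (hs1 : s ≤ 1) (hL : 2 ≤ L) (hh : h2 ≤ 24675 / 10000) (hLξ : h2 ≤ 8 * (L * ξ ^ 2)) :
    4 * (s * (1 - s * ξ)) ^ 2 * ((1 - ξ) ^ 2 + (1 - s * ξ) ^ 2) * h2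
      < L * (s * (1 - s * ξ) + (1 - ξ)) ^ 2 := by
  have hb := bernstein_pos hs0 hs1
  have hL0 : 0 < L := by linarith
  have big : ∀ x₁ x₂ : ℝ, x₁ ≤ ξ → ξ ≤ x₂ → x₂ ≤ 1 / 2 →
      4935 / 1000 * (s * (1 - s * x₂)) ^ 2 * ((1 - x₁) ^ 2 + (1 - s * x₁) ^ 2)
      < (s * (1 - s * x₂) + (1 - x₂)) ^ 2 →
      4 * (s * (1 - s * ξ)) ^ 2 * ((1 - ξ) ^ 2 + (1 - s * ξ) ^ 2) * h2
      < L * (s * (1 - s * ξ) + (1 - ξ)) ^ 2 := by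
    intro x₁ x₂ e1 e2 e3 hp
    have h5 := wedge_piece (by norm_num) e1 e2 e3 hs0 hs1 hp
    have h6 : 0 ≤ (s * (1 - s * ξ)) ^ 2 * ((1 - ξ) ^ 2 + (1 - s * ξ) ^ 2) := by positivity
    have h7 := mul_le_mul_of_nonneg_left hh h6
    have h8 : 2 * (s * (1 - s * ξ) + (1 - ξ)) ^ 2 ≤ L * (s * (1 - s * ξ) + (1 - ξ)) ^ 2 :=
      mul_le_mul_of_nonneg_right hL (sq_nonneg _)
    linarith
  have small : ∀ x₁ x₂ : ℝ, x₁ ≤ ξ → ξ ≤ x₂ → x₂ ≤ 1 / 2 →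
      32 * x₂ ^ 2 * (s * (1 - s * x₂)) ^ 2 * ((1 - x₁) ^ 2 + (1 - s * x₁) ^ 2)
      < (s * (1 - s * x₂) + (1 - x₂)) ^ 2 →
      4 * (s * (1 - s * ξ)) ^ 2 * ((1 - ξ) ^ 2 + (1 - s * ξ) ^ 2) * h2
      < L * (s * (1 - s * ξ) + (1 - ξ)) ^ 2 := by
    intro x₁ x₂ e1 e2 e3 hp
    have h5 := wedge_piece (by positivity) e1 e2 e3 hs0 hs1 hp
    have h6 : 0 ≤ (s * (1 - s * ξ)) ^ 2 * ((1 - ξ) ^ 2 + (1 - s * ξ) ^ 2) := by positivity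
    have hx : ξ ^ 2 ≤ x₂ ^ 2 := by
      have : 0 ≤ ξ := by linarith
      gcongr
    have h7 := mul_le_mul_of_nonneg_left
      (hLξ.trans (mul_le_mul_of_nonneg_left (mul_le_mul_of_nonneg_left hx hL0.le) (by norm_num : (0 : ℝ) ≤ 8))) h6
    have h8 := mul_lt_mul_of_pos_left h5 hL0
    linarith
  have b0 := hb 0
  have b1 := hb 1
  have b2 := hb 2
  have b3 := hb 3
  have b4 := hb 4
  have b5 := hb 5
  have b6 := hb 6
  norm_num at b0 b1 b2 b3 b4 b5 b6
  -- The cuts are fine enough for the one-variable inequality on each piece to follow from the seven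
  -- Bernstein terms. The cut `3/8` separates the two bounds on `h2 / L`.
  rcases le_total ξ (3 / 8) with h | h
  · rcases le_total ξ (27 / 80) with h' | h'
    · rcases le_total ξ (13 / 50) with h'' | h''
      · exact small (1 / 4) (13 / 50) hξ0 h'' (by norm_num) (by linarith)
      · exact small (13 / 50) (27 / 80) h'' h' (by norm_num) (by linarith)
    · exact small (27 / 80) (3 / 8) h' h (by norm_num) (by linarith)
  · rcases le_total ξ (2 / 5) with h' | h'
    · exact big (3 / 8) (2 / 5) h h' (by norm_num) (by linarith)
    · exact big (2 / 5) (1 / 2) h' hξ1 (by norm_num) (by linarith)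

theorem gain_gt_one {lam s : ℝ} (hlam : √2 < lam) (hs : 0 ≤ s) (hs1 : s ≤ 1) :
    1 < lam / √(1 + s ^ 2) := by
  have h1 : √(1 + s ^ 2) ≤ √2 := Real.sqrt_le_sqrt (by nlinarith)
  have h2 : 0 < √(1 + s ^ 2) := Real.sqrt_pos.2 (by positivity)
  rw [lt_div_iff₀ h2]; linarith

/-- If the ray of slope `s` is carried beyond the antidiagonal, then the reflection of `(x, s x)`
in the antidiagonal is not too far from the origin. -/
theorem reflection_bound {lam x s : ℝ} (hlamsq : 2 < lam ^ 2) (hlam0 : 0 < lam)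
    (hlamsq2 : lam ^ 2 < Real.pi ^ 2 / 2) (hx : 0 < x) (hx4 : x ≤ Real.pi / 4)
    (hs0 : 11 / 20 ≤ s) (hs1 : s ≤ 1)
    (hcase : Real.pi / 2 ≤ lam / √(1 + s ^ 2) * Real.tan x
      + s * (lam / √(1 + s ^ 2) * Real.tan x)) :
    2 * s * (Real.pi / 2 - s * x) *
        √((Real.pi / 2 - s * x) ^ 2 + (Real.pi / 2 - x) ^ 2)
      < lam * (s * (Real.pi / 2 - s * x) + (Real.pi / 2 - x)) := by
  have hpi := Real.pi_pos
  have hpi2 := Real.pi_lt_d4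
  have hsq0 : 0 < √(1 + s ^ 2) := Real.sqrt_pos.2 (by positivity)
  have hsq := Real.sq_sqrt (show 0 ≤ 1 + s ^ 2 by positivity)
  have htan0 : 0 < Real.tan x := Real.tan_pos_of_pos_of_lt_pi_div_two hx (by linarith)
  have htan : Real.tan x ≤ 4 * x / Real.pi := by
    have h1 : 4 * x / Real.pi ≤ 1 := by rw [div_le_one hpi]; linarith
    have h2 := mul_le_arctan (by positivity) h1
    rw [show Real.pi / 4 * (4 * x / Real.pi) = x by field_simp] at h2
    rw [← Real.tan_arctan (4 * x / Real.pi)]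
    rcases eq_or_lt_of_le h2 with h3 | h3
    · rw [← h3]
    · exact (Real.tan_lt_tan_of_lt_of_lt_pi_div_two (by linarith)
        (Real.arctan_lt_pi_div_two _) h3).le
  have h1 : Real.pi / 2 * √(1 + s ^ 2) ≤ lam * (4 * x / Real.pi) * (1 + s) := by
    have e1 : Real.pi / 2 ≤ lam * Real.tan x * (1 + s) / √(1 + s ^ 2) := by
      refine hcase.trans (le_of_eq (by ring))
    rw [le_div_iff₀ hsq0] at e1
    refine e1.trans ?_
    have : 0 ≤ 1 + s := by linarith
    gcongr
  -- The estimate `(1 + s)² ≤ 2 (1 + s²)` removes `s` from the squared hypothesis.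
  have h2 : Real.pi ^ 4 / 128 ≤ lam ^ 2 * x ^ 2 := by
    have e1 : (Real.pi / 2 * √(1 + s ^ 2)) ^ 2 ≤ (lam * (4 * x / Real.pi) * (1 + s)) ^ 2 := by
      gcongr
    rw [mul_pow, hsq] at e1
    have e2 : (lam * (4 * x / Real.pi) * (1 + s)) ^ 2 ≤
        (lam * (4 * x / Real.pi)) ^ 2 * (2 * (1 + s ^ 2)) := by
      rw [mul_pow]
      apply mul_le_mul_of_nonneg_left _ (sq_nonneg _)
      nlinarith [sq_nonneg (1 - s)]
    have e3 : (Real.pi / 2) ^ 2 ≤ (lam * (4 * x / Real.pi)) ^ 2 * 2 := by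
      have e4 : (Real.pi / 2) ^ 2 * (1 + s ^ 2) ≤
          (lam * (4 * x / Real.pi)) ^ 2 * 2 * (1 + s ^ 2) := by linarith
      exact le_of_mul_le_mul_right e4 (by positivity)
    rw [show (lam * (4 * x / Real.pi)) ^ 2 * 2 = 32 * (lam ^ 2 * x ^ 2) / Real.pi ^ 2 by
      field_simp; ring, le_div_iff₀ (by positivity)] at e3
    linarith [show (Real.pi / 2) ^ 2 * Real.pi ^ 2 = Real.pi ^ 4 / 4 by ring]
  have h3 : (Real.pi / 2) ^ 2 ≤ 8 * (lam ^ 2 * (x / (Real.pi / 2)) ^ 2) := by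
    rw [show 8 * (lam ^ 2 * (x / (Real.pi / 2)) ^ 2) = 32 * (lam ^ 2 * x ^ 2) / Real.pi ^ 2 by
      field_simp; ring, le_div_iff₀ (by positivity)]
    linarith [show (Real.pi / 2) ^ 2 * Real.pi ^ 2 = Real.pi ^ 4 / 4 by ring]
  -- This combines the lower bound on `lam² x²` with `lam² < π²/2`.
  have h4 : 1 / 4 ≤ x / (Real.pi / 2) := by
    have e1 : (1 / 4 : ℝ) ^ 2 ≤ (x / (Real.pi / 2)) ^ 2 := by
      have e2 : lam ^ 2 * (x / (Real.pi / 2)) ^ 2 ≤ Real.pi ^ 2 / 2 * (x / (Real.pi / 2)) ^ 2 := by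
        gcongr
      have e3 : Real.pi ^ 2 * (1 / 16) ≤ Real.pi ^ 2 * (x / (Real.pi / 2)) ^ 2 := by linarith
      have := le_of_mul_le_mul_left e3 (by positivity)
      linarith
    exact le_of_sq_le_sq e1 (by positivity)
  have h5 := wedge_inequality h4 (by rw [div_le_iff₀ (by positivity)]; linarith) hs0 hs1
    hlamsq.le (by nlinarith : (Real.pi / 2) ^ 2 ≤ 24675 / 10000) h3
  set ξ := x / (Real.pi / 2) with hξ
  have h6 : x = Real.pi / 2 * ξ := by rw [hξ]; field_simp
  have hsx : s * x ≤ x := mul_le_of_le_one_left hx.le hs1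
  have hpos : 0 ≤ lam * (s * (Real.pi / 2 - s * x) + (Real.pi / 2 - x)) := by
    have e1 : 0 ≤ Real.pi / 2 - s * x := by linarith
    have e2 : 0 ≤ Real.pi / 2 - x := by linarith
    positivity
  apply lt_of_pow_lt_pow_left₀ 2 hpos
  rw [mul_pow _ (√_), Real.sq_sqrt (by positivity), h6]
  have h7 := mul_lt_mul_of_pos_right h5 (show 0 < (Real.pi / 2) ^ 2 by positivity)
  calc _ = _ := by ring
    _ < _ := h7
    _ = _ := by ring

/-! ### The steepest ray and points of `C` on the diagonal -/

namespace IsTangentInvariant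

variable {lam : ℝ} {C : Set (ℝ × ℝ)}

/-- The orbit along a ray reaches the outer part of the central square. -/
theorem exists_outer (h : IsTangentInvariant lam C) (hlam : √2 < lam) {x s : ℝ} (hx : 0 < x)
    (hx4 : x ≤ Real.pi / 4) (hs : 0 ≤ s) (hs1 : s ≤ 1) (hC : (x, s * x) ∈ C) :
    ∃ x', 0 < x' ∧ x' ≤ Real.pi / 4 ∧ Real.pi / 4 ≤ lam / √(1 + s ^ 2) * Real.tan x' ∧
      (x', s * x') ∈ C := by
  set r := lam / √(1 + s ^ 2) with hr
  have hr1 : 1 < r := gain_gt_one hlam hs hs1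
  by_contra hcon
  push Not at hcon
  have step : ∀ n : ℕ, ∃ x', 0 < x' ∧ x' ≤ Real.pi / 4 ∧ r ^ n * x ≤ x' ∧ (x', s * x') ∈ C := by
    intro n
    induction n with
    | zero => exact ⟨x, hx, hx4, by simp, hC⟩
    | succ n ih =>
      obtain ⟨x', h1, h2, h3, h4⟩ := ih
      have h5 : r * Real.tan x' < Real.pi / 4 := by
        by_contra h6
        exact hcon x' h1 h2 (not_lt.1 h6) h4
      have h6 := Real.lt_tan h1 (by linarith [Real.pi_pos])
      refine ⟨r * Real.tan x', mul_pos (by linarith) (h1.trans h6), h5.le, ?_, (h.ray_iff h1 h2 hs hs1).1 h4⟩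
      rw [pow_succ]
      have : r * (r ^ n * x) ≤ r * Real.tan x' :=
        mul_le_mul_of_nonneg_left (h3.trans h6.le) (by linarith)
      linarith
  obtain ⟨n, hn⟩ := ((tendsto_pow_atTop_atTop_of_one_lt hr1).eventually_gt_atTop
    (Real.pi / 4 / x)).exists
  obtain ⟨x', -, h2, h3, -⟩ := step n
  rw [div_lt_iff₀ hx] at hn
  linarith

/-- Among the rays of slope in `[0, 1]` that meet `C` near the origin, there is a steepest one. -/
theorem exists_steepest_ray (h : IsTangentInvariant lam C) (hlam : √2 < lam) :
    ∃ x₀ s₀ : ℝ, 0 < x₀ ∧ x₀ ≤ Real.pi / 4 ∧ 0 ≤ s₀ ∧ s₀ ≤ 1 ∧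
      Real.pi / 4 ≤ lam / √(1 + s₀ ^ 2) * Real.tan x₀ ∧ (x₀, s₀ * x₀) ∈ C ∧
      ∀ u v : ℝ, 0 < u → v ≤ u → s₀ * u < v → u ^ 2 + v ^ 2 ≤ lam ^ 2 → (u, v) ∉ C := by
  have hpi := Real.pi_pos
  have hlam0 : 0 < lam := lt_trans (by positivity) hlam
  -- Points of `C` in polar form `(x, s)` on the outer part of their ray. The condition `lam / √(1 +
  -- s²) * tan x ≥ π/4` is written with `arctan` so that it is visibly closed; it also keeps `x`
  -- away from `0`, and compactness then yields a maximal slope.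
  set K : Set (ℝ × ℝ) := (Set.Icc 0 (Real.pi / 4) ×ˢ Set.Icc 0 1) ∩
    ({p | Real.arctan (Real.pi / 4 * √(1 + p.2 ^ 2) / lam) ≤ p.1} ∩
      (fun p : ℝ × ℝ => (p.1, p.2 * p.1)) ⁻¹' C) with hK
  have hKc : IsCompact K := by
    apply (isCompact_Icc.prod isCompact_Icc).inter_right
    apply IsClosed.inter
    · exact isClosed_le (by fun_prop) continuous_fst
    · exact h.isClosed.preimage (by fun_prop)
  have hmemK : ∀ x s : ℝ, 0 < x → x ≤ Real.pi / 4 → 0 ≤ s → s ≤ 1 →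
      Real.pi / 4 ≤ lam / √(1 + s ^ 2) * Real.tan x → (x, s * x) ∈ C → (x, s) ∈ K := by
    intro x s h1 h2 h3 h4 h5 h6
    refine ⟨⟨⟨h1.le, h2⟩, h3, h4⟩, ?_, h6⟩
    simp only [Set.mem_ofPred_eq]
    rw [← Real.arctan_tan (x := x) (by linarith) (by linarith)]
    apply Real.arctan_strictMono.monotone
    have : 0 < √(1 + s ^ 2) := Real.sqrt_pos.2 (by positivity)
    rw [div_le_iff₀ hlam0, ← le_div_iff₀ this]
    linarith [h5, show lam / √(1 + s ^ 2) * Real.tan x = Real.tan x * lam / √(1 + s ^ 2) by ring]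
  have hne : K.Nonempty := by
    obtain ⟨x', h1, h2, h3, h4⟩ := h.exists_outer hlam (x := Real.pi / 4) (s := 0) (by positivity)
      le_rfl le_rfl zero_le_one (by rw [zero_mul]; exact h.axis _)
    exact ⟨_, hmemK x' 0 h1 h2 le_rfl zero_le_one h3 h4⟩
  obtain ⟨⟨x₀, s₀⟩, hp, hmax⟩ := hKc.exists_isMaxOn hne continuous_snd.continuousOn
  obtain ⟨⟨⟨hx0, hx4⟩, hs0, hs1⟩, ha, hpC⟩ := hp
  simp only [Set.mem_ofPred_eq, Set.mem_preimage] at hx0 hx4 hs0 hs1 ha hpC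
  have hsq : 0 < √(1 + s₀ ^ 2) := Real.sqrt_pos.2 (by positivity)
  have hxpos : 0 < x₀ := lt_of_lt_of_le (Real.arctan_pos.2 (by positivity)) ha
  refine ⟨x₀, s₀, hxpos, hx4, hs0, hs1, ?_, hpC, ?_⟩
  · have h1 : Real.pi / 4 * √(1 + s₀ ^ 2) / lam ≤ Real.tan x₀ := by
      rw [← Real.tan_arctan (Real.pi / 4 * √(1 + s₀ ^ 2) / lam)]
      rcases eq_or_lt_of_le ha with h2 | h2
      · rw [h2]
      · exact (Real.tan_lt_tan_of_lt_of_lt_pi_div_two (Real.neg_pi_div_two_lt_arctan _)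
          (by linarith) h2).le
    rw [div_le_iff₀ hlam0, ← le_div_iff₀ hsq] at h1
    linarith [show lam / √(1 + s₀ ^ 2) * Real.tan x₀ = Real.tan x₀ * lam / √(1 + s₀ ^ 2) by ring]
  · intro u v hu hvu hsv hnorm hC
    set s := v / u with hs
    have hv : v = s * u := by rw [hs]; field_simp
    have hss : s₀ < s := by rw [hs, lt_div_iff₀ hu]; exact hsv
    have hs1' : s ≤ 1 := by rw [hs, div_le_one hu]; exact hvu
    have hs0' : 0 ≤ s := by linarith
    have hq : 0 < √(1 + s ^ 2) := Real.sqrt_pos.2 (by positivity)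
    have hr : 0 < lam / √(1 + s ^ 2) := by positivity
    have hle : u / (lam / √(1 + s ^ 2)) ≤ 1 := by
      rw [div_le_one hr, le_div_iff₀ hq]
      apply le_of_sq_le_sq _ hlam0.le
      rw [mul_pow, Real.sq_sqrt (by positivity)]
      rw [hv] at hnorm
      linarith
    -- A point of norm at most `lam` is the image of a point of the same ray with `x ≤ π/4`; pushing
    -- that preimage outwards puts its slope in competition with `s₀`.
    have hx : 0 < Real.arctan (u / (lam / √(1 + s ^ 2))) := Real.arctan_pos.2 (by positivity)
    have hx' : Real.arctan (u / (lam / √(1 + s ^ 2))) ≤ Real.pi / 4 := by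
      rw [← Real.arctan_one]; exact Real.arctan_strictMono.monotone hle
    have hC' := (h.ray_iff hx hx' hs0' hs1').2 (by
      rw [Real.tan_arctan, mul_div_cancel₀ _ hr.ne', ← hv]; exact hC)
    obtain ⟨x', h1, h2, h3, h4⟩ := h.exists_outer hlam hx hx' hs0' hs1' hC'
    exact absurd (hmax (hmemK x' s h1 h2 hs0' hs1' h3 h4)) (not_le.2 hss)

/-- The corner `(π/2, π/2)` is a translate of the origin and hence lies in `C`. Its preimage on the
antidiagonal has slope greater than `11/20` and norm below `lam`, so `s₀` cannot be smaller than
`11/20`. -/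
theorem steepest_slope_ge (h : IsTangentInvariant lam C) (hlam : √2 < lam)
    (hκ : lam / √2 < Real.pi / 2) {s₀ : ℝ} (hs0 : 0 ≤ s₀)
    (hW : ∀ u v : ℝ, 0 < u → v ≤ u → s₀ * u < v → u ^ 2 + v ^ 2 ≤ lam ^ 2 → (u, v) ∉ C) :
    11 / 20 ≤ s₀ := by
  have hpi := Real.pi_pos
  have hpi1 := Real.pi_gt_d4
  have hpi2 := Real.pi_lt_d4
  have h2 : 0 < √2 := by positivity
  have hlam0 : 0 < lam := h2.trans hlam
  have hκ1 : 1 < lam / √2 := by rwa [one_lt_div h2]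
  have hlamsq : 2 < lam ^ 2 := by
    have := Real.sq_sqrt (show (0 : ℝ) ≤ 2 by norm_num)
    nlinarith
  set T := Real.pi / 2 / (lam / √2) with hT
  have hT1 : 1 < T := by rw [hT, one_lt_div (by linarith)]; exact hκ
  have hT2 : T < Real.pi / 2 := by
    rw [hT]; exact div_lt_self (by linarith) hκ1
  set M := Real.pi / 2 - Real.arctan T with hM
  have hx1 : Real.pi / 4 < Real.arctan T := by
    rw [← Real.arctan_one]; exact Real.arctan_strictMono hT1
  have hx2 := Real.arctan_lt_pi_div_two T
  -- The bound is `(T - 1) / (T + 1)` with `T < π/2`.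
  have hx3 : Real.arctan T - Real.pi / 4 ≤ 2221 / 10000 := by
    have h3 := tan_sub_tan_ge (a := Real.pi / 4) (b := Real.arctan T) (by linarith) hx1.le hx2
    rw [Real.tan_pi_div_four, Real.tan_arctan] at h3
    nlinarith
  have hC : (Real.arctan T, M) ∈ C := by
    have h4 := sectorMap_ray_right (lam := lam) (M := M) (σ := 1) (by linarith) (by linarith)
    have h5 : Real.tan M = T⁻¹ := by rw [hM, Real.tan_pi_div_two_sub, Real.tan_arctan]
    have h6 : lam / √2 * T = Real.pi / 2 := by rw [hT]; field_simp
    rw [h5] at h4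
    norm_num at h4
    rw [h6] at h4
    rw [h.sector _ _ (by linarith) (by linarith) (by linarith) hx2 (by linarith)]
    rw [show Real.arctan T = Real.pi / 2 - M by rw [hM]; ring, h4]
    simpa using h.add_half_pi 0 0 (h.axis 0)
  by_contra hcon
  push Not at hcon
  refine hW _ _ (by linarith) (by linarith) ?_ ?_ hC
  · nlinarith
  · rw [hM]; nlinarith

/-- A point outside the disk of radius `lam` is not excluded by `hW` directly, but its preimage in
the chart at the pole `(π/2, 0)` is. By `arctan r ≥ (π/4) r`, the hypothesis `hkey` is exactly what
makes this preimage steeper than `s`. -/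
theorem far_reflection_notMem (h : IsTangentInvariant lam C) (hlamsq : 2 < lam ^ 2)
    (hlam0 : 0 < lam) {X Y s : ℝ} (hX0 : 0 < X) (hXY : X < Y) (hspos : 0 < s)
    (hN : lam ^ 2 < Y ^ 2 + X ^ 2) (hX : X ≤ Real.pi / 2) (hY : Y ≤ Real.pi / 2)
    (hkey : 2 * s * Y * √(Y ^ 2 + X ^ 2) < lam * (s * Y + X))
    (hW : ∀ u v : ℝ, 0 < u → v ≤ u → s * u < v → u ^ 2 + v ^ 2 ≤ lam ^ 2 → (u, v) ∉ C) :
    (Y, X) ∉ C := by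
  intro hA
  have hpi := Real.pi_pos
  have hpi2 := Real.pi_lt_d4
  have hY0 : 0 < Y := hX0.trans hXY
  set N := √(Y ^ 2 + X ^ 2) with hNdef
  have hNsq : N ^ 2 = Y ^ 2 + X ^ 2 := Real.sq_sqrt (by positivity)
  have hN0 : 0 < N := Real.sqrt_pos.2 (by positivity)
  have hlamN : lam < N := by
    rw [hNdef]; exact Real.lt_sqrt_of_sq_lt hN
  set M := Real.arctan (lam / N) with hM
  have hM1 : M ≤ Real.pi / 4 := by
    rw [← Real.arctan_one]
    exact Real.arctan_strictMono.monotone (by rw [div_le_one hN0]; exact hlamN.le)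
  have hM0 : 0 < M := Real.arctan_pos.2 (by positivity)
  have hM2 : Real.pi / 4 * (lam / N) ≤ M :=
    mul_le_arctan (by positivity) (by rw [div_le_one hN0]; exact hlamN.le)
  have hσ1 : X / Y < 1 := by rw [div_lt_one hY0]; exact hXY
  have hσ0 : 0 < X / Y := by positivity
  have hq := sectorMap_ray_right (lam := lam) (M := M) (σ := X / Y) hM0 hM1
  have hroot : √(1 + (X / Y) ^ 2) = N / Y := by
    rw [hNdef, show 1 + (X / Y) ^ 2 = (Y ^ 2 + X ^ 2) / Y ^ 2 by field_simp,
      Real.sqrt_div (by positivity), Real.sqrt_sq hY0.le]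
  have hσM : X / Y * M < M := mul_lt_of_lt_one_left hM0 hσ1
  have hqC : (Real.pi / 2 - M, X / Y * M) ∈ C := by
    rw [h.sector _ _ (by positivity) (by linarith) (by linarith) (by linarith) (by linarith),
      hq, hroot, hM, Real.tan_arctan]
    convert hA using 2 <;> field_simp
  have hN2 : N ^ 2 ≤ Real.pi ^ 2 / 2 := by
    rw [hNsq]
    have e1 : Y ^ 2 ≤ (Real.pi / 2) ^ 2 := by
      have : Y ≤ Real.pi / 2 := by linarith
      gcongr
    have e2 : X ^ 2 ≤ (Real.pi / 2) ^ 2 := by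
      have : X ≤ Real.pi / 2 := by linarith
      gcongr
    linarith
  -- Here `lam² > 2` and `N² ≤ π²/2` give `lam / N ≥ 2/π`.
  have hMhalf : 1 / 2 ≤ M := by
    refine le_trans ?_ hM2
    rw [← mul_div_assoc, le_div_iff₀ hN0]
    have : (1 / 2 * N) ^ 2 ≤ (Real.pi / 4 * lam) ^ 2 := by nlinarith
    exact le_of_sq_le_sq this (by positivity)
  refine hW _ _ (by linarith) (by linarith) ?_ ?_ hqC
  · have e1 : s * (Real.pi / 2) < M * (X / Y + s) := by
      have e2 : Real.pi / 4 * (lam / N) * (X / Y + s) ≤ M * (X / Y + s) :=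
        mul_le_mul_of_nonneg_right hM2 (by positivity)
      refine lt_of_lt_of_le ?_ e2
      rw [show Real.pi / 4 * (lam / N) * (X / Y + s) =
        Real.pi / 4 * (lam * (s * Y + X)) / (N * Y) by field_simp; ring, lt_div_iff₀ (by positivity)]
      have e3 := mul_lt_mul_of_pos_left hkey (show 0 < Real.pi / 4 by positivity)
      linarith
    linarith
  · have e1 : (X / Y * M) ^ 2 ≤ (Real.pi / 4) ^ 2 := by
      have : X / Y * M ≤ Real.pi / 4 := by linarith
      have : 0 ≤ X / Y * M := by positivity
      gcongr
    have e2 : (Real.pi / 2 - M) ^ 2 ≤ (11 / 10) ^ 2 := by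
      have : 0 ≤ Real.pi / 2 - M := by linarith
      have : Real.pi / 2 - M ≤ 11 / 10 := by linarith
      gcongr
    have e3 : (Real.pi / 4) ^ 2 ≤ (8 / 10) ^ 2 := by
      have : Real.pi / 4 ≤ 8 / 10 := by linarith
      gcongr
    linarith

/-- If the diagonal segment misses `C`, then the steepest slope `s` is less than `1`. Reflection in
the antidiagonal makes a point of this ray steeper precisely when the point lies below the
antidiagonal. It is applied to the image of the extremal point, or to the point itself if the image
has crossed the antidiagonal. -/
theorem exists_diagonal_mem (h : IsTangentInvariant lam C) (hlam : √2 < lam)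
    (hκ : lam / √2 < Real.pi / 2) : ∃ t ∈ Set.Ioo 0 (Real.pi / 2), (t, t) ∈ C := by
  by_contra hcon
  push Not at hcon
  have hpi := Real.pi_pos
  have hpi1 := Real.pi_gt_d4
  have hpi2 := Real.pi_lt_d4
  have h2 : 0 < √2 := by positivity
  have hlam0 : 0 < lam := h2.trans hlam
  have h2sq := Real.sq_sqrt (show (0 : ℝ) ≤ 2 by norm_num)
  have hlamsq : 2 < lam ^ 2 := by nlinarith
  have hlamsq2 : lam ^ 2 < Real.pi ^ 2 / 2 := by
    rw [div_lt_iff₀ h2] at hκ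
    have : lam ^ 2 < (Real.pi / 2 * √2) ^ 2 := by gcongr
    rw [mul_pow, h2sq] at this
    linarith
  obtain ⟨x, s, hx, hx4, hs0, hs1, hout, hC, hW⟩ := h.exists_steepest_ray hlam
  have hs55 := h.steepest_slope_ge hlam hκ hs0 hW
  have hslt : s < 1 := by
    refine lt_of_le_of_ne hs1 ?_
    rintro rfl
    rw [one_mul] at hC
    exact hcon x ⟨hx, by linarith⟩ hC
  have hspos : 0 < s := by linarith
  have hr := gain_gt_one hlam hs0 hs1
  set r := lam / √(1 + s ^ 2) with hrdef
  have hsq0 : 0 < √(1 + s ^ 2) := Real.sqrt_pos.2 (by positivity)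
  have hsq := Real.sq_sqrt (show 0 ≤ 1 + s ^ 2 by positivity)
  have hC' := (h.ray_iff hx hx4 hs0 hs1).1 hC
  set x' := r * Real.tan x with hx'
  rcases lt_or_ge (x' + s * x') (Real.pi / 2) with hcase | hcase
  · have hA := h.reflect hC'
    refine hW _ _ ?_ ?_ ?_ ?_ hA
    · nlinarith
    · nlinarith
    · nlinarith
    · have e1 : Real.pi / 2 - x' ≤ Real.pi / 4 := by linarith
      have e0 : 0 ≤ Real.pi / 2 - x' := by nlinarith
      -- Here `29/20 = 2 - 11/20`, from `x' ≥ π/4` and `s ≥ 11/20`.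
      have e2 : Real.pi / 2 - s * x' ≤ 29 / 20 * (Real.pi / 4) := by nlinarith
      have e3 : 0 ≤ Real.pi / 2 - s * x' := by nlinarith
      have e4 : (Real.pi / 2 - x') ^ 2 ≤ (Real.pi / 4) ^ 2 := by gcongr
      have e5 : (Real.pi / 2 - s * x') ^ 2 ≤ (29 / 20 * (Real.pi / 4)) ^ 2 := by gcongr
      nlinarith
  · have hA := h.reflect hC
    have hsx : s * x < x := by nlinarith
    have hsx0 : 0 < s * x := by positivity
    set X := Real.pi / 2 - x with hX
    set Y := Real.pi / 2 - s * x with hY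
    have hX0 : 0 < X := by linarith
    have hXY : X < Y := by linarith
    have hY0 : 0 < Y := by linarith
    have hσ : s * Y < X := by
      rw [hX, hY]
      nlinarith
    rcases le_or_gt (Y ^ 2 + X ^ 2) (lam ^ 2) with hN | hN
    · exact hW _ _ hY0 hXY.le hσ hN hA
    · refine h.far_reflection_notMem hlamsq hlam0 hX0 hXY hspos hN ?_ ?_ ?_ hW hA
      · linarith
      · linarith
      · exact reflection_bound hlamsq hlam0 hlamsq2 hx hx4 hs55 hs1 hcase

end IsTangentInvariant

/-! ### Expansion of area and folding into the chamber -/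

open MeasureTheory

/-- The inverse of the tangent map on the sector `0 ≤ v ≤ u`. -/
noncomputable def sectorInv (lam : ℝ) (q : ℝ × ℝ) : ℝ × ℝ :=
  (Real.arctan (√(q.1 ^ 2 + q.2 ^ 2) / lam),
    q.2 / q.1 * min (Real.arctan (√(q.1 ^ 2 + q.2 ^ 2) / lam))
      (Real.pi / 2 - Real.arctan (√(q.1 ^ 2 + q.2 ^ 2) / lam)))

theorem sectorInv_sectorMap {lam x y : ℝ} (hlam : 0 < lam) (hx : 0 < x) (hx2 : x < Real.pi / 2) :
    sectorInv lam (sectorMap lam x y) = (x, y) := by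
  have hT : 0 < Real.tan x := Real.tan_pos_of_pos_of_lt_pi_div_two hx hx2
  have hm : 0 < min x (Real.pi / 2 - x) := lt_min hx (by linarith)
  set m := min x (Real.pi / 2 - x) with hmdef
  have hρ : 0 < √(m ^ 2 + y ^ 2) := Real.sqrt_pos.2 (by positivity)
  have hρ2 : √(m ^ 2 + y ^ 2) ^ 2 = m ^ 2 + y ^ 2 := Real.sq_sqrt (by positivity)
  have hnorm : √((sectorMap lam x y).1 ^ 2 + (sectorMap lam x y).2 ^ 2) = lam * Real.tan x := by
    rw [show (sectorMap lam x y).1 ^ 2 + (sectorMap lam x y).2 ^ 2 = (lam * Real.tan x) ^ 2 by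
      simp only [sectorMap, ← hmdef]
      rw [div_pow, div_pow, hρ2]
      field_simp]
    exact Real.sqrt_sq (by positivity)
  have hslope : (sectorMap lam x y).2 / (sectorMap lam x y).1 = y / m := by
    simp only [sectorMap, ← hmdef]
    field_simp
  unfold sectorInv
  rw [hnorm, hslope, mul_div_cancel_left₀ _ hlam.ne', Real.arctan_tan (by linarith) hx2, ← hmdef]
  ext <;> simp only
  field_simp

theorem sectorMap_sectorInv {lam : ℝ} {q : ℝ × ℝ} (hlam : 0 < lam) (hq : 0 < q.1) :
    sectorMap lam (sectorInv lam q).1 (sectorInv lam q).2 = q := by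
  have hN : 0 < √(q.1 ^ 2 + q.2 ^ 2) := Real.sqrt_pos.2 (by positivity)
  set N := √(q.1 ^ 2 + q.2 ^ 2) with hNdef
  have hx : 0 < Real.arctan (N / lam) := Real.arctan_pos.2 (by positivity)
  have hx2 := Real.arctan_lt_pi_div_two (N / lam)
  have hm : 0 < min (Real.arctan (N / lam)) (Real.pi / 2 - Real.arctan (N / lam)) :=
    lt_min hx (by linarith)
  set m := min (Real.arctan (N / lam)) (Real.pi / 2 - Real.arctan (N / lam)) with hmdef
  have hρ : √(m ^ 2 + (q.2 / q.1 * m) ^ 2) = m * (N / q.1) := by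
    rw [show m ^ 2 + (q.2 / q.1 * m) ^ 2 = (m / q.1) ^ 2 * (q.1 ^ 2 + q.2 ^ 2) by field_simp,
      Real.sqrt_mul (by positivity), Real.sqrt_sq (by positivity)]
    ring
  simp only [sectorMap, sectorInv, ← hNdef, ← hmdef]
  rw [hρ, Real.tan_arctan]
  ext <;> simp only <;> field_simp

theorem sectorInv_mem {lam : ℝ} {q : ℝ × ℝ} (hlam : 0 < lam) (hq1 : 0 < q.1) (hq : 0 ≤ q.2)
    (hq' : q.2 ≤ q.1) :
    0 ≤ (sectorInv lam q).2 ∧ (sectorInv lam q).2 ≤ (sectorInv lam q).1 ∧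
      0 < (sectorInv lam q).1 ∧ (sectorInv lam q).1 < Real.pi / 2 ∧
      (sectorInv lam q).1 + (sectorInv lam q).2 ≤ Real.pi / 2 := by
  have hN : 0 < √(q.1 ^ 2 + q.2 ^ 2) := Real.sqrt_pos.2 (by positivity)
  have hx : 0 < Real.arctan (√(q.1 ^ 2 + q.2 ^ 2) / lam) := Real.arctan_pos.2 (by positivity)
  have hx2 := Real.arctan_lt_pi_div_two (√(q.1 ^ 2 + q.2 ^ 2) / lam)
  unfold sectorInv
  set x := Real.arctan (√(q.1 ^ 2 + q.2 ^ 2) / lam)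
  have hm : 0 < min x (Real.pi / 2 - x) := lt_min hx (by linarith)
  have h1 : q.2 / q.1 ≤ 1 := by rwa [div_le_one hq1]
  have h2 : q.2 / q.1 * min x (Real.pi / 2 - x) ≤ min x (Real.pi / 2 - x) :=
    mul_le_of_le_one_left hm.le h1
  refine ⟨by positivity, h2.trans (min_le_left _ _), hx, hx2, ?_⟩
  have := h2.trans (min_le_right _ _)
  simp only
  linarith

theorem sectorMap_mem_closedSector {lam x y : ℝ} (hlam : 0 < lam) (hx : 0 < x)
    (hx2 : x < Real.pi / 2) (hy : 0 ≤ y) (hyx : y ≤ x) (hxy : x + y ≤ Real.pi / 2) :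
    0 < (sectorMap lam x y).1 ∧ 0 ≤ (sectorMap lam x y).2 ∧
      (sectorMap lam x y).2 ≤ (sectorMap lam x y).1 := by
  have hT : 0 < Real.tan x := Real.tan_pos_of_pos_of_lt_pi_div_two hx hx2
  have hm : y ≤ min x (Real.pi / 2 - x) := le_min hyx (by linarith)
  have hm0 : 0 < min x (Real.pi / 2 - x) := lt_min hx (by linarith)
  unfold sectorMap
  set m := min x (Real.pi / 2 - x)
  have hρ : 0 < √(m ^ 2 + y ^ 2) := Real.sqrt_pos.2 (by positivity)
  exact ⟨by positivity, by positivity, by simp only; gcongr⟩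

theorem sectorMap_mem {lam x y : ℝ} (hlam : 0 < lam) (hy : 0 < y) (hyx : y < x)
    (hxy : x + y < Real.pi / 2) :
    0 < (sectorMap lam x y).2 ∧ (sectorMap lam x y).2 < (sectorMap lam x y).1 := by
  have hx : 0 < x := hy.trans hyx
  have hT : 0 < Real.tan x := Real.tan_pos_of_pos_of_lt_pi_div_two hx (by linarith)
  have hm : y < min x (Real.pi / 2 - x) := lt_min hyx (by linarith)
  unfold sectorMap
  set m := min x (Real.pi / 2 - x)
  have hρ : 0 < √(m ^ 2 + y ^ 2) := Real.sqrt_pos.2 (by positivity)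
  exact ⟨by positivity, by simp only; gcongr⟩

theorem continuousAt_sectorInv {lam : ℝ} {q : ℝ × ℝ} (hq : 0 < q.1) :
    ContinuousAt (sectorInv lam) q := by
  have h1 : ContinuousAt (fun q : ℝ × ℝ => q.2 / q.1) q :=
    continuousAt_snd.div continuousAt_fst hq.ne'
  have h2 : Continuous fun q : ℝ × ℝ => Real.arctan (√(q.1 ^ 2 + q.2 ^ 2) / lam) := by fun_prop
  exact h2.continuousAt.prodMk
    (h1.mul (h2.continuousAt.min (continuousAt_const.sub h2.continuousAt)))

theorem continuousAt_sectorMap {lam : ℝ} {p : ℝ × ℝ} (hx : 0 < p.1) (hx2 : p.1 < Real.pi / 2) :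
    ContinuousAt (fun p : ℝ × ℝ => sectorMap lam p.1 p.2) p := by
  have hm : 0 < min p.1 (Real.pi / 2 - p.1) := lt_min hx (by linarith)
  have hρ : 0 < √(min p.1 (Real.pi / 2 - p.1) ^ 2 + p.2 ^ 2) := Real.sqrt_pos.2 (by positivity)
  have h1 : ContinuousAt (fun p : ℝ × ℝ => Real.tan p.1) p :=
    ContinuousAt.comp (f := Prod.fst) (Real.continuousAt_tan.2
      (Real.cos_pos_of_mem_Ioo ⟨by linarith, hx2⟩).ne') continuousAt_fst
  have h2 : Continuous fun p : ℝ × ℝ => √(min p.1 (Real.pi / 2 - p.1) ^ 2 + p.2 ^ 2) := by fun_prop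
  have h3 : Continuous fun p : ℝ × ℝ => min p.1 (Real.pi / 2 - p.1) := by fun_prop
  unfold sectorMap
  exact (((continuousAt_const.mul h1).mul h3.continuousAt).div h2.continuousAt hρ.ne').prodMk
    (((continuousAt_const.mul h1).mul continuousAt_snd).div h2.continuousAt hρ.ne')

theorem det_prod_eq (L : ℝ × ℝ →L[ℝ] ℝ × ℝ) :
    L.det = (L (1, 0)).1 * (L (0, 1)).2 - (L (0, 1)).1 * (L (1, 0)).2 := by
  rw [ContinuousLinearMap.det, ← LinearMap.det_toMatrix (Module.Basis.finTwoProd ℝ),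
    Matrix.det_fin_two]
  simp [LinearMap.toMatrix_apply]

/-- The Jacobian of the tangent map in a chart centred at a zero or a pole. -/
theorem exists_hasFDerivAt_chart {lam a ε x y : ℝ} (hcos : 0 < Real.cos x)
    (hm : 0 < a + ε * x) :
    ∃ L : ℝ × ℝ →L[ℝ] ℝ × ℝ,
      HasFDerivAt (fun p : ℝ × ℝ =>
        (lam * Real.tan p.1 * (a + ε * p.1) / √((a + ε * p.1) ^ 2 + p.2 ^ 2),
          lam * Real.tan p.1 * p.2 / √((a + ε * p.1) ^ 2 + p.2 ^ 2))) L (x, y) ∧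
      L.det = lam ^ 2 * Real.tan x * (a + ε * x) /
        (Real.cos x ^ 2 * ((a + ε * x) ^ 2 + y ^ 2)) := by
  have hfst : HasFDerivAt (fun p : ℝ × ℝ => p.1) (ContinuousLinearMap.fst ℝ ℝ ℝ) (x, y) :=
    hasFDerivAt_fst
  have hsnd : HasFDerivAt (fun p : ℝ × ℝ => p.2) (ContinuousLinearMap.snd ℝ ℝ ℝ) (x, y) :=
    hasFDerivAt_snd
  have htan := ((Real.hasDerivAt_tan hcos.ne').comp_hasFDerivAt (x, y) hfst).const_mul lam
  have hmd := (hfst.const_mul ε).const_add a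
  have hS : 0 < (a + ε * x) ^ 2 + y ^ 2 := by positivity
  have hr := ((hmd.pow 2).add (hsnd.pow 2)).sqrt hS.ne'
  have hρ : 0 < √((a + ε * x) ^ 2 + y ^ 2) := Real.sqrt_pos.2 hS
  have hinv := (hasDerivAt_inv hρ.ne').comp_hasFDerivAt (x, y) hr
  have h1 := (htan.mul hmd).mul hinv
  have h2 := (htan.mul hsnd).mul hinv
  refine ⟨_, h1.prodMk h2, ?_⟩
  rw [det_prod_eq]
  have hρ2 : √((a + ε * x) ^ 2 + y ^ 2) ^ 2 = (a + ε * x) ^ 2 + y ^ 2 := Real.sq_sqrt hS.le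
  simp
  rw [show 2 * a + 2 * (ε * x) = 2 * (a + ε * x) by ring]
  clear h1 h2 hinv hr hmd
  generalize a + ε * x = m at *
  generalize √(m ^ 2 + y ^ 2) = ρ at *
  rw [← hρ2]
  generalize Real.tan x = T at *
  generalize Real.cos x = c at *
  field_simp
  linear_combination lam ^ 2 * T * (T * ε * c ^ 2) * ρ ^ 2 * hρ2

/-- Away from the line `x = π / 4` the tangent map expands areas. -/
theorem exists_hasFDerivAt_sectorMap {lam x y : ℝ} (hy : 0 < y) (hyx : y < x)
    (hxy : x + y < Real.pi / 2) (hx : x ≠ Real.pi / 4) :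
    ∃ L : ℝ × ℝ →L[ℝ] ℝ × ℝ,
      HasFDerivAt (fun p : ℝ × ℝ => sectorMap lam p.1 p.2) L (x, y) ∧ lam ^ 2 / 2 ≤ |L.det| := by
  have hpi := Real.pi_pos
  have hx0 : 0 < x := hy.trans hyx
  have hcos : 0 < Real.cos x := Real.cos_pos_of_mem_Ioo ⟨by linarith, by linarith⟩
  have hcos1 : Real.cos x ^ 2 ≤ 1 := Real.cos_sq_le_one x
  have hTx : x < Real.tan x := Real.lt_tan hx0 (by linarith)
  rcases lt_or_gt_of_ne hx with h4 | h4
  · obtain ⟨L, hL, hdet⟩ := exists_hasFDerivAt_chart (lam := lam) (a := 0) (ε := 1) (x := x)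
      (y := y) hcos (by linarith)
    refine ⟨L, hL.congr_of_eventuallyEq ?_, ?_⟩
    · have : ∀ᶠ p : ℝ × ℝ in 𝓝 (x, y), p.1 < Real.pi / 4 :=
        continuous_fst.continuousAt.eventually_lt continuousAt_const h4
      filter_upwards [this] with p hp
      have : min p.1 (Real.pi / 2 - p.1) = 0 + 1 * p.1 := by
        rw [min_eq_left (by linarith)]; ring
      simp only [sectorMap, this]
    · rw [hdet, zero_add, one_mul]
      refine le_trans ?_ (le_abs_self _)
      rw [div_le_div_iff₀ (by norm_num) (by positivity)]
      have e1 : Real.cos x ^ 2 * (x ^ 2 + y ^ 2) ≤ 1 * (x ^ 2 + x ^ 2) := by gcongr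
      have e2 : x ^ 2 ≤ Real.tan x * x := by nlinarith
      have e3 := mul_le_mul_of_nonneg_left (show Real.cos x ^ 2 * (x ^ 2 + y ^ 2) ≤
        2 * (Real.tan x * x) by linarith) (sq_nonneg lam)
      linarith
  · obtain ⟨L, hL, hdet⟩ := exists_hasFDerivAt_chart (lam := lam) (a := Real.pi / 2) (ε := -1)
      (x := x) (y := y) hcos (by linarith)
    refine ⟨L, hL.congr_of_eventuallyEq ?_, ?_⟩
    · have : ∀ᶠ p : ℝ × ℝ in 𝓝 (x, y), Real.pi / 4 < p.1 :=
        continuousAt_const.eventually_lt continuous_fst.continuousAt h4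
      filter_upwards [this] with p hp
      have : min p.1 (Real.pi / 2 - p.1) = Real.pi / 2 + -1 * p.1 := by
        rw [min_eq_right (by linarith)]; ring
      simp only [sectorMap, this]
    · rw [hdet, show Real.pi / 2 + -1 * x = Real.pi / 2 - x by ring]
      refine le_trans ?_ (le_abs_self _)
      have hm : 0 < Real.pi / 2 - x := by linarith
      rw [div_le_div_iff₀ (by norm_num) (by positivity)]
      have e1 : Real.cos x ^ 2 * ((Real.pi / 2 - x) ^ 2 + y ^ 2) ≤
          1 * ((Real.pi / 2 - x) ^ 2 + (Real.pi / 2 - x) ^ 2) := by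
        have : y ≤ Real.pi / 2 - x := by linarith
        gcongr
      have e2 : (Real.pi / 2 - x) ^ 2 ≤ Real.tan x * (Real.pi / 2 - x) := by nlinarith
      have e3 := mul_le_mul_of_nonneg_left (show Real.cos x ^ 2 * ((Real.pi / 2 - x) ^ 2 + y ^ 2) ≤
        2 * (Real.tan x * (Real.pi / 2 - x)) by linarith) (sq_nonneg lam)
      linarith

/-- The open chamber of the symmetry group of the tangent map. -/
def chamber : Set (ℝ × ℝ) := {p | 0 < p.2 ∧ p.2 < p.1 ∧ p.1 + p.2 < Real.pi / 2}

/-- The map is injective on the chamber and its Jacobian is at least `lam² / 2` off a null set, so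
the change of variables formula applies. -/
theorem volume_sectorMap_image {lam : ℝ} (hlam : 0 < lam) {V : Set (ℝ × ℝ)} (hV : IsOpen V)
    (hVc : V ⊆ chamber) :
    ENNReal.ofReal (lam ^ 2 / 2) * volume V ≤
      volume ((fun p : ℝ × ℝ => sectorMap lam p.1 p.2) '' V) := by
  set F := fun p : ℝ × ℝ => sectorMap lam p.1 p.2 with hF
  -- On the line `x = π/4` the minimum in `sectorMap` switches branch and differentiability may
  -- fail.
  set N : Set (ℝ × ℝ) := {Real.pi / 4} ×ˢ Set.univ with hN
  have hN0 : volume N = 0 := by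
    rw [hN, Measure.volume_eq_prod, Measure.prod_prod]; simp
  have hNm : MeasurableSet N := (measurableSet_singleton _).prod MeasurableSet.univ
  have hS : MeasurableSet (V \ N) := hV.measurableSet.diff hNm
  have hvol : volume (V \ N) = volume V := measure_sdiff_null hN0
  have hex : ∀ p ∈ V \ N, ∃ L : ℝ × ℝ →L[ℝ] ℝ × ℝ, HasFDerivAt F L p ∧ lam ^ 2 / 2 ≤ |L.det| := by
    rintro ⟨x, y⟩ ⟨hp, hpN⟩
    obtain ⟨h1, h2, h3⟩ := hVc hp
    refine exists_hasFDerivAt_sectorMap h1 h2 h3 ?_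
    intro h4
    exact hpN ⟨h4, trivial⟩
  choose! L hL hdet using hex
  have hinj : Set.InjOn F (V \ N) := by
    rintro ⟨x, y⟩ ⟨hp, -⟩ ⟨x', y'⟩ ⟨hp', -⟩ heq
    obtain ⟨h1, h2, h3⟩ := hVc hp
    obtain ⟨h1', h2', h3'⟩ := hVc hp'
    simp only at h1 h2 h3 h1' h2' h3'
    rw [← sectorInv_sectorMap (y := y) hlam (h1.trans h2) (by linarith),
      ← sectorInv_sectorMap (y := y') hlam (h1'.trans h2') (by linarith)]
    exact congrArg _ heq
  rw [← hvol]
  calc ENNReal.ofReal (lam ^ 2 / 2) * volume (V \ N)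
      = ∫⁻ _ in V \ N, ENNReal.ofReal (lam ^ 2 / 2) := by simp
    _ ≤ ∫⁻ p in V \ N, ENNReal.ofReal |(L p).det| :=
        setLIntegral_mono' hS fun p hp => ENNReal.ofReal_le_ofReal (hdet p hp)
    _ = volume (F '' (V \ N)) := lintegral_abs_det_fderiv_eq_addHaar_image volume hS
        (fun p hp => (hL p hp).hasFDerivWithinAt) hinj
    _ ≤ volume (F '' V) := measure_mono (Set.image_mono Set.sdiff_subset)

theorem isOpen_sectorMap_image {lam : ℝ} (hlam : 0 < lam) {V : Set (ℝ × ℝ)} (hV : IsOpen V)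
    (hVc : V ⊆ chamber) : IsOpen ((fun p : ℝ × ℝ => sectorMap lam p.1 p.2) '' V) := by
  have hO : IsOpen {q : ℝ × ℝ | 0 < q.2 ∧ q.2 < q.1} :=
    (isOpen_lt continuous_const continuous_snd).inter (isOpen_lt continuous_snd continuous_fst)
  have hc : ContinuousOn (sectorInv lam) {q : ℝ × ℝ | 0 < q.2 ∧ q.2 < q.1} :=
    fun q hq => (continuousAt_sectorInv (hq.1.trans hq.2)).continuousWithinAt
  convert hc.isOpen_inter_preimage hO hV using 1
  ext q
  constructor
  · rintro ⟨⟨x, y⟩, hp, rfl⟩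
    obtain ⟨h1, h2, h3⟩ := hVc hp
    refine ⟨sectorMap_mem hlam h1 h2 h3, ?_⟩
    simp only [Set.mem_preimage]
    rwa [sectorInv_sectorMap hlam (h1.trans h2) (by simp only at h1 h2 h3; linarith)]
  · rintro ⟨hq, hqV⟩
    exact ⟨_, hqV, sectorMap_sectorInv hlam (hq.1.trans hq.2)⟩

theorem IsPreconnected.lt_or_gt_of_ne {α : Type*} [TopologicalSpace α] {V : Set α}
    (hV : IsPreconnected V) {φ : α → ℝ} (hφ : ContinuousOn φ V) {c : ℝ} (hc : ∀ p ∈ V, φ p ≠ c) :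
    (∀ p ∈ V, φ p < c) ∨ (∀ p ∈ V, c < φ p) := by
  by_contra hcon
  push Not at hcon
  obtain ⟨⟨p, hp, hp'⟩, q, hq, hq'⟩ := hcon
  obtain ⟨r, hr, hr'⟩ := (hV.image φ hφ).ordConnected.out ⟨q, hq, rfl⟩ ⟨p, hp, rfl⟩ ⟨hq', hp'⟩
  exact hc r hr hr'

/-- A connected set avoiding all walls `φ = k c` stays between two consecutive ones. -/
theorem IsPreconnected.exists_int_mul_lt {α : Type*} [TopologicalSpace α] {V : Set α}
    (hV : IsPreconnected V) {φ : α → ℝ} (hφ : ContinuousOn φ V) {c : ℝ} (hc0 : 0 < c)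
    (hc : ∀ p ∈ V, ∀ k : ℤ, φ p ≠ k * c) :
    ∃ k : ℤ, ∀ p ∈ V, k * c < φ p ∧ φ p < (k + 1) * c := by
  rcases V.eq_empty_or_nonempty with rfl | ⟨p₀, hp₀⟩
  · exact ⟨0, by simp⟩
  refine ⟨⌊φ p₀ / c⌋, ?_⟩
  have h1 := Int.floor_le (φ p₀ / c)
  have h2 := Int.lt_floor_add_one (φ p₀ / c)
  rw [le_div_iff₀ hc0] at h1
  rw [div_lt_iff₀ hc0] at h2
  have h3 := hV.lt_or_gt_of_ne hφ (fun p hp => hc p hp ⌊φ p₀ / c⌋)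
  have h4 := hV.lt_or_gt_of_ne hφ (fun p hp => hc p hp (⌊φ p₀ / c⌋ + 1))
  push_cast at h4
  intro p hp
  constructor
  · rcases h3 with h3 | h3
    · linarith [h3 p₀ hp₀]
    · exact h3 p hp
  · rcases h4 with h4 | h4
    · exact h4 p hp
    · linarith [h4 p₀ hp₀]

namespace IsTangentInvariant

variable {lam : ℝ} {C : Set (ℝ × ℝ)}

theorem horizontal_mem (h : IsTangentInvariant lam C) (k : ℤ) (x : ℝ) :
    (x, k * (Real.pi / 2)) ∈ C := by
  simpa using h.add_int_mul_half_pi k (h.axis (x - k * (Real.pi / 2)))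

theorem vertical_mem (h : IsTangentInvariant lam C) (k : ℤ) (y : ℝ) :
    (k * (Real.pi / 2), y) ∈ C :=
  h.swap _ _ (h.horizontal_mem k y)

/-- In the chart at the pole the antidiagonal is the ray `σ = 1`, whose image lies on the diagonal.
-/
theorem antidiagonal_mem (h : IsTangentInvariant lam C) (hd : ∀ t, (t, t) ∈ C) {x : ℝ}
    (hx : 0 < x) (hx2 : x < Real.pi / 2) : (x, Real.pi / 2 - x) ∈ C := by
  have key : ∀ M, 0 < M → M ≤ Real.pi / 4 → (Real.pi / 2 - M, M) ∈ C := by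
    intro M hM hM4
    rw [h.sector _ _ hM.le (by linarith) (by linarith) (by linarith) (by linarith)]
    have := sectorMap_ray_right (lam := lam) (σ := 1) hM hM4
    rw [one_mul, one_mul] at this
    rw [this]
    exact hd _
  rcases le_total x (Real.pi / 4) with h4 | h4
  · exact h.swap _ _ (key x hx h4)
  · simpa using key (Real.pi / 2 - x) (by linarith) (by linarith)

/-- A connected open set in the complement of `C` is isometric to one in the chamber. -/
theorem exists_chamber_copy (h : IsTangentInvariant lam C) (hd : ∀ t, (t, t) ∈ C)
    {V : Set (ℝ × ℝ)} (hV : IsOpen V) (hVp : IsPreconnected V) (hVC : ∀ p ∈ V, p ∉ C) :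
    ∃ W : Set (ℝ × ℝ), IsOpen W ∧ IsPreconnected W ∧ (∀ p ∈ W, p ∉ C) ∧ W ⊆ chamber ∧
      volume W = volume V := by
  have hpi := Real.pi_pos
  have move : ∀ (e : ℝ × ℝ ≃ₜ ℝ × ℝ), MeasurePreserving e → (∀ p ∈ C, e p ∈ C) →
      ∀ U : Set (ℝ × ℝ), IsOpen U → IsPreconnected U → (∀ p ∈ U, p ∉ C) →
      IsOpen (e ⁻¹' U) ∧ IsPreconnected (e ⁻¹' U) ∧ (∀ p ∈ e ⁻¹' U, p ∉ C) ∧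
        volume (e ⁻¹' U) = volume U := by
    intro e he heC U h1 h2 h3
    exact ⟨h1.preimage e.continuous, (e.isPreconnected_preimage).2 h2,
      fun p hp hpC => h3 _ hp (heC p hpC), he.measure_preimage h1.measurableSet.nullMeasurableSet⟩
  obtain ⟨k, hk⟩ := hVp.exists_int_mul_lt (φ := Prod.fst) continuous_fst.continuousOn
    (c := Real.pi / 2) (by linarith) (fun p hp k hk => hVC p hp (by
      rw [show p = (p.1, p.2) from rfl, hk]; exact h.vertical_mem k p.2))
  obtain ⟨o1, p1, c1, v1⟩ := move
    (Homeomorph.addRight ((k * (Real.pi / 2), k * (Real.pi / 2)) : ℝ × ℝ))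
    (measurePreserving_add_right volume _)
    (fun p hp => h.add_int_mul_half_pi k hp) V hV hVp hVC
  set V₁ := (Homeomorph.addRight ((k * (Real.pi / 2), k * (Real.pi / 2)) : ℝ × ℝ)) ⁻¹' V
  have x1 : ∀ p ∈ V₁, 0 < p.1 ∧ p.1 < Real.pi / 2 := by
    intro p hp
    have := hk _ hp
    simp only [Homeomorph.coe_addRight, Prod.fst_add] at this
    constructor <;> linarith
  obtain ⟨l, hl⟩ := p1.exists_int_mul_lt (φ := Prod.snd) continuous_snd.continuousOn
    (c := Real.pi / 2) (by linarith) (fun p hp k hk => c1 p hp (by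
      rw [show p = (p.1, p.2) from rfl, hk]; exact h.horizontal_mem k p.1))
  obtain ⟨V₂, o2, p2, c2, v2, x2, y2⟩ : ∃ V₂ : Set (ℝ × ℝ), IsOpen V₂ ∧ IsPreconnected V₂ ∧
      (∀ p ∈ V₂, p ∉ C) ∧ volume V₂ = volume V₁ ∧ (∀ p ∈ V₂, 0 < p.1 ∧ p.1 < Real.pi / 2) ∧
      (∀ p ∈ V₂, 0 < p.2 ∧ p.2 < Real.pi / 2) := by
    -- A translation by `π/2` in `y` alone is not a symmetry. Even strips are translated by a
    -- multiple of `π`, odd ones are reflected.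
    rcases Int.even_or_odd' l with ⟨j, rfl | rfl⟩
    · obtain ⟨o2, p2, c2, v2⟩ := move (Homeomorph.addRight ((0, j * Real.pi) : ℝ × ℝ))
        (measurePreserving_add_right volume _)
        (fun p hp => by
          have := h.add_int_mul_pi_snd j (x := p.1) (y := p.2) hp
          rwa [← add_zero p.1] at this) V₁ o1 p1 c1
      refine ⟨_, o2, p2, c2, v2, fun p hp => ?_, fun p hp => ?_⟩
      · simpa using x1 _ hp
      · have := hl _ hp
        simp only [Homeomorph.coe_addRight, Prod.snd_add] at this
        push_cast at this
        constructor <;> linarith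
    · have hmp : MeasurePreserving
          ((Homeomorph.refl ℝ).prodCongr (Homeomorph.subLeft ((j + 1) * Real.pi))) :=
        (MeasurePreserving.id volume).prod (Measure.measurePreserving_sub_left volume ((j + 1) * Real.pi))
      obtain ⟨o2, p2, c2, v2⟩ := move _ hmp
        (fun p hp => by
          have := h.add_int_mul_pi_snd (j + 1) (h.neg_snd (x := p.1) (y := p.2) hp)
          push_cast at this
          rw [neg_add_eq_sub] at this
          exact this) V₁ o1 p1 c1
      refine ⟨_, o2, p2, c2, v2, fun p hp => ?_, fun p hp => ?_⟩
      · have : 0 < p.1 ∧ p.1 < Real.pi / 2 :=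
          x1 (p.1, (j + 1) * Real.pi - p.2) hp
        exact this
      · have : _ ∧ (j + 1) * Real.pi - p.2 < _ := hl _ hp
        have h2 : _ < (j + 1) * Real.pi - p.2 := (hl _ hp).1
        push_cast at this h2
        constructor <;> linarith [this.2]
  obtain ⟨V₃, o3, p3, c3, v3, x3, y3⟩ : ∃ V₃ : Set (ℝ × ℝ), IsOpen V₃ ∧ IsPreconnected V₃ ∧
      (∀ p ∈ V₃, p ∉ C) ∧ volume V₃ = volume V₂ ∧ (∀ p ∈ V₃, p.1 < Real.pi / 2) ∧
      (∀ p ∈ V₃, 0 < p.2 ∧ p.2 < p.1) := by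
    rcases p2.lt_or_gt_of_ne (φ := fun p => p.1 - p.2) (by fun_prop) (c := 0)
      (fun p hp h0 => c2 p hp (by
        rw [show p = (p.1, p.2) from rfl, sub_eq_zero.1 h0]; exact hd _)) with h0 | h0
    · obtain ⟨o3, p3, c3, v3⟩ := move (Homeomorph.prodComm ℝ ℝ) Measure.measurePreserving_swap
        (fun p hp => h.swap p.1 p.2 hp) V₂ o2 p2 c2
      refine ⟨_, o3, p3, c3, v3, fun p hp => (y2 _ hp).2, fun p hp => ⟨(x2 _ hp).1, ?_⟩⟩
      have : p.2 - p.1 < 0 := h0 _ hp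
      linarith
    · exact ⟨V₂, o2, p2, c2, rfl, fun p hp => (x2 p hp).2,
        fun p hp => ⟨(y2 p hp).1, by linarith [h0 p hp]⟩⟩
  rcases p3.lt_or_gt_of_ne (φ := fun p => p.1 + p.2) (by fun_prop) (c := Real.pi / 2)
    (fun p hp h0 => c3 p hp (by
      rw [show p = (p.1, Real.pi / 2 - p.1) from Prod.ext rfl (by simp only; linarith)]
      exact h.antidiagonal_mem hd ((y3 p hp).1.trans (y3 p hp).2) (x3 p hp))) with h0 | h0
  · exact ⟨V₃, o3, p3, c3, fun p hp => ⟨(y3 p hp).1, (y3 p hp).2, h0 p hp⟩,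
      by rw [v3, v2, v1]⟩
  · have hmp : MeasurePreserving ((Homeomorph.prodComm ℝ ℝ).trans
        (Homeomorph.subLeft ((Real.pi / 2, Real.pi / 2) : ℝ × ℝ))) :=
      (Measure.measurePreserving_sub_left volume _).comp Measure.measurePreserving_swap
    obtain ⟨o4, p4, c4, v4⟩ := move _ hmp
      (fun p hp => h.reflect (x := p.1) (y := p.2) hp) V₃ o3 p3 c3
    refine ⟨_, o4, p4, c4, fun p hp => ?_, by rw [v4, v3, v2, v1]⟩
    have e1 : 0 < Real.pi / 2 - p.1 ∧ Real.pi / 2 - p.1 < Real.pi / 2 - p.2 := y3 _ hp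
    have e2 : Real.pi / 2 < (Real.pi / 2 - p.2) + (Real.pi / 2 - p.1) := h0 _ hp
    have e3 : Real.pi / 2 - p.2 < Real.pi / 2 := x3 _ hp
    exact ⟨by linarith, by linarith [e1.2], by linarith⟩

/-- Since the tangent map expands areas, the complement of `C` cannot avoid the diagonals. -/
theorem eq_univ_of_diagonal (h : IsTangentInvariant lam C) (hlam : √2 < lam)
    (hd : ∀ t, (t, t) ∈ C) : C = Set.univ := by
  have hpi := Real.pi_pos
  have hlam0 : 0 < lam := lt_trans (by positivity) hlam
  have hlamsq : 1 < lam ^ 2 / 2 := by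
    have := Real.sq_sqrt (show (0 : ℝ) ≤ 2 by norm_num)
    nlinarith [Real.sqrt_nonneg 2]
  by_contra hne
  obtain ⟨p, hp⟩ := (Set.ne_univ_iff_exists_notMem C).1 hne
  obtain ⟨r, hr, hball⟩ := Metric.isOpen_iff.1 h.isClosed.isOpen_compl p hp
  obtain ⟨W, oW, pW, cW, sW, vW⟩ := h.exists_chamber_copy hd Metric.isOpen_ball
    (convex_ball p r).isPreconnected (fun q hq => hball hq)
  have hpos : 0 < volume W := by rw [vW]; exact Metric.measure_ball_pos _ _ hr
  -- Alternate the map with folding back into the chamber; invariance keeps every set disjoint from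
  -- `C`.
  have step : ∀ n : ℕ, ∃ U : Set (ℝ × ℝ), IsOpen U ∧ IsPreconnected U ∧ (∀ p ∈ U, p ∉ C) ∧
      U ⊆ chamber ∧ ENNReal.ofReal (lam ^ 2 / 2) ^ n * volume W ≤ volume U := by
    intro n
    induction n with
    | zero => exact ⟨W, oW, pW, cW, sW, by simp⟩
    | succ n ih =>
      obtain ⟨U, oU, pU, cU, sU, vU⟩ := ih
      have hcont : ContinuousOn (fun p : ℝ × ℝ => sectorMap lam p.1 p.2) U := fun q hq => by
        obtain ⟨h1, h2, h3⟩ := sU hq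
        exact (continuousAt_sectorMap (by linarith) (by linarith)).continuousWithinAt
      obtain ⟨U', oU', pU', cU', sU', vU'⟩ := h.exists_chamber_copy hd
        (isOpen_sectorMap_image hlam0 oU sU) (pU.image _ hcont) (by
          rintro _ ⟨q, hq, rfl⟩
          obtain ⟨h1, h2, h3⟩ := sU hq
          rw [← h.sector q.1 q.2 h1.le h2.le (by linarith) (by linarith) h3.le]
          exact cU q hq)
      refine ⟨U', oU', pU', cU', sU', ?_⟩
      rw [vU', pow_succ', mul_assoc]
      exact (mul_le_mul_right vU _).trans (volume_sectorMap_image hlam0 oU sU)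
  have hfin : volume chamber < ⊤ := by
    refine lt_of_le_of_lt (measure_mono (t := Set.Icc 0 (Real.pi / 2) ×ˢ Set.Icc 0 (Real.pi / 2)) ?_)
      (isCompact_Icc.prod isCompact_Icc).measure_lt_top
    rintro q ⟨h1, h2, h3⟩
    exact ⟨⟨by linarith, by linarith⟩, ⟨by linarith, by linarith⟩⟩
  have hlim : Tendsto (fun n : ℕ => ENNReal.ofReal (lam ^ 2 / 2) ^ n * volume W) atTop (𝓝 ⊤) := by
    have h1 := ENNReal.tendsto_pow_atTop_nhds_top_iff (r := ENNReal.ofReal (lam ^ 2 / 2)) |>.2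
      (by rwa [ENNReal.one_lt_ofReal])
    have h2 := ENNReal.Tendsto.mul_const (b := volume W) h1 (Or.inl ENNReal.top_ne_zero)
    rwa [ENNReal.top_mul hpos.ne'] at h2
  obtain ⟨n, hn⟩ := (hlim.eventually (lt_mem_nhds hfin)).exists
  obtain ⟨U, -, -, -, sU, vU⟩ := step n
  exact absurd (hn.trans_le (vU.trans (measure_mono sU))) (lt_irrefl _)

theorem eq_univ (h : IsTangentInvariant lam C) (hlam : √2 < lam) : C = Set.univ := by
  by_contra hne
  have hB : {t : ℝ | (t, t) ∉ C}.Nonempty := by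
    by_contra hcon
    rw [Set.not_nonempty_iff_eq_empty] at hcon
    refine hne (h.eq_univ_of_diagonal hlam fun t => ?_)
    by_contra ht
    exact (Set.mem_empty_iff_false t).1 (hcon ▸ ht)
  obtain ⟨h1, h2⟩ := h.isDiagonalTrace.Ioo_subset
    (by rwa [one_lt_div (by positivity)]) hB
  obtain ⟨t, ht, htC⟩ := h.exists_diagonal_mem hlam h1
  exact h2 ht htC

end IsTangentInvariant

/-! ### Closed form and symmetries of the Zorich map -/

theorem neg_one_zpow_mul_self (k : ℤ) : ((-1 : ℝ) ^ k) * (-1) ^ k = 1 := by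
  rw [← mul_zpow]; simp

theorem sub_stripIndex_mem (t : ℝ) :
    t - stripIndex t * Real.pi ∈ Set.Icc (-(Real.pi / 2)) (Real.pi / 2) := by
  have hpi := Real.pi_pos
  have h := abs_sub_round (t / Real.pi)
  rw [abs_le] at h
  have h1 : t - stripIndex t * Real.pi = (t / Real.pi - round (t / Real.pi)) * Real.pi := by
    unfold stripIndex; field_simp
  rw [h1]
  constructor <;> nlinarith [h.1, h.2]

/-- Translation by `k π` multiplies `sin` by `(-1)^k`, the same sign as in the fold. In this form
the symmetries become identities for `sin`, free of rounding. -/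
theorem foldCoord_eq (t : ℝ) : foldCoord t = Real.arcsin (Real.sin t) := by
  obtain ⟨h1, h2⟩ := sub_stripIndex_mem t
  have h3 : Real.sin t = (-1) ^ stripIndex t * Real.sin (t - stripIndex t * Real.pi) := by
    rw [Real.sin_sub_int_mul_pi, ← mul_assoc, neg_one_zpow_mul_self, one_mul]
  unfold foldCoord
  rw [h3]
  rcases Int.even_or_odd (stripIndex t) with he | ho
  · rw [he.neg_one_zpow, one_mul, one_mul, Real.arcsin_sin h1 h2]
  · rw [ho.neg_one_zpow, neg_one_mul, neg_one_mul, Real.arcsin_neg, Real.arcsin_sin h1 h2]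

theorem neg_one_zpow_stripIndex {t : ℝ} (ht : Real.cos t ≠ 0) :
    ((-1 : ℝ) ^ stripIndex t) = Real.sign (Real.cos t) := by
  have h1 : 0 ≤ Real.cos (t - stripIndex t * Real.pi) := Real.cos_nonneg_of_mem_Icc
    (sub_stripIndex_mem t)
  rw [Real.cos_sub_int_mul_pi] at h1
  rcases Int.even_or_odd (stripIndex t) with he | ho
  · rw [he.neg_one_zpow] at h1 ⊢
    rw [Real.sign_of_pos (lt_of_le_of_ne (by linarith) ht.symm)]
  · rw [ho.neg_one_zpow] at h1 ⊢
    rw [Real.sign_of_neg (lt_of_le_of_ne (by linarith) ht)]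

theorem abs_arcsin_sin_of_cos_eq_zero {t : ℝ} (ht : Real.cos t = 0) :
    |Real.arcsin (Real.sin t)| = Real.pi / 2 := by
  have h1 := Real.sin_sq_add_cos_sq t
  rw [ht] at h1
  have hpi := Real.pi_pos
  have : (Real.sin t - 1) * (Real.sin t + 1) = 0 := by linarith
  rcases mul_eq_zero.1 this with h | h
  · rw [sub_eq_zero.1 h, Real.arcsin_one, abs_of_pos (by linarith)]
  · rw [eq_neg_of_add_eq_zero_left h, Real.arcsin_neg_one, abs_neg, abs_of_pos (by linarith)]

theorem abs_arcsin_le (t : ℝ) : |Real.arcsin t| ≤ Real.pi / 2 :=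
  abs_le.2 ⟨Real.neg_pi_div_two_le_arcsin t, Real.arcsin_le_pi_div_two t⟩

/-- On the fold lines the parity of the strip and the sign of the cosine may disagree, but there
`cos M = 0`. -/
theorem neg_one_zpow_mul_cos_maxAbs (s t : ℝ) :
    (-1 : ℝ) ^ (stripIndex s + stripIndex t) *
        Real.cos (maxAbs (Real.arcsin (Real.sin s)) (Real.arcsin (Real.sin t))) =
      Real.sign (Real.cos s) * Real.sign (Real.cos t) *
        Real.cos (maxAbs (Real.arcsin (Real.sin s)) (Real.arcsin (Real.sin t))) := by
  unfold maxAbs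
  by_cases hs : Real.cos s = 0
  · rw [abs_arcsin_sin_of_cos_eq_zero hs, max_eq_left (abs_arcsin_le _), Real.cos_pi_div_two]
    simp
  by_cases ht : Real.cos t = 0
  · rw [abs_arcsin_sin_of_cos_eq_zero ht, max_eq_right (abs_arcsin_le _), Real.cos_pi_div_two]
    simp
  rw [zpow_add₀ (by norm_num), neg_one_zpow_stripIndex hs, neg_one_zpow_stripIndex ht]

theorem zorich_eq (p : Space3) : zorich p =
    !₂[Real.exp (p 2) * (Real.arcsin (Real.sin (p 0)) *
          Real.sin (maxAbs (Real.arcsin (Real.sin (p 0))) (Real.arcsin (Real.sin (p 1)))) /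
          √(Real.arcsin (Real.sin (p 0)) ^ 2 + Real.arcsin (Real.sin (p 1)) ^ 2)),
      Real.exp (p 2) * (Real.arcsin (Real.sin (p 1)) *
          Real.sin (maxAbs (Real.arcsin (Real.sin (p 0))) (Real.arcsin (Real.sin (p 1)))) /
          √(Real.arcsin (Real.sin (p 0)) ^ 2 + Real.arcsin (Real.sin (p 1)) ^ 2)),
      Real.exp (p 2) * (Real.sign (Real.cos (p 0)) * Real.sign (Real.cos (p 1)) *
        Real.cos (maxAbs (Real.arcsin (Real.sin (p 0))) (Real.arcsin (Real.sin (p 1)))))] := by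
  unfold zorich hemisphereMap
  simp only [foldCoord_eq]
  rw [← neg_one_zpow_mul_cos_maxAbs]
  ext i
  fin_cases i <;> simp
  ring

/-- Reflection in the plane `x = 0`. -/
def negFst (p : Space3) : Space3 := !₂[-p 0, p 1, p 2]

/-- Reflection in the plane `x = y`. -/
def swapCoords (p : Space3) : Space3 := !₂[p 1, p 0, p 2]

theorem norm_negFst (p : Space3) : ‖negFst p‖ = ‖p‖ := by
  simp [EuclideanSpace.norm_eq, Fin.sum_univ_three, negFst]

theorem norm_swapCoords (p : Space3) : ‖swapCoords p‖ = ‖p‖ := by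
  simp only [EuclideanSpace.norm_eq, Fin.sum_univ_three, swapCoords]
  simp
  ring_nf

theorem maxAbs_neg_left (x y : ℝ) : maxAbs (-x) y = maxAbs x y := by simp [maxAbs]

theorem maxAbs_neg_right (x y : ℝ) : maxAbs x (-y) = maxAbs x y := by simp [maxAbs]

theorem maxAbs_comm (x y : ℝ) : maxAbs x y = maxAbs y x := max_comm _ _

theorem zorich_negFst (p : Space3) : zorich (negFst p) = negFst (zorich p) := by
  rw [zorich_eq, zorich_eq]
  ext i
  fin_cases i <;> simp [negFst, Real.arcsin_neg, maxAbs_neg_left, neg_div]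

theorem zorich_swapCoords (p : Space3) : zorich (swapCoords p) = swapCoords (zorich p) := by
  rw [zorich_eq, zorich_eq]
  ext i
  fin_cases i <;> simp [swapCoords, maxAbs_comm, add_comm, mul_comm]

theorem zorich_add_two_pi (p : Space3) : zorich (p + !₂[2 * Real.pi, 0, 0]) = zorich p := by
  rw [zorich_eq, zorich_eq]
  simp

/-- The two reflections of the image in `z = 0` cancel, leaving the half-turn about the vertical
axis. -/
theorem zorich_add_pi_pi (p : Space3) : zorich (p + !₂[Real.pi, Real.pi, 0]) =
    !₂[-zorich p 0, -zorich p 1, zorich p 2] := by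
  have hs : ∀ c : ℝ, Real.sign (-c) = -Real.sign c := fun c => Real.sign_neg
  rw [zorich_eq, zorich_eq]
  ext i
  fin_cases i <;> simp [Real.arcsin_neg, maxAbs_neg_left, maxAbs_neg_right, neg_div, hs]

theorem moebiusA_of_ne {w : Space3} (hw : w ≠ !₂[0, 0, -1]) {D : ℝ}
    (hD : w 0 ^ 2 + w 1 ^ 2 + (w 2 + 1) ^ 2 = D) : moebiusA w =
      ((!₂[2 * (1 / D) * w 0, 2 * (1 / D) * w 1, 1 - 2 * (1 / D) * (w 2 + 1)] : Space3) :
        OnePoint Space3) := by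
  unfold moebiusA
  rw [if_neg hw, ← hD]

theorem moebiusA_negFst (w : Space3) : moebiusA (negFst w) = OnePoint.map negFst (moebiusA w) := by
  have h : negFst w = !₂[0, 0, -1] ↔ w = !₂[0, 0, -1] := by
    constructor <;> intro h
    · have h0 := congrArg (fun v : Space3 => v 0) h
      have h1 := congrArg (fun v : Space3 => v 1) h
      have h2 := congrArg (fun v : Space3 => v 2) h
      simp [negFst] at h0 h1 h2
      ext i; fin_cases i <;> simp [h0, h1, h2]
    · rw [h]; ext i; fin_cases i <;> simp [negFst]
  unfold moebiusA
  by_cases hw : w = !₂[0, 0, -1]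
  · rw [if_pos hw, if_pos (h.2 hw), OnePoint.map_infty]
  · rw [if_neg hw, if_neg (mt h.1 hw), OnePoint.map_some]
    refine congrArg ((↑) : Space3 → OnePoint Space3) ?_
    ext i
    fin_cases i <;> simp [negFst]

theorem moebiusA_swapCoords (w : Space3) :
    moebiusA (swapCoords w) = OnePoint.map swapCoords (moebiusA w) := by
  have h : swapCoords w = !₂[0, 0, -1] ↔ w = !₂[0, 0, -1] := by
    constructor <;> intro h
    · have h0 := congrArg (fun v : Space3 => v 0) h
      have h1 := congrArg (fun v : Space3 => v 1) h
      have h2 := congrArg (fun v : Space3 => v 2) h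
      simp [swapCoords] at h0 h1 h2
      ext i; fin_cases i <;> simp [h0, h1, h2]
    · rw [h]; ext i; fin_cases i <;> simp [swapCoords]
  unfold moebiusA
  by_cases hw : w = !₂[0, 0, -1]
  · rw [if_pos hw, if_pos (h.2 hw), OnePoint.map_infty]
  · rw [if_neg hw, if_neg (mt h.1 hw), OnePoint.map_some]
    refine congrArg ((↑) : Space3 → OnePoint Space3) ?_
    ext i
    fin_cases i <;> simp [swapCoords, add_comm]

theorem genTanScaled_negFst (lam : ℝ) (p : Space3) :
    genTanScaled lam (negFst p) = OnePoint.map negFst (genTanScaled lam p) := by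
  have h1 : (2 : ℝ) • negFst p = negFst ((2 : ℝ) • p) := by
    ext i; fin_cases i <;> simp [negFst]
  unfold genTanScaled genTan
  rw [h1, zorich_negFst, moebiusA_negFst]
  cases moebiusA (zorich ((2 : ℝ) • p)) with
  | infty => simp
  | coe v =>
    simp only [OnePoint.map_some]
    congr 1
    ext i; fin_cases i <;> simp [negFst]

theorem genTanScaled_swapCoords (lam : ℝ) (p : Space3) :
    genTanScaled lam (swapCoords p) = OnePoint.map swapCoords (genTanScaled lam p) := by
  have h1 : (2 : ℝ) • swapCoords p = swapCoords ((2 : ℝ) • p) := by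
    ext i; fin_cases i <;> simp [swapCoords]
  unfold genTanScaled genTan
  rw [h1, zorich_swapCoords, moebiusA_swapCoords]
  cases moebiusA (zorich ((2 : ℝ) • p)) with
  | infty => simp
  | coe v =>
    simp only [OnePoint.map_some]
    congr 1
    ext i; fin_cases i <;> simp [swapCoords]

theorem genTanScaled_add_pi (lam : ℝ) (p : Space3) :
    genTanScaled lam (p + !₂[Real.pi, 0, 0]) = genTanScaled lam p := by
  have h1 : (2 : ℝ) • (p + !₂[Real.pi, 0, 0]) = (2 : ℝ) • p + !₂[2 * Real.pi, 0, 0] := by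
    ext i; fin_cases i <;> simp
  unfold genTanScaled genTan
  rw [h1, zorich_add_two_pi]

theorem genTanScaled_add_half_pi (lam : ℝ) (p : Space3) :
    genTanScaled lam (p + !₂[Real.pi / 2, Real.pi / 2, 0]) =
      genTanScaled lam (negFst (swapCoords (negFst (swapCoords p)))) := by
  have h1 : (2 : ℝ) • (p + !₂[Real.pi / 2, Real.pi / 2, 0]) =
      (2 : ℝ) • p + !₂[Real.pi, Real.pi, 0] := by
    ext i; fin_cases i <;> simp <;> ring
  have h2 : (2 : ℝ) • negFst (swapCoords (negFst (swapCoords p))) =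
      negFst (swapCoords (negFst (swapCoords ((2 : ℝ) • p)))) := by
    ext i; fin_cases i <;> simp [negFst, swapCoords]
  unfold genTanScaled genTan
  rw [h1, h2, zorich_add_pi_pi, zorich_negFst, zorich_swapCoords, zorich_negFst, zorich_swapCoords]
  congr 2

/-- On the chamber of the plane `z = 0`, the generalized tangent map is `sectorMap`. -/
theorem genTanScaled_sector {lam x y : ℝ} (hy : 0 ≤ y) (hyx : y ≤ x) (hx : 0 < x)
    (hx2 : x < Real.pi / 2) (hxy : x + y ≤ Real.pi / 2) :
    genTanScaled lam !₂[x, y, 0] =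
      ((!₂[(sectorMap lam x y).1, (sectorMap lam x y).2, 0] : Space3) : OnePoint Space3) := by
  have hpi := Real.pi_pos
  set m := min x (Real.pi / 2 - x) with hm
  have hm0 : 0 < m := lt_min hx (by linarith)
  have hym : y ≤ m := le_min hyx (by linarith)
  have ha : Real.arcsin (Real.sin (2 * x)) = 2 * m := by
    rcases le_total x (Real.pi / 4) with h4 | h4
    · rw [hm, min_eq_left (by linarith), Real.arcsin_sin (by linarith) (by linarith)]
    · rw [hm, min_eq_right (by linarith), ← Real.sin_pi_sub,
        Real.arcsin_sin (by linarith) (by linarith)]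
      ring
  have hm4 : m ≤ Real.pi / 4 := by
    rcases le_total x (Real.pi / 4) with h4 | h4
    · exact (min_le_left _ _).trans h4
    · exact (min_le_right _ _).trans (by linarith)
  have hb : Real.arcsin (Real.sin (2 * y)) = 2 * y :=
    Real.arcsin_sin (by linarith) (by linarith)
  have hM : maxAbs (2 * m) (2 * y) = 2 * m := by
    unfold maxAbs
    rw [abs_of_pos (by linarith), abs_of_nonneg (by linarith), max_eq_left (by linarith)]
  have hsin : Real.sin (2 * m) = Real.sin (2 * x) := by
    rcases le_total x (Real.pi / 4) with h4 | h4
    · rw [hm, min_eq_left (by linarith)]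
    · rw [hm, min_eq_right (by linarith), ← Real.sin_pi_sub]; ring_nf
  have hcos : Real.sign (Real.cos (2 * x)) * Real.sign (Real.cos (2 * y)) * Real.cos (2 * m) =
      Real.cos (2 * x) := by
    rcases lt_trichotomy x (Real.pi / 4) with h4 | h4 | h4
    · rw [hm, min_eq_left (by linarith),
        Real.sign_of_pos (Real.cos_pos_of_mem_Ioo ⟨by linarith, by linarith⟩),
        Real.sign_of_pos (Real.cos_pos_of_mem_Ioo ⟨by linarith, by linarith⟩)]
      ring
    · rw [hm, min_eq_left (by linarith), h4, show 2 * (Real.pi / 4) = Real.pi / 2 by ring]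
      simp
    · have h5 : Real.cos (2 * m) = -Real.cos (2 * x) := by
        rw [hm, min_eq_right (by linarith), ← Real.cos_pi_sub]; ring_nf
      rw [h5, Real.sign_of_neg (Real.cos_neg_of_pi_div_two_lt_of_lt (by linarith) (by linarith)),
        Real.sign_of_pos (Real.cos_pos_of_mem_Ioo ⟨by linarith, by linarith⟩)]
      ring
  have hρ : 0 < √(m ^ 2 + y ^ 2) := Real.sqrt_pos.2 (by positivity)
  have hρ2 : √(m ^ 2 + y ^ 2) ^ 2 = m ^ 2 + y ^ 2 := Real.sq_sqrt (by positivity)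
  have hroot : √((2 * m) ^ 2 + (2 * y) ^ 2) = 2 * √(m ^ 2 + y ^ 2) := by
    rw [show (2 * m) ^ 2 + (2 * y) ^ 2 = 2 ^ 2 * (m ^ 2 + y ^ 2) by ring,
      Real.sqrt_mul (by positivity), Real.sqrt_sq (by norm_num)]
  have hcx : 0 < Real.cos x := Real.cos_pos_of_mem_Ioo ⟨by linarith, hx2⟩
  have hz : zorich ((2 : ℝ) • !₂[x, y, 0]) = !₂[m * Real.sin (2 * x) / √(m ^ 2 + y ^ 2),
      y * Real.sin (2 * x) / √(m ^ 2 + y ^ 2), Real.cos (2 * x)] := by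
    rw [zorich_eq]
    ext i
    fin_cases i <;> simp [ha, hb, hM, hsin, hcos, hroot] <;> field_simp
  have hne : (!₂[m * Real.sin (2 * x) / √(m ^ 2 + y ^ 2),
      y * Real.sin (2 * x) / √(m ^ 2 + y ^ 2), Real.cos (2 * x)] : Space3) ≠ !₂[0, 0, -1] := by
    intro h
    have h2 := congrArg (fun v : Space3 => v 2) h
    simp [Real.cos_two_mul] at h2
    nlinarith
  unfold genTanScaled genTan
  rw [hz]
  have hr : (m * Real.sin (2 * x) / √(m ^ 2 + y ^ 2)) ^ 2 +
      (y * Real.sin (2 * x) / √(m ^ 2 + y ^ 2)) ^ 2 + (Real.cos (2 * x) + 1) ^ 2 =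
      4 * Real.cos x ^ 2 := by
    rw [div_pow, div_pow, hρ2, Real.sin_two_mul, Real.cos_two_mul]
    have := Real.sin_sq_add_cos_sq x
    field_simp
    linear_combination 4 * Real.cos x ^ 2 * this
  rw [moebiusA_of_ne hne hr, OnePoint.map_some]
  refine congrArg ((↑) : Space3 → OnePoint Space3) ?_
  ext i
  fin_cases i
  · simp [sectorMap, ← hm, Real.sin_two_mul, Real.tan_eq_sin_div_cos]
    field_simp
    norm_num
  · simp [sectorMap, ← hm, Real.sin_two_mul, Real.tan_eq_sin_div_cos]
    field_simp
    norm_num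
  · simp [Real.cos_two_mul]
    right
    field_simp
    norm_num

/-! ### Escaping orbits and their heights -/

theorem tendsto_coe_infty_iff {q : ℕ → Space3} :
    Tendsto (fun k => (q k : OnePoint Space3)) atTop (𝓝 OnePoint.infty) ↔
      Tendsto (fun k => ‖q k‖) atTop atTop := by
  rw [tendsto_norm_atTop_iff_cobounded, Metric.cobounded_eq_cocompact,
    ← coclosedCompact_eq_cocompact, ← OnePoint.comap_coe_nhds_infty, tendsto_comap_iff]
  rfl

theorem mem_escapingSet_iff {f : Space3 → OnePoint Space3} {p : Space3} :
    p ∈ escapingSet f ↔ ∃ q : ℕ → Space3, q 0 = p ∧ (∀ k, f (q k) = (q (k + 1) : OnePoint Space3)) ∧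
      Tendsto (fun k => ‖q k‖) atTop atTop := by
  constructor
  · rintro ⟨h1, h2⟩
    have h3 : ∀ k, ∃ v : Space3, orbit f k p = (v : OnePoint Space3) := by
      intro k
      rcases Nat.eq_zero_or_pos k with rfl | hk
      · exact ⟨p, rfl⟩
      · have : orbit f k p ≠ OnePoint.infty := fun h => h1 ⟨k, hk, h⟩
        obtain ⟨v, hv⟩ := OnePoint.ne_infty_iff_exists.1 this
        exact ⟨v, hv.symm⟩
    choose q hq using h3
    refine ⟨q, ?_, fun k => ?_, ?_⟩
    · exact OnePoint.coe_injective (hq 0).symm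
    · rw [← hq (k + 1)]
      simp [orbit, hq k]
    · rw [← tendsto_coe_infty_iff]
      simpa only [hq] using h2
  · rintro ⟨q, rfl, h1, h2⟩
    have h3 : ∀ k, orbit f k (q 0) = (q k : OnePoint Space3) := by
      intro k
      induction k with
      | zero => rfl
      | succ k ih => simp [orbit, ih, h1]
    refine ⟨?_, ?_⟩
    · rintro ⟨k, -, hk⟩
      rw [h3] at hk
      exact OnePoint.coe_ne_infty _ hk
    · simp only [h3]
      exact tendsto_coe_infty_iff.2 h2

theorem mem_escapingSet_shift {f : Space3 → OnePoint Space3} {p p' : Space3}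
    (h : f p = (p' : OnePoint Space3)) : p ∈ escapingSet f ↔ p' ∈ escapingSet f := by
  rw [mem_escapingSet_iff, mem_escapingSet_iff]
  constructor
  · rintro ⟨q, rfl, h1, h2⟩
    refine ⟨fun k => q (k + 1), ?_, fun k => h1 (k + 1), (tendsto_add_atTop_iff_nat 1).2 h2⟩
    have := h1 0
    rw [h] at this
    exact (OnePoint.coe_injective this).symm
  · rintro ⟨q, rfl, h1, h2⟩
    refine ⟨fun k => Nat.casesOn k p q, rfl, fun k => ?_, ?_⟩
    · cases k with
      | zero => exact h
      | succ k => exact h1 k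
    · exact (tendsto_add_atTop_iff_nat 1).1 h2

/-- Escape depends only on the first image, so translations under which the map is periodic preserve
the escaping set. -/
theorem mem_escapingSet_congr {f : Space3 → OnePoint Space3} {p p' : Space3} (h : f p' = f p)
    (hp : p ∈ escapingSet f) : p' ∈ escapingSet f := by
  obtain ⟨q, rfl, h1, -⟩ := mem_escapingSet_iff.1 hp
  rw [mem_escapingSet_shift (h.trans (h1 0))]
  exact (mem_escapingSet_shift (h1 0)).1 hp

theorem map_mem_escapingSet {f : Space3 → OnePoint Space3} {R : Space3 → Space3}
    (hR : ∀ p, ‖R p‖ = ‖p‖) (hf : ∀ p, f (R p) = OnePoint.map R (f p)) {p : Space3}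
    (hp : p ∈ escapingSet f) : R p ∈ escapingSet f := by
  obtain ⟨q, rfl, h1, h2⟩ := mem_escapingSet_iff.1 hp
  refine mem_escapingSet_iff.2 ⟨fun k => R (q k), rfl, fun k => ?_, by simpa only [hR] using h2⟩
  rw [hf, h1, OnePoint.map_some]

theorem zorich_norm_sq (p : Space3) :
    zorich p 0 ^ 2 + zorich p 1 ^ 2 + zorich p 2 ^ 2 = Real.exp (2 * p 2) := by
  unfold zorich hemisphereMap
  generalize foldCoord (p 0) = a
  generalize foldCoord (p 1) = b
  generalize hn : stripIndex (p 0) + stripIndex (p 1) = n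
  have h1 : ((-1 : ℝ) ^ n) ^ 2 = 1 := by rw [pow_two]; exact neg_one_zpow_mul_self n
  have h2 : a ^ 2 + b ^ 2 ≠ 0 → √(a ^ 2 + b ^ 2) ^ 2 = a ^ 2 + b ^ 2 := fun _ =>
    Real.sq_sqrt (by positivity)
  have h3 := Real.sin_sq_add_cos_sq (maxAbs a b)
  have h4 : (a * Real.sin (maxAbs a b) / √(a ^ 2 + b ^ 2)) ^ 2 +
      (b * Real.sin (maxAbs a b) / √(a ^ 2 + b ^ 2)) ^ 2 = Real.sin (maxAbs a b) ^ 2 := by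
    by_cases h0 : a ^ 2 + b ^ 2 = 0
    · have ha : a = 0 := by nlinarith [sq_nonneg a, sq_nonneg b]
      have hb : b = 0 := by nlinarith [sq_nonneg a, sq_nonneg b]
      simp [ha, hb, maxAbs]
    · rw [div_pow, div_pow, h2 h0]
      field_simp
  rw [show 2 * p 2 = p 2 + p 2 by ring, Real.exp_add]
  simp
  rw [mul_pow, mul_pow, mul_pow, mul_pow, h1]
  linear_combination Real.exp (p 2) ^ 2 * (h4 + h3)

theorem exp_sub_one_abs_ge {t : ℝ} (ht : -1 ≤ t) : |t| / 2 ≤ |Real.exp t - 1| := by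
  rcases le_total 0 t with h | h
  · have := Real.add_one_le_exp t
    rw [abs_of_nonneg h, abs_of_nonneg (by linarith)]
    linarith
  · have h1 := Real.add_one_le_exp (-t)
    have h2 : Real.exp t * Real.exp (-t) = 1 := by rw [← Real.exp_add]; simp
    have h3 := Real.exp_pos t
    have h4 : Real.exp t ≤ 1 := Real.exp_le_one_iff.2 h
    rw [abs_of_nonpos h, abs_of_nonpos (by linarith)]
    have h5 : Real.exp t * (-t + 1) ≤ 1 := by
      have := mul_le_mul_of_nonneg_left h1 h3.le
      linarith
    nlinarith

/-- One step of the tangent map: the height of the image, and the bound of its norm, in terms of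
the squared distance `D` of the image under the Zorich map from the south pole. -/
theorem exists_genTanScaled_step {lam : ℝ} {p p' : Space3}
    (h : genTanScaled lam p = (p' : OnePoint Space3)) :
    ∃ D : ℝ, 0 < D ∧ p' 2 * D = lam * (Real.exp (4 * p 2) - 1) ∧
      ‖p'‖ ^ 2 * D ≤ lam ^ 2 * (8 + 2 * D) ∧ (Real.exp (4 * p 2) - 1 - D) ^ 2 ≤ 4 * D := by
  unfold genTanScaled genTan at h
  have hn := zorich_norm_sq ((2 : ℝ) • p)
  rw [show 2 * ((2 : ℝ) • p) 2 = 4 * p 2 by simp; ring] at hn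
  generalize zorich ((2 : ℝ) • p) = w at h hn
  have hw : w ≠ !₂[0, 0, -1] := by
    rintro rfl
    simp [moebiusA] at h
  rw [moebiusA_of_ne hw rfl, OnePoint.map_some] at h
  have hD : 0 < w 0 ^ 2 + w 1 ^ 2 + (w 2 + 1) ^ 2 := by
    refine lt_of_le_of_ne (by positivity) fun h0 => hw ?_
    have e0 : w 0 = 0 := by nlinarith [sq_nonneg (w 0), sq_nonneg (w 1), sq_nonneg (w 2 + 1)]
    have e1 : w 1 = 0 := by nlinarith [sq_nonneg (w 0), sq_nonneg (w 1), sq_nonneg (w 2 + 1)]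
    have e2 : w 2 + 1 = 0 := by nlinarith [sq_nonneg (w 0), sq_nonneg (w 1), sq_nonneg (w 2 + 1)]
    ext i
    fin_cases i
    · simpa using e0
    · simpa using e1
    · simpa using eq_neg_of_add_eq_zero_left e2
  set D := w 0 ^ 2 + w 1 ^ 2 + (w 2 + 1) ^ 2 with hDdef
  have hp' := (OnePoint.coe_injective h).symm
  refine ⟨D, hD, ?_, ?_, ?_⟩
  · rw [hp', ← hn]
    simp
    field_simp
    rw [hDdef]
    ring
  · have hnorm : ‖p'‖ ^ 2 = lam ^ 2 * (4 / D ^ 2 * (w 0 ^ 2 + w 1 ^ 2) +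
        (1 - 2 / D * (w 2 + 1)) ^ 2) := by
      rw [EuclideanSpace.norm_sq_eq, Fin.sum_univ_three]
      simp only [Real.norm_eq_abs, sq_abs]
      rw [hp']
      simp
      field_simp
      ring
    have h1 : (1 - 2 / D * (w 2 + 1)) ^ 2 ≤ 2 + 2 * (4 / D ^ 2 * (w 2 + 1) ^ 2) := by
      have : 4 / D ^ 2 * (w 2 + 1) ^ 2 = (2 / D * (w 2 + 1)) ^ 2 := by rw [mul_pow, div_pow]; norm_num
      rw [this]
      nlinarith [sq_nonneg (1 + 2 / D * (w 2 + 1))]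
    have h2 : 4 / D ^ 2 * (w 0 ^ 2 + w 1 ^ 2) + (1 - 2 / D * (w 2 + 1)) ^ 2 ≤ 2 + 8 / D := by
      have e1 : 0 ≤ 4 / D ^ 2 * (w 0 ^ 2 + w 1 ^ 2) := by positivity
      have e2 : 2 * (4 / D ^ 2 * D) = 8 / D := by field_simp; norm_num
      have e3 : 4 / D ^ 2 * D = 4 / D ^ 2 * (w 0 ^ 2 + w 1 ^ 2) + 4 / D ^ 2 * (w 2 + 1) ^ 2 := by
        rw [hDdef]; ring
      linarith
    rw [hnorm]
    have h3 := mul_le_mul_of_nonneg_left h2 (show 0 ≤ lam ^ 2 * D by positivity)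
    have h4 : lam ^ 2 * D * (2 + 8 / D) = lam ^ 2 * (8 + 2 * D) := by field_simp; ring
    linarith
  · rw [← hn, hDdef]
    nlinarith [sq_nonneg (w 0), sq_nonneg (w 1)]

/-- Escaping points lie in the plane `z = 0`. -/
theorem escapingSet_subset_xyPlane {lam : ℝ} (hlam : 0 < lam) :
    escapingSet (genTanScaled lam) ⊆ xyPlane := by
  intro p hp
  obtain ⟨q, rfl, h1, h2⟩ := mem_escapingSet_iff.1 hp
  choose D hD0 hDz hDn hDe using fun k => exists_genTanScaled_step (h1 k)
  -- The new height vanishes only if the old one does, so it suffices to find height `0` somewhere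
  -- along the orbit.
  have hdesc : ∀ k, q k 2 = 0 → q 0 2 = 0 := by
    intro k
    induction k with
    | zero => exact id
    | succ k ih =>
      intro h
      apply ih
      have h3 := hDz k
      rw [h, zero_mul] at h3
      have h4 : Real.exp (4 * q k 2) = 1 := by
        have := (mul_eq_zero.1 h3.symm).resolve_left hlam.ne'
        linarith
      have := Real.exp_eq_one_iff _ |>.1 h4
      linarith
  -- A large image norm forces `D` to be small. The threshold is chosen generously so that its
  -- square dominates both `lam²` and `lam` with room to spare.
  have hsmall : ∃ N, ∀ k ≥ N, D k ≤ lam ∧ D k ≤ 1 / 100 := by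
    obtain ⟨N, hN⟩ := eventually_atTop.1 ((tendsto_add_atTop_iff_nat 1).2 h2
      |>.eventually_ge_atTop (lam * (2 + 30) + 30 + 9 * lam))
    refine ⟨N, fun k hk => ?_⟩
    have h3 := hN k hk
    have h4 := hDn k
    have h5 : (lam * (2 + 30) + 30 + 9 * lam) ^ 2 * D k ≤ lam ^ 2 * (8 + 2 * D k) :=
      le_trans (mul_le_mul_of_nonneg_right (by gcongr) (hD0 k).le) h4
    have h6 : 800 * lam ^ 2 * D k ≤ 8 * lam ^ 2 := by nlinarith [hD0 k, mul_pos hlam hlam]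
    have h7 : D k ≤ 1 / 100 := by
      have : lam ^ 2 * D k ≤ lam ^ 2 * (1 / 100) := by linarith
      exact le_of_mul_le_mul_left this (by positivity)
    refine ⟨?_, h7⟩
    have h8 : (60 * 30 * lam) * D k ≤ 9 * lam ^ 2 := by nlinarith [hD0 k, mul_pos hlam hlam]
    have h9 : lam * D k ≤ lam * lam := by nlinarith
    exact le_of_mul_le_mul_left h9 hlam
  obtain ⟨N, hN⟩ := hsmall
  have hz : ∀ k ≥ N, |q k 2| ≤ 1 / 4 := by
    intro k hk
    obtain ⟨-, h4⟩ := hN k hk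
    have h5 := hDe k
    have h6 : |Real.exp (4 * q k 2) - 1 - D k| ≤ 2 / 10 := by
      apply abs_le_of_sq_le_sq _ (by norm_num)
      linarith
    rw [abs_le] at h6
    have h7 := Real.add_one_le_exp (4 * q k 2)
    have h8 := Real.add_one_le_exp (-(4 * q k 2))
    have h9 : Real.exp (4 * q k 2) * Real.exp (-(4 * q k 2)) = 1 := by
      rw [← Real.exp_add]; simp
    have h10 : Real.exp (-(4 * q k 2)) ≤ 2 := by
      have := Real.exp_pos (-(4 * q k 2))
      nlinarith [hD0 k]
    rw [abs_le]
    constructor <;> linarith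
  -- With `D ≤ lam` the height formula gives `|z'| ≥ |exp (4 z) - 1| ≥ 2 |z|`, which contradicts
  -- `|z| ≤ 1/4` in the long run.
  have hgrow : ∀ k ≥ N, 2 * |q k 2| ≤ |q (k + 1) 2| := by
    intro k hk
    have h4 := (hN k hk).1
    have h5 := hz k hk
    have h6 := exp_sub_one_abs_ge (t := 4 * q k 2) (by linarith [(abs_le.1 h5).1])
    have h7 := congrArg abs (hDz k)
    rw [abs_mul, abs_mul, abs_of_pos (hD0 k), abs_of_pos hlam] at h7
    rw [abs_mul, abs_of_pos (by norm_num : (0 : ℝ) < 4)] at h6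
    have h8 : lam * (2 * |q k 2|) ≤ |q (k + 1) 2| * D k := by
      rw [h7]
      exact mul_le_mul_of_nonneg_left (by linarith) hlam.le
    have h9 : |q (k + 1) 2| * D k ≤ |q (k + 1) 2| * lam :=
      mul_le_mul_of_nonneg_left h4 (abs_nonneg _)
    have h10 : lam * (2 * |q k 2|) ≤ lam * |q (k + 1) 2| := by linarith
    exact le_of_mul_le_mul_left h10 hlam
  apply hdesc N
  by_contra hne
  have hpow : ∀ j : ℕ, 2 ^ j * |q N 2| ≤ |q (N + j) 2| := by
    intro j
    induction j with
    | zero => simp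
    | succ j ih =>
      have := hgrow (N + j) (by omega)
      rw [pow_succ]
      have e : N + (j + 1) = N + j + 1 := by omega
      rw [e]
      linarith
  obtain ⟨j, hj⟩ := ((tendsto_pow_atTop_atTop_of_one_lt (one_lt_two (α := ℝ))).eventually_gt_atTop
    (1 / 4 / |q N 2|)).exists
  rw [div_lt_iff₀ (abs_pos.2 hne)] at hj
  have := hpow j
  have := hz (N + j) (by omega)
  linarith

/-! ### The escaping set in the plane and its closure -/

/-- The point of the plane `z = 0` with the given coordinates. -/
def planePoint (p : ℝ × ℝ) : Space3 := !₂[p.1, p.2, 0]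

theorem continuous_planePoint : Continuous planePoint := by
  unfold planePoint
  refine (PiLp.continuous_toLp 2 _).comp (continuous_pi fun i => ?_)
  fin_cases i <;> simp <;> fun_prop

/-- The escaping set of the tangent map, as a subset of the plane. -/
def planarEscapingSet (lam : ℝ) : Set (ℝ × ℝ) :=
  {p | planePoint p ∈ escapingSet (genTanScaled lam)}

theorem isPlanarSymmetric_planarEscapingSet (lam : ℝ) :
    IsPlanarSymmetric (planarEscapingSet lam) where
  neg_fst x y h := by
    have := map_mem_escapingSet norm_negFst (genTanScaled_negFst lam) h
    simpa [planarEscapingSet, planePoint, negFst] using this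
  swap x y h := by
    have := map_mem_escapingSet norm_swapCoords (genTanScaled_swapCoords lam) h
    simpa [planarEscapingSet, planePoint, swapCoords] using this
  add_pi x y h := by
    have := mem_escapingSet_congr (genTanScaled_add_pi lam _) h
    have e : planePoint (x, y) + !₂[Real.pi, 0, 0] = planePoint (x + Real.pi, y) := by
      ext i; fin_cases i <;> simp [planePoint]
    rwa [e] at this
  add_half_pi x y h := by
    have h1 := map_mem_escapingSet norm_negFst (genTanScaled_negFst lam)
      (map_mem_escapingSet norm_swapCoords (genTanScaled_swapCoords lam)
      (map_mem_escapingSet norm_negFst (genTanScaled_negFst lam)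
      (map_mem_escapingSet norm_swapCoords (genTanScaled_swapCoords lam) h)))
    have := mem_escapingSet_congr (genTanScaled_add_half_pi lam _) h1
    have e : planePoint (x, y) + !₂[Real.pi / 2, Real.pi / 2, 0] =
        planePoint (x + Real.pi / 2, y + Real.pi / 2) := by
      ext i; fin_cases i <;> simp [planePoint]
    rwa [e] at this

theorem sectorMap_mem_planarEscapingSet_iff {lam x y : ℝ} (hy : 0 ≤ y) (hyx : y ≤ x) (hx : 0 < x)
    (hx2 : x < Real.pi / 2) (hxy : x + y ≤ Real.pi / 2) :
    (x, y) ∈ planarEscapingSet lam ↔ sectorMap lam x y ∈ planarEscapingSet lam :=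
  mem_escapingSet_shift (genTanScaled_sector hy hyx hx hx2 hxy)

/-- The retraction of the plane onto the closed chamber along the orbits of the symmetry group. -/
noncomputable def foldToChamber (p : ℝ × ℝ) : ℝ × ℝ :=
  let a := |Real.arcsin (Real.sin p.1)|
  let b := |Real.arcsin (Real.sin p.2)|
  (min (max a b) (Real.pi / 2 - min a b), min (min a b) (Real.pi / 2 - max a b))

theorem continuous_foldToChamber : Continuous foldToChamber := by
  unfold foldToChamber
  fun_prop

theorem foldToChamber_of_mem {x y : ℝ} (hy : 0 ≤ y) (hyx : y ≤ x) (hxy : x + y ≤ Real.pi / 2) :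
    foldToChamber (x, y) = (x, y) := by
  unfold foldToChamber
  rw [Real.arcsin_sin (by linarith) (by linarith), Real.arcsin_sin (by linarith) (by linarith),
    abs_of_nonneg (by linarith), abs_of_nonneg hy]
  simp only
  rw [max_eq_left hyx, min_eq_right hyx, min_eq_left (by linarith), min_eq_left (by linarith)]

theorem foldToChamber_mem (p : ℝ × ℝ) :
    0 ≤ (foldToChamber p).2 ∧ (foldToChamber p).2 ≤ (foldToChamber p).1 ∧
      (foldToChamber p).1 + (foldToChamber p).2 ≤ Real.pi / 2 := by
  have ha := abs_arcsin_le (Real.sin p.1)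
  have hb := abs_arcsin_le (Real.sin p.2)
  have ha0 := abs_nonneg (Real.arcsin (Real.sin p.1))
  have hb0 := abs_nonneg (Real.arcsin (Real.sin p.2))
  unfold foldToChamber
  set a := |Real.arcsin (Real.sin p.1)|
  set b := |Real.arcsin (Real.sin p.2)|
  simp only
  have h1 : min a b ≤ max a b := min_le_max
  have h2 : 0 ≤ min a b := le_min ha0 hb0
  have h3 : max a b ≤ Real.pi / 2 := max_le ha hb
  refine ⟨le_min h2 (by linarith), le_min ?_ ?_, ?_⟩
  · exact (min_le_left _ _).trans h1
  · exact (min_le_right _ _).trans (by linarith)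
  · rcases le_total (max a b) (Real.pi / 2 - min a b) with h | h
    · rw [min_eq_left h, min_eq_left (by linarith)]; linarith
    · rw [min_eq_right h, min_eq_right (show Real.pi / 2 - max a b ≤ min a b by linarith)]; linarith

namespace IsPlanarSymmetric

variable {C : Set (ℝ × ℝ)}

theorem closure (h : IsPlanarSymmetric C) : IsPlanarSymmetric (closure C) where
  neg_fst x y hp := map_mem_closure (f := fun p : ℝ × ℝ => (-p.1, p.2)) (by fun_prop) hp
    fun p hp => h.neg_fst p.1 p.2 hp
  swap x y hp := map_mem_closure (f := fun p : ℝ × ℝ => (p.2, p.1)) (by fun_prop) hp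
    fun p hp => h.swap p.1 p.2 hp
  add_pi x y hp := map_mem_closure (f := fun p : ℝ × ℝ => (p.1 + Real.pi, p.2)) (by fun_prop) hp
    fun p hp => h.add_pi p.1 p.2 hp
  add_half_pi x y hp := map_mem_closure
    (f := fun p : ℝ × ℝ => (p.1 + Real.pi / 2, p.2 + Real.pi / 2)) (by fun_prop) hp
    fun p hp => h.add_half_pi p.1 p.2 hp

theorem abs_fst (h : IsPlanarSymmetric C) {x y : ℝ} (hp : (x, y) ∈ C) : (|x|, y) ∈ C := by
  rcases abs_choice x with hx | hx <;> rw [hx]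
  · exact hp
  · exact h.neg_fst _ _ hp

theorem abs_arcsin_sin_fst (h : IsPlanarSymmetric C) {x y : ℝ} (hp : (x, y) ∈ C) :
    (|Real.arcsin (Real.sin x)|, y) ∈ C := by
  have h1 := h.add_int_mul_pi (-stripIndex x) hp
  rw [Int.cast_neg, neg_mul, ← sub_eq_add_neg] at h1
  rw [← foldCoord_eq, foldCoord, abs_mul, abs_zpow, abs_neg, abs_one, one_zpow, one_mul]
  exact h.abs_fst h1

theorem sort_mem (h : IsPlanarSymmetric C) {x y : ℝ} (hp : (x, y) ∈ C) :
    (max x y, min x y) ∈ C := by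
  rcases le_total x y with h1 | h1
  · rw [max_eq_right h1, min_eq_left h1]; exact h.swap _ _ hp
  · rw [max_eq_left h1, min_eq_right h1]; exact hp

theorem foldToChamber_mem (h : IsPlanarSymmetric C) {p : ℝ × ℝ} (hp : p ∈ C) :
    foldToChamber p ∈ C := by
  have h1 := h.sort_mem (h.swap _ _ (h.abs_arcsin_sin_fst (h.swap _ _
    (h.abs_arcsin_sin_fst (x := p.1) (y := p.2) hp))))
  unfold foldToChamber
  set a := |Real.arcsin (Real.sin p.1)|
  set b := |Real.arcsin (Real.sin p.2)|
  simp only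
  rcases le_total (max a b) (Real.pi / 2 - min a b) with h2 | h2
  · rw [min_eq_left h2, min_eq_left (by linarith)]; exact h1
  · rw [min_eq_right h2, min_eq_right (show Real.pi / 2 - max a b ≤ min a b by linarith)]
    exact h.reflect h1

end IsPlanarSymmetric

/-- Escaping points near `(x, y)` need not lie in the chamber when `(x, y)` is on its boundary.
Folding moves them into it continuously while fixing `(x, y)`, and then `sectorMap` is continuous
along the sequence. The converse sorts absolute values instead and uses the continuous inverse
branch. -/
theorem sectorMap_mem_closure_iff {lam x y : ℝ} (hlam : 0 < lam) (hy : 0 ≤ y) (hyx : y ≤ x)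
    (hx : 0 < x) (hx2 : x < Real.pi / 2) (hxy : x + y ≤ Real.pi / 2) :
    (x, y) ∈ closure (planarEscapingSet lam) ↔
      sectorMap lam x y ∈ closure (planarEscapingSet lam) := by
  have hsym := isPlanarSymmetric_planarEscapingSet lam
  constructor
  · intro h
    obtain ⟨e, he, hlim⟩ := mem_closure_iff_seq_limit.1 h
    have h1 : Tendsto (fun n => foldToChamber (e n)) atTop (𝓝 (x, y)) := by
      have := (continuous_foldToChamber.tendsto (x, y)).comp hlim
      rwa [foldToChamber_of_mem hy hyx hxy] at this
    have h2 : Tendsto (fun n => sectorMap lam (foldToChamber (e n)).1 (foldToChamber (e n)).2)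
        atTop (𝓝 (sectorMap lam x y)) :=
      (continuousAt_sectorMap (lam := lam) (p := (x, y)) hx hx2).tendsto.comp h1
    have h3 : Tendsto (fun n => (foldToChamber (e n)).1) atTop (𝓝 x) :=
      (continuous_fst.tendsto _).comp h1
    refine mem_closure_of_tendsto h2 ?_
    filter_upwards [h3.eventually (lt_mem_nhds hx), h3.eventually (gt_mem_nhds hx2)] with n hn1 hn2
    obtain ⟨m1, m2, m3⟩ := foldToChamber_mem (e n)
    exact (sectorMap_mem_planarEscapingSet_iff m1 m2 hn1 hn2 m3).1
      (hsym.foldToChamber_mem (he n))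
  · intro h
    obtain ⟨e, he, hlim⟩ := mem_closure_iff_seq_limit.1 h
    obtain ⟨s1, s2, s3⟩ := sectorMap_mem_closedSector hlam hx hx2 hy hyx hxy
    set s : ℝ × ℝ → ℝ × ℝ := fun q => (max |q.1| |q.2|, min |q.1| |q.2|) with hs
    have hsc : Continuous s := by fun_prop
    have hse : ∀ q ∈ planarEscapingSet lam, s q ∈ planarEscapingSet lam := fun q hq =>
      hsym.sort_mem (hsym.swap _ _ (hsym.abs_fst (hsym.swap _ _ (hsym.abs_fst hq))))
    have h1 : Tendsto (fun n => s (e n)) atTop (𝓝 (sectorMap lam x y)) := by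
      have := (hsc.tendsto (sectorMap lam x y)).comp hlim
      have hfix : s (sectorMap lam x y) = sectorMap lam x y := by
        simp only [hs]
        rw [abs_of_pos s1, abs_of_nonneg s2, max_eq_left s3, min_eq_right s3]
      rwa [hfix] at this
    have h2 : Tendsto (fun n => sectorInv lam (s (e n))) atTop (𝓝 (x, y)) := by
      have := (continuousAt_sectorInv (lam := lam) s1).tendsto.comp h1
      rwa [sectorInv_sectorMap hlam hx hx2] at this
    have h3 : Tendsto (fun n => (s (e n)).1) atTop (𝓝 (sectorMap lam x y).1) :=
      (continuous_fst.tendsto _).comp h1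
    refine mem_closure_of_tendsto h2 ?_
    filter_upwards [h3.eventually (lt_mem_nhds s1)] with n hn1
    have m1 : 0 ≤ (s (e n)).2 := le_min (abs_nonneg _) (abs_nonneg _)
    have m2 : (s (e n)).2 ≤ (s (e n)).1 := min_le_max
    obtain ⟨i1, i2, i3, i4, i5⟩ := sectorInv_mem hlam hn1 m1 m2
    have := (sectorMap_mem_planarEscapingSet_iff (lam := lam) i1 i2 i3 i4 i5).2
      (by rw [sectorMap_sectorInv hlam hn1]; exact hse _ (he n))
    exact this

/-! ### Escaping points on the axis -/

theorem sectorMap_axis {lam x : ℝ} (hx : 0 < x) (hx2 : x < Real.pi / 2) :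
    sectorMap lam x 0 = (lam * Real.tan x, 0) := by
  have hm : 0 < min x (Real.pi / 2 - x) := lt_min hx (by linarith)
  unfold sectorMap
  rw [zero_pow two_ne_zero, add_zero, Real.sqrt_sq hm.le]
  ext <;> simp only
  · exact mul_div_cancel_right₀ _ hm.ne'
  · simp

theorem arctan_mem_planarEscapingSet {lam y : ℝ} (hlam : 0 < lam)
    (h : (y, 0) ∈ planarEscapingSet lam) : (Real.arctan (y / lam), 0) ∈ planarEscapingSet lam := by
  have hsym := isPlanarSymmetric_planarEscapingSet lam
  have key : ∀ y, 0 < y → (y, 0) ∈ planarEscapingSet lam →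
      (Real.arctan (y / lam), 0) ∈ planarEscapingSet lam := by
    intro y hy hp
    have h1 : 0 < Real.arctan (y / lam) := Real.arctan_pos.2 (by positivity)
    have h2 := Real.arctan_lt_pi_div_two (y / lam)
    rw [sectorMap_mem_planarEscapingSet_iff le_rfl h1.le h1 h2 (by linarith), sectorMap_axis h1 h2,
      Real.tan_arctan, mul_div_cancel₀ _ hlam.ne']
    exact hp
  rcases lt_trichotomy y 0 with hy | rfl | hy
  · have := hsym.neg_fst _ _ (key (-y) (by linarith) (hsym.neg_fst _ _ h))
    rwa [neg_div, Real.arctan_neg, neg_neg] at this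
  · simpa using h
  · exact key y hy h

theorem abs_arctan_sub_le (a b : ℝ) : |Real.arctan a - Real.arctan b| ≤ |a - b| := by
  have h : LipschitzWith 1 Real.arctan := by
    refine lipschitzWith_of_nnnorm_deriv_le Real.differentiable_arctan fun x => ?_
    rw [Real.deriv_arctan, ← NNReal.coe_le_coe, coe_nnnorm, Real.norm_eq_abs,
      abs_of_pos (by positivity), NNReal.coe_one, div_le_one (by positivity)]
    nlinarith [sq_nonneg x]
  simpa [Real.dist_eq] using h.dist_le_mul a b

/-- Finite approximations of an orbit on the real axis that visits consecutive strips. -/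
noncomputable def stripApprox (lam : ℝ) : ℕ → ℕ → ℝ
  | 0, n => n * Real.pi
  | d + 1, n => n * Real.pi + Real.arctan (stripApprox lam d (n + 1) / lam)

/-- An orbit visiting the strips `[n π, n π + π/2)` in turn satisfies `X n = n π + arctan (X (n + 1)
/ lam)`. The finite approximations increase and are bounded, so their suprema solve this recursion.
-/
theorem exists_axis_escaping {lam : ℝ} (hlam : 0 < lam) :
    ∃ x, (x, 0) ∈ planarEscapingSet lam := by
  have hpi := Real.pi_pos
  have hnonneg : ∀ d n, 0 ≤ stripApprox lam d n := by
    intro d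
    induction d with
    | zero => intro n; simp only [stripApprox]; positivity
    | succ d ih =>
      intro n
      have := Real.arctan_nonneg.2 (div_nonneg (ih (n + 1)) hlam.le)
      simp only [stripApprox]; positivity
  have hmono : ∀ d n, stripApprox lam d n ≤ stripApprox lam (d + 1) n := by
    intro d
    induction d with
    | zero =>
      intro n
      have := Real.arctan_nonneg.2 (div_nonneg (hnonneg 0 (n + 1)) hlam.le)
      simp only [stripApprox] at this ⊢; linarith
    | succ d ih =>
      intro n
      have := Real.arctan_strictMono.monotone (div_le_div_of_nonneg_right (ih (n + 1)) hlam.le)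
      simp only [stripApprox] at this ⊢; linarith
  have hbdd : ∀ n, BddAbove (Set.range fun d => stripApprox lam d n) := by
    intro n
    refine ⟨n * Real.pi + Real.pi / 2, ?_⟩
    rintro _ ⟨d, rfl⟩
    cases d with
    | zero => simp only [stripApprox]; linarith
    | succ d =>
      have := Real.arctan_lt_pi_div_two (stripApprox lam d (n + 1) / lam)
      simp only [stripApprox]; linarith
  set X : ℕ → ℝ := fun n => ⨆ d, stripApprox lam d n with hX
  have hlim : ∀ n, Tendsto (fun d => stripApprox lam d n) atTop (𝓝 (X n)) := fun n =>
    tendsto_atTop_ciSup (monotone_nat_of_le_succ fun d => hmono d n) (hbdd n)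
  have hrec : ∀ n, X n = n * Real.pi + Real.arctan (X (n + 1) / lam) := by
    intro n
    refine tendsto_nhds_unique ((tendsto_add_atTop_iff_nat 1).2 (hlim n)) ?_
    simp only [stripApprox]
    exact tendsto_const_nhds.add ((Real.continuous_arctan.tendsto _).comp
      ((hlim (n + 1)).div_const lam))
  have hge : ∀ n : ℕ, n * Real.pi ≤ X n := fun n => le_ciSup (hbdd n) 0
  have hpos : ∀ n : ℕ, 0 < X (n + 1) := fun n =>
    lt_of_lt_of_le (by positivity) (hge (n + 1))
  refine ⟨X 0, mem_escapingSet_iff.2 ⟨fun n => planePoint (X n, 0), rfl, fun n => ?_, ?_⟩⟩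
  · have ha : 0 < Real.arctan (X (n + 1) / lam) := Real.arctan_pos.2 (div_pos (hpos n) hlam)
    have ha2 := Real.arctan_lt_pi_div_two (X (n + 1) / lam)
    have hper : ∀ m : ℕ, ∀ a : ℝ, genTanScaled lam (planePoint (m * Real.pi + a, 0)) =
        genTanScaled lam (planePoint (a, 0)) := by
      intro m a
      induction m with
      | zero => simp
      | succ m ih =>
        rw [← ih, ← genTanScaled_add_pi lam (planePoint (m * Real.pi + a, 0))]
        congr 1
        ext i
        fin_cases i <;> simp [planePoint]
        ring
    have h1 := genTanScaled_sector (lam := lam) le_rfl ha.le ha ha2 (by linarith)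
    change genTanScaled lam (planePoint (X n, 0)) = (planePoint (X (n + 1), 0) : OnePoint Space3)
    rw [hrec n, hper]
    refine h1.trans ?_
    rw [sectorMap_axis ha ha2, Real.tan_arctan, mul_div_cancel₀ _ hlam.ne']
    rfl
  · have hnorm : ∀ n, ‖planePoint (X n, 0)‖ = |X n| := by
      intro n
      rw [EuclideanSpace.norm_eq, Fin.sum_univ_three]
      simp [planePoint, Real.sqrt_sq_eq_abs]
    simp only [hnorm]
    refine tendsto_atTop_mono (fun n => (hge n).trans (le_abs_self _)) ?_
    exact tendsto_natCast_atTop_atTop.atTop_mul_const hpi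

/-- By periodicity escaping points come within `π` of any real number. The inverse branches `arctan
(· / lam)` contract by `1 / lam`, so `n` pullbacks improve this to `π / lam ^ n`. -/
theorem exists_axis_escaping_near {lam : ℝ} (hlam : 1 < lam) (n : ℕ) :
    ∀ y ε : ℝ, 0 < ε →
      ∃ x, (x, 0) ∈ planarEscapingSet lam ∧ |x - y| < Real.pi / lam ^ n + ε := by
  have hpi := Real.pi_pos
  have hlam0 : 0 < lam := by linarith
  have hsym := isPlanarSymmetric_planarEscapingSet lam
  induction n with
  | zero =>
    intro y ε hε
    obtain ⟨x, hx⟩ := exists_axis_escaping hlam0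
    have h1 := sub_stripIndex_mem (x - y)
    refine ⟨_, hsym.add_int_mul_pi (-stripIndex (x - y)) hx, ?_⟩
    rw [abs_lt]
    push_cast
    constructor <;> simp only [pow_zero, div_one] <;> linarith [h1.1, h1.2]
  | succ n ih =>
    intro y ε hε
    obtain ⟨h1, h2⟩ := sub_stripIndex_mem y
    set k := stripIndex y
    set u := y - k * Real.pi with hu
    obtain ⟨δ, hδ0, hδ1, hδ⟩ : ∃ δ : ℝ, 0 < δ ∧ δ < 1 ∧ δ * (Real.pi / 2) < ε / 2 := by
      refine ⟨min (1 / 2) (ε / 2 / Real.pi), by positivity,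
        lt_of_le_of_lt (min_le_left _ _) (by norm_num), ?_⟩
      have := min_le_right (1 / 2) (ε / 2 / Real.pi)
      rw [le_div_iff₀ hpi] at this
      have h3 : 0 < min (1 / 2) (ε / 2 / Real.pi) := by positivity
      nlinarith
    -- Shrinking `u` slightly keeps it off `±π/2`, where `arctan` does not invert `tan`; the error
    -- is absorbed in `ε`.
    set u' := (1 - δ) * u with hu'
    have hu1 : -(Real.pi / 2) < u' := by nlinarith
    have hu2 : u' < Real.pi / 2 := by nlinarith
    have hclose : |u' - u| < ε / 2 := by
      rw [show u' - u = -(δ * u) by rw [hu']; ring, abs_neg, abs_mul, abs_of_pos hδ0]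
      have : |u| ≤ Real.pi / 2 := abs_le.2 ⟨h1, h2⟩
      nlinarith
    obtain ⟨z, hz, hzd⟩ := ih (lam * Real.tan u') (ε / 2) (by linarith)
    refine ⟨_, hsym.add_int_mul_pi k (arctan_mem_planarEscapingSet hlam0 hz), ?_⟩
    have h3 : |Real.arctan (z / lam) - u'| ≤ |z - lam * Real.tan u'| / lam := by
      have := abs_arctan_sub_le (z / lam) (Real.tan u')
      rw [Real.arctan_tan hu1 hu2] at this
      refine this.trans (le_of_eq ?_)
      rw [show z / lam - Real.tan u' = (z - lam * Real.tan u') / lam by field_simp, abs_div,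
        abs_of_pos hlam0]
    have h4 : |z - lam * Real.tan u'| / lam < Real.pi / lam ^ (n + 1) + ε / 2 := by
      rw [div_lt_iff₀ hlam0, add_mul, pow_succ,
        show Real.pi / (lam ^ n * lam) * lam = Real.pi / lam ^ n by field_simp]
      nlinarith
    have h5 : Real.arctan (z / lam) + k * Real.pi - y =
        (Real.arctan (z / lam) - u') + (u' - u) := by rw [hu]; ring
    rw [h5]
    have := abs_add_le (Real.arctan (z / lam) - u') (u' - u)
    linarith

theorem axis_mem_closure {lam : ℝ} (hlam : 1 < lam) (x : ℝ) :
    (x, 0) ∈ closure (planarEscapingSet lam) := by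
  rw [Metric.mem_closure_iff]
  intro ε hε
  have hlim : Tendsto (fun n : ℕ => Real.pi / lam ^ n) atTop (𝓝 0) :=
    (tendsto_pow_atTop_atTop_of_one_lt hlam).const_div_atTop _
  obtain ⟨n, hn⟩ := (hlim.eventually_lt_const (show 0 < ε / 2 by linarith)).exists
  obtain ⟨z, hz, hzd⟩ := exists_axis_escaping_near hlam n x (ε / 2) (by linarith)
  refine ⟨_, hz, ?_⟩
  rw [dist_comm, Prod.dist_eq, dist_self, Real.dist_eq, max_lt_iff]
  exact ⟨by linarith, hε⟩

theorem isTangentInvariant_closure {lam : ℝ} (hlam : 1 < lam) :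
    IsTangentInvariant lam (closure (planarEscapingSet lam)) where
  toIsPlanarSymmetric := (isPlanarSymmetric_planarEscapingSet lam).closure
  isClosed := isClosed_closure
  axis := axis_mem_closure hlam
  sector := fun _ _ hy hyx hx hx2 hxy =>
    sectorMap_mem_closure_iff (by linarith) hy hyx hx hx2 hxy

theorem eq_planePoint {p : Space3} (hp : p ∈ xyPlane) : p = planePoint (p 0, p 1) := by
  ext i
  fin_cases i <;> simp [planePoint]
  exact hp

/-- For `lam > √2` the escaping points are dense in the plane `z = 0`. -/
theorem closure_escapingSet_eq {lam : ℝ} (hlam : √2 < lam) :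
    closure (escapingSet (genTanScaled lam)) = xyPlane := by
  have h1 : 1 < lam := lt_trans (by rw [Real.lt_sqrt] <;> norm_num) hlam
  have hcl : IsClosed xyPlane :=
    isClosed_eq (PiLp.continuous_apply 2 (fun _ : Fin 3 => ℝ) 2) continuous_const
  refine Set.Subset.antisymm
    (closure_minimal (escapingSet_subset_xyPlane (by linarith)) hcl) fun p hp => ?_
  have h2 := (isTangentInvariant_closure h1).eq_univ hlam
  rw [eq_planePoint hp]
  exact map_mem_closure continuous_planePoint (h2 ▸ Set.mem_univ (p 0, p 1)) fun q hq => hq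

/-! ### Attraction along rays -/

/-- Monotonicity of `tan x / x`, deduced from the concavity of `arctan`. Consequently `μ tan x < x`
at one point passes to all smaller positive points. -/
theorem tan_mul_le_tan_mul {x y : ℝ} (hx : 0 < x) (hxy : x ≤ y) (hy : y < Real.pi / 2) :
    Real.tan x * y ≤ Real.tan y * x := by
  have hy0 : 0 < y := hx.trans_le hxy
  have hu : 0 < Real.tan x := Real.tan_pos_of_pos_of_lt_pi_div_two hx (hxy.trans_lt hy)
  have hv : 0 < Real.tan y := Real.tan_pos_of_pos_of_lt_pi_div_two hy0 hy
  have huv : Real.tan x ≤ Real.tan y :=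
    Real.strictMonoOn_tan.monotoneOn ⟨by linarith, by linarith⟩ ⟨by linarith, hy⟩ hxy
  have h := concaveOn_arctan.2 (x := 0) (y := Real.tan y) (by simp) hv.le
    (sub_nonneg.2 ((div_le_one hv).2 huv)) (div_nonneg hu.le hv.le) (by ring)
  simp only [smul_eq_mul, Real.arctan_zero, mul_zero, zero_add] at h
  rw [div_mul_cancel₀ _ hv.ne', Real.arctan_tan (by linarith) hy,
    Real.arctan_tan (by linarith) (by linarith), div_mul_eq_mul_div, div_le_iff₀ hv] at h
  linarith

theorem mul_tan_lt_of_le {μ x t : ℝ} (hμ : 0 ≤ μ) (hx : 0 < x) (hxt : x ≤ t)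
    (ht : t < Real.pi / 2) (h : μ * Real.tan t < t) : μ * Real.tan x < x := by
  have h1 := mul_le_mul_of_nonneg_left (tan_mul_le_tan_mul hx hxt ht) hμ
  have h2 := mul_lt_mul_of_pos_right h hx
  have h3 : (μ * Real.tan x) * t < x * t := by linarith
  exact lt_of_mul_lt_mul_right h3 (hx.trans_le hxt).le

theorem continuousOn_tan_Icc {a b : ℝ} (ha : -(Real.pi / 2) < a) (hb : b < Real.pi / 2) :
    ContinuousOn Real.tan (Set.Icc a b) :=
  Real.continuousOn_tan_Ioo.mono fun _ hx => ⟨ha.trans_le hx.1, hx.2.trans_lt hb⟩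

theorem bddBelow_fixedPt (μ : ℝ) : BddBelow {x : ℝ | 0 < x ∧ μ * Real.tan x = x} :=
  ⟨0, fun _ hx => hx.1.le⟩

theorem exists_mul_tan_lt {μ t : ℝ} (hμ : 0 ≤ μ) (hμ1 : μ < 1) (ht0 : 0 < t)
    (ht : t ≤ Real.pi / 2) : ∃ x, 0 < x ∧ x < t ∧ μ * Real.tan x < x := by
  have hev : ∀ᶠ x in 𝓝[>] (0 : ℝ), μ < Real.cos x ∧ x < t ∧ 0 < x := by
    have h1 : ∀ᶠ x in 𝓝 (0 : ℝ), μ < Real.cos x :=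
      (Real.continuous_cos.tendsto 0).eventually (lt_mem_nhds (by simpa using hμ1))
    filter_upwards [nhdsWithin_le_nhds h1, nhdsWithin_le_nhds (gt_mem_nhds ht0),
      self_mem_nhdsWithin] with x a b c using ⟨a, b, c⟩
  obtain ⟨x, hx1, hxt, hx0⟩ := hev.exists
  have hsin : 0 < Real.sin x := Real.sin_pos_of_pos_of_lt_pi hx0 (by linarith [Real.pi_pos])
  refine ⟨x, hx0, hxt, ?_⟩
  rw [Real.tan_eq_sin_div_cos, ← mul_div_assoc, div_lt_iff₀ (hμ.trans_lt hx1)]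
  nlinarith [Real.sin_lt hx0]

theorem mul_tan_lt_of_lt_smallestFixedPt {μ t : ℝ} (hμ : 0 ≤ μ) (hμ1 : μ < 1) (ht0 : 0 < t)
    (ht : t < Real.pi / 2) (h : t < smallestFixedPt μ) : μ * Real.tan t < t := by
  by_contra! hge
  obtain ⟨x, hx0, hxt, hx⟩ := exists_mul_tan_lt hμ hμ1 ht0 ht.le
  have hc : ContinuousOn (fun s => μ * Real.tan s - s) (Set.Icc x t) :=
    ((continuousOn_tan_Icc (by linarith) ht).const_smul μ).sub continuousOn_id
  obtain ⟨s, hs, hs0⟩ := intermediate_value_Icc hxt.le hc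
    (show (0 : ℝ) ∈ Set.Icc _ _ from ⟨by simpa using hx.le, by simpa using hge⟩)
  have : smallestFixedPt μ ≤ s := csInf_le (bddBelow_fixedPt μ)
    ⟨hx0.trans_le hs.1, sub_eq_zero.1 hs0⟩
  linarith [hs.2]

/-- The inequality persists slightly beyond `t`, so fixed points stay a definite distance above `t`.
One must also exist, since the infimum of the empty set is `0` by convention. -/
theorem lt_smallestFixedPt_of_mul_tan_lt {μ t : ℝ} (hμ : 0 < μ) (ht0 : 0 < t)
    (ht : t < Real.pi / 2) (h : μ * Real.tan t < t) : t < smallestFixedPt μ := by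
  have hpi := Real.pi_pos
  have hcont : ContinuousAt (fun s => μ * Real.tan s - s) t :=
    ((Real.continuousAt_tan.2 (Real.cos_pos_of_mem_Ioo ⟨by linarith, ht⟩).ne').const_smul μ).sub
      continuousAt_id
  have hev : ∀ᶠ s in 𝓝[>] t, μ * Real.tan s - s < 0 ∧ s < Real.pi / 2 ∧ t < s := by
    filter_upwards [nhdsWithin_le_nhds (hcont.eventually (gt_mem_nhds (sub_neg.2 h))),
      nhdsWithin_le_nhds (gt_mem_nhds ht), self_mem_nhdsWithin] with x a b c using ⟨a, b, c⟩
  obtain ⟨t', h1, h2, h3⟩ := hev.exists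
  rw [sub_neg] at h1
  have hne : {x : ℝ | 0 < x ∧ μ * Real.tan x = x}.Nonempty := by
    -- At this `b` the value `μ tan b = π/2` exceeds `b`, which supplies the other sign for the
    -- intermediate value theorem.
    set b := Real.arctan (Real.pi / 2 / μ) with hb
    have hb1 : μ * Real.tan b = Real.pi / 2 := by rw [Real.tan_arctan]; field_simp
    have hb0 : 0 < b := Real.arctan_pos.2 (by positivity)
    have hb2 : b < Real.pi / 2 := Real.arctan_lt_pi_div_two _
    have htb : t ≤ b := by
      by_contra! hlt
      have := mul_tan_lt_of_le hμ.le hb0 hlt.le ht h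
      linarith
    have hc : ContinuousOn (fun s => μ * Real.tan s - s) (Set.Icc t b) :=
      ((continuousOn_tan_Icc (by linarith) hb2).const_smul μ).sub continuousOn_id
    obtain ⟨s, hs, hs0⟩ := intermediate_value_Icc htb hc
      (show (0 : ℝ) ∈ Set.Icc _ _ from ⟨by simpa using h.le, by simp only [hb1]; linarith⟩)
    exact ⟨s, ht0.trans_le hs.1, sub_eq_zero.1 hs0⟩
  refine h3.trans_le (le_csInf hne fun x hx => ?_)
  by_contra! hlt
  exact (mul_tan_lt_of_le hμ.le hx.1 hlt.le h2 h1).ne hx.2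

/-- Below the smallest fixed point the iterates decrease; their limit is fixed and hence `0`. -/
theorem tendsto_iterate_mul_tan {μ t : ℝ} (hμ : 0 < μ) (hμ1 : μ < 1) (ht0 : 0 < t)
    (ht : t < Real.pi / 2) (h : t < smallestFixedPt μ) :
    (∀ n, (fun x => μ * Real.tan x)^[n] t ∈ Set.Ioc 0 t) ∧
      Tendsto (fun n => (fun x => μ * Real.tan x)^[n] t) atTop (𝓝 0) := by
  set g : ℝ → ℝ := fun x => μ * Real.tan x with hg
  have hlt : ∀ x ∈ Set.Ioc 0 t, g x < x := fun x hx =>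
    mul_tan_lt_of_lt_smallestFixedPt hμ.le hμ1 hx.1 (hx.2.trans_lt ht) (hx.2.trans_lt h)
  have hmem : ∀ n, g^[n] t ∈ Set.Ioc 0 t := by
    intro n
    induction n with
    | zero => exact ⟨ht0, le_rfl⟩
    | succ n ih =>
      rw [Function.iterate_succ_apply']
      exact ⟨mul_pos hμ (Real.tan_pos_of_pos_of_lt_pi_div_two ih.1 (ih.2.trans_lt ht)),
        (hlt _ ih).le.trans ih.2⟩
  refine ⟨hmem, ?_⟩
  have hanti : Antitone fun n => g^[n] t := antitone_nat_of_succ_le fun n => by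
    rw [Function.iterate_succ_apply']
    exact (hlt _ (hmem n)).le
  have hbdd : BddBelow (Set.range fun n => g^[n] t) := ⟨0, by
    rintro _ ⟨n, rfl⟩
    exact (hmem n).1.le⟩
  have hlim := tendsto_atTop_ciInf hanti hbdd
  set L := ⨅ n, g^[n] t with hL
  have hL0 : 0 ≤ L := ge_of_tendsto' hlim fun n => (hmem n).1.le
  have hLt : L ≤ t := le_of_tendsto' hlim fun n => (hmem n).2
  have hcont : ContinuousAt g L := (Real.continuousAt_tan.2
    (Real.cos_pos_of_mem_Ioo ⟨by linarith [Real.pi_pos], by linarith⟩).ne').const_smul μ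
  have hfix : g L = L := by
    refine tendsto_nhds_unique (hcont.tendsto.comp hlim) ?_
    have := (tendsto_add_atTop_iff_nat 1).2 hlim
    simpa only [Function.iterate_succ_apply', Function.comp_def] using this
  rcases hL0.eq_or_lt with h0 | h0
  · rwa [← h0] at hlim
  · exact absurd hfix (hlt L ⟨h0, hLt⟩).ne

theorem mem_basin_of_tendsto {f : Space3 → OnePoint Space3} {p₀ : Space3} {q : ℕ → Space3}
    (h1 : ∀ k, f (q k) = (q (k + 1) : OnePoint Space3)) (h2 : Tendsto q atTop (𝓝 p₀)) :
    q 0 ∈ basin f p₀ := by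
  have h3 : ∀ k, orbit f k (q 0) = (q k : OnePoint Space3) := by
    intro k
    induction k with
    | zero => rfl
    | succ k ih => simp [orbit, ih, h1]
  change Tendsto (fun k => orbit f k (q 0)) _ _
  simp only [h3]
  exact (OnePoint.continuous_coe.tendsto p₀).comp h2

theorem map_mem_basin {f : Space3 → OnePoint Space3} {R : Space3 → Space3} {p₀ : Space3}
    (hR : Continuous R) (hR0 : R p₀ = p₀) (hf : ∀ p, f (R p) = OnePoint.map R (f p)) {p : Space3}
    (hp : p ∈ basin f p₀) : R p ∈ basin f p₀ := by
  have h1 : ∀ k, orbit f k (R p) = OnePoint.map R (orbit f k p) := by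
    intro k
    induction k with
    | zero => rfl
    | succ k ih =>
      simp only [orbit, ih]
      cases orbit f k p with
      | infty => simp
      | coe v => simp [hf]
  -- Continuity is needed only at the finite point `p₀`, so nothing is required of `R` near
  -- infinity.
  have h2 : ContinuousAt (OnePoint.map R) (p₀ : OnePoint Space3) := by
    rw [OnePoint.continuousAt_coe]
    exact (OnePoint.continuous_coe.comp hR).continuousAt
  have h3 := h2.tendsto.comp (show Tendsto _ _ _ from hp)
  rw [OnePoint.map_some, hR0] at h3
  change Tendsto (fun k => orbit f k (R p)) _ _
  simpa only [h1, Function.comp_def] using h3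

theorem disjoint_basin_escapingSet (f : Space3 → OnePoint Space3) (p₀ : Space3) :
    Disjoint (basin f p₀) (escapingSet f) :=
  Set.disjoint_left.2 fun _ h1 h2 => OnePoint.coe_ne_infty p₀ (tendsto_nhds_unique h1 h2.2)

theorem continuous_negFst : Continuous negFst := by
  unfold negFst
  refine (PiLp.continuous_toLp 2 _).comp (continuous_pi fun i => ?_)
  fin_cases i <;> simp <;> fun_prop

theorem continuous_swapCoords : Continuous swapCoords := by
  unfold swapCoords
  refine (PiLp.continuous_toLp 2 _).comp (continuous_pi fun i => ?_)
  fin_cases i <;> simp <;> fun_prop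

/-- The basin of the origin, as a subset of the plane. -/
def planarBasin (lam : ℝ) : Set (ℝ × ℝ) := {p | planePoint p ∈ basin (genTanScaled lam) 0}

theorem neg_fst_mem_planarBasin {lam x y : ℝ} (h : (x, y) ∈ planarBasin lam) :
    (-x, y) ∈ planarBasin lam := by
  have := map_mem_basin continuous_negFst (by ext i; fin_cases i <;> simp [negFst])
    (genTanScaled_negFst lam) h
  simpa [planarBasin, planePoint, negFst] using this

theorem swap_mem_planarBasin {lam x y : ℝ} (h : (x, y) ∈ planarBasin lam) :
    (y, x) ∈ planarBasin lam := by
  have := map_mem_basin continuous_swapCoords (by ext i; fin_cases i <;> simp [swapCoords])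
    (genTanScaled_swapCoords lam) h
  simpa [planarBasin, planePoint, swapCoords] using this

theorem mem_planarBasin_of_abs {lam x y : ℝ} (h : (|x|, |y|) ∈ planarBasin lam) :
    (x, y) ∈ planarBasin lam := by
  have key : ∀ u v : ℝ, (|u|, v) ∈ planarBasin lam → (u, v) ∈ planarBasin lam := by
    intro u v huv
    rcases abs_choice u with hu | hu <;> rw [hu] at huv
    · exact huv
    · simpa using neg_fst_mem_planarBasin huv
  exact swap_mem_planarBasin (key _ _ (swap_mem_planarBasin (key _ _ h)))

theorem ray_mem_planarBasin {lam t α : ℝ} (hlam : 0 < lam) (hα0 : 0 ≤ α) (hα1 : α ≤ 1)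
    (hα : lam ^ 2 < 1 + α ^ 2) (ht0 : 0 < t) (ht : t < petalBound lam α) :
    (t, α * t) ∈ planarBasin lam := by
  have hpi := Real.pi_pos
  obtain ⟨ht4, htφ⟩ := lt_min_iff.1 ht
  have hr : 0 < √(1 + α ^ 2) := Real.sqrt_pos.2 (by positivity)
  have hμ1 : lam / √(1 + α ^ 2) < 1 := by
    rw [div_lt_one hr]
    exact Real.lt_sqrt_of_sq_lt hα
  obtain ⟨h1, h2⟩ := tendsto_iterate_mul_tan (div_pos hlam hr) hμ1 ht0 (by linarith) htφ
  set s : ℕ → ℝ := fun n => (fun x => lam / √(1 + α ^ 2) * Real.tan x)^[n] t with hs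
  have := mem_basin_of_tendsto (f := genTanScaled lam) (p₀ := 0)
    (q := fun n => planePoint (s n, α * s n)) (fun k => ?_) ?_
  · exact this
  · have h3 : α * s k ≤ s k := mul_le_of_le_one_left (h1 k).1.le hα1
    have h4 : s k ≤ t := (h1 k).2
    have h5 : 0 < s k := (h1 k).1
    have h6 := genTanScaled_sector (lam := lam) (x := s k) (y := α * s k) (by positivity) h3 h5
      (by linarith) (by linarith)
    rw [sectorMap_ray h5 (by linarith)] at h6
    refine h6.trans ?_
    simp only [hs, Function.iterate_succ_apply', planePoint]
  · have h3 : Tendsto (fun n => planePoint (s n, α * s n)) atTop (𝓝 (planePoint (0, α * 0))) :=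
      (continuous_planePoint.tendsto _).comp (h2.prodMk_nhds (h2.const_mul α))
    have h4 : planePoint (0, α * 0) = 0 := by ext i; fin_cases i <;> simp [planePoint]
    rwa [h4] at h3

theorem genTanScaled_zero (lam : ℝ) : genTanScaled lam 0 = ((0 : Space3) : OnePoint Space3) := by
  have hz : zorich ((2 : ℝ) • (0 : Space3)) = !₂[0, 0, 1] := by
    rw [zorich_eq]
    ext i
    fin_cases i <;> simp [maxAbs]
  have hne : (!₂[0, 0, 1] : Space3) ≠ !₂[0, 0, -1] := by
    intro h
    have : (1 : ℝ) = -1 := by simpa using congrArg (fun v : Space3 => v 2) h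
    norm_num at this
  unfold genTanScaled genTan
  rw [hz, moebiusA_of_ne (D := 4) hne (by simp; norm_num), OnePoint.map_some]
  refine congrArg ((↑) : Space3 → OnePoint Space3) ?_
  ext i
  fin_cases i <;> simp
  right
  norm_num

theorem zero_mem_planarBasin (lam : ℝ) : (0, 0) ∈ planarBasin lam := by
  have h4 : planePoint (0, 0) = 0 := by ext i; fin_cases i <;> simp [planePoint]
  change planePoint (0, 0) ∈ basin (genTanScaled lam) 0
  rw [h4]
  exact mem_basin_of_tendsto (q := fun _ => 0) (fun _ => genTanScaled_zero lam) tendsto_const_nhds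

theorem petal_mem_planarBasin {lam t α : ℝ} (hlam : 0 < lam) (hα : lam ^ 2 - 1 < α ^ 2)
    (hα1 : α ^ 2 ≤ 1) (ht : |t| < petalBound lam α) : (t, α * t) ∈ planarBasin lam := by
  rcases eq_or_ne t 0 with rfl | h0
  · rw [mul_zero]; exact zero_mem_planarBasin lam
  · refine mem_planarBasin_of_abs ?_
    rw [abs_mul]
    have hb : petalBound lam |α| = petalBound lam α := by simp [petalBound]
    exact ray_mem_planarBasin hlam (abs_nonneg α) (abs_le_one_iff_mul_self_le_one.2 (by nlinarith))
      (by rw [sq_abs]; linarith) (abs_pos.2 h0) (by rwa [hb])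

theorem petalSet_subset_basin {lam : ℝ} (hlam : 0 < lam) :
    petalSet lam ⊆ basin (genTanScaled lam) 0 := by
  rintro p (⟨t, α, hα, hα1, ht, rfl⟩ | ⟨t, α, hα, hα1, ht, rfl⟩)
  · exact petal_mem_planarBasin hlam hα hα1 ht
  · exact swap_mem_planarBasin (petal_mem_planarBasin hlam hα hα1 ht)

/-! ### The petals as an open set, and failure of density -/

/-- Points off the axis over which the tangent map decreases the radius. -/
def contractionRegion (lam : ℝ) : Set Space3 :=
  {p | maxAbs (p 0) (p 1) ∈ Set.Ioo 0 (Real.pi / 4) ∧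
    lam * Real.tan (maxAbs (p 0) (p 1)) < √(p 0 ^ 2 + p 1 ^ 2)}

theorem isOpen_contractionRegion (lam : ℝ) : IsOpen (contractionRegion lam) := by
  have hM : Continuous fun p : Space3 => maxAbs (p 0) (p 1) := by
    unfold maxAbs; fun_prop
  have h1 : IsOpen ((fun p : Space3 => maxAbs (p 0) (p 1)) ⁻¹' Set.Ioo 0 (Real.pi / 4)) :=
    isOpen_Ioo.preimage hM
  have hc : ContinuousOn (fun p : Space3 => √(p 0 ^ 2 + p 1 ^ 2) -
      lam * Real.tan (maxAbs (p 0) (p 1)))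
      ((fun p : Space3 => maxAbs (p 0) (p 1)) ⁻¹' Set.Ioo 0 (Real.pi / 4)) := by
    refine ContinuousOn.sub (by fun_prop) (ContinuousOn.const_smul ?_ lam)
    refine Real.continuousOn_tan_Ioo.comp hM.continuousOn fun p hp => ?_
    exact ⟨by linarith [hp.1, Real.pi_pos], by linarith [hp.2, Real.pi_pos]⟩
  have := hc.isOpen_inter_preimage h1 (isOpen_Ioi (a := 0))
  convert this using 1
  ext p
  simp [contractionRegion]

/-- With `μ = lam / √(1 + α²)` the left side reads `μ tan M < M`. Since `tan M > M`, this forces `μ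
< 1`, and for `μ < 1` it means that `M` lies below the smallest fixed point. -/
theorem mul_tan_lt_iff {lam M α : ℝ} (hlam : 0 < lam) (hM : 0 < M) (hM4 : M < Real.pi / 4) :
    lam * Real.tan M < √(M ^ 2 + (α * M) ^ 2) ↔
      lam ^ 2 - 1 < α ^ 2 ∧ M < petalBound lam α := by
  have hr : 0 < √(1 + α ^ 2) := Real.sqrt_pos.2 (by positivity)
  have hroot : √(M ^ 2 + (α * M) ^ 2) = M * √(1 + α ^ 2) := by
    rw [show M ^ 2 + (α * M) ^ 2 = M ^ 2 * (1 + α ^ 2) by ring, Real.sqrt_mul (by positivity),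
      Real.sqrt_sq hM.le]
  have hiff : lam * Real.tan M < M * √(1 + α ^ 2) ↔ lam / √(1 + α ^ 2) * Real.tan M < M := by
    rw [div_mul_eq_mul_div, div_lt_iff₀ hr]
  have hM2 : M < Real.pi / 2 := by linarith
  rw [hroot, hiff]
  constructor
  · intro h
    refine ⟨?_, lt_min hM4 (lt_smallestFixedPt_of_mul_tan_lt (div_pos hlam hr) hM hM2 h)⟩
    have h1 : lam < √(1 + α ^ 2) := by
      have h2 := Real.lt_tan hM hM2
      have h3 := hiff.2 h
      nlinarith
    have := (Real.lt_sqrt hlam.le).1 h1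
    linarith
  · rintro ⟨h1, h2⟩
    refine mul_tan_lt_of_lt_smallestFixedPt (div_pos hlam hr).le ?_ hM hM2 (lt_min_iff.1 h2).2
    rw [div_lt_one hr]
    exact Real.lt_sqrt_of_sq_lt (by linarith)

theorem petal_mem_contractionRegion {lam t α : ℝ} (hlam : 0 < lam) (hα : lam ^ 2 - 1 < α ^ 2)
    (hα1 : α ^ 2 ≤ 1) (ht : |t| < petalBound lam α) (ht0 : t ≠ 0) :
    maxAbs t (α * t) ∈ Set.Ioo 0 (Real.pi / 4) ∧
      lam * Real.tan (maxAbs t (α * t)) < √(t ^ 2 + (α * t) ^ 2) := by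
  have h1 : |α| ≤ 1 := abs_le_one_iff_mul_self_le_one.2 (by nlinarith)
  have hM : maxAbs t (α * t) = |t| := by
    rw [maxAbs, abs_mul, max_eq_left (mul_le_of_le_one_left (abs_nonneg t) h1)]
  have h4 : |t| < Real.pi / 4 := (lt_min_iff.1 ht).1
  have h5 := (mul_tan_lt_iff hlam (abs_pos.2 ht0) h4).2 ⟨hα, ht⟩
  rw [mul_pow, sq_abs, ← mul_pow] at h5
  rw [hM]
  exact ⟨⟨abs_pos.2 ht0, h4⟩, h5⟩

theorem exists_petal_of_contraction {lam x y : ℝ} (hlam : 0 < lam) (hyx : |y| ≤ |x|)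
    (h1 : maxAbs x y ∈ Set.Ioo 0 (Real.pi / 4))
    (h2 : lam * Real.tan (maxAbs x y) < √(x ^ 2 + y ^ 2)) :
    ∃ α, lam ^ 2 - 1 < α ^ 2 ∧ α ^ 2 ≤ 1 ∧ |x| < petalBound lam α ∧ y = α * x := by
  have hM : maxAbs x y = |x| := max_eq_left hyx
  rw [hM] at h1 h2
  have hx0 : x ≠ 0 := abs_pos.1 h1.1
  have hy : y / x * x = y := div_mul_cancel₀ _ hx0
  have h3 : √(|x| ^ 2 + (y / x * |x|) ^ 2) = √(x ^ 2 + y ^ 2) := by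
    rw [mul_pow, sq_abs, ← mul_pow, hy]
  rw [← h3, mul_tan_lt_iff hlam h1.1 h1.2] at h2
  refine ⟨y / x, h2.1, ?_, h2.2, hy.symm⟩
  rw [div_pow, div_le_one (by positivity)]
  exact sq_le_sq.2 hyx

/-- Replacing the implicit bound through the fixed point by a strict inequality between continuous
functions makes relative openness evident. The two halves of the petal set correspond to `|y| ≤ |x|`
and `|x| ≤ |y|`. -/
theorem petalSet_diff_zero {lam : ℝ} (hlam : 0 < lam) :
    petalSet lam \ {0} = contractionRegion lam ∩ xyPlane := by
  ext p
  constructor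
  · rintro ⟨⟨t, α, hα, hα1, ht, rfl⟩ | ⟨t, α, hα, hα1, ht, rfl⟩, h0⟩
    all_goals
      have ht0 : t ≠ 0 := by
        rintro rfl
        apply h0
        ext i; fin_cases i <;> simp
      have h := petal_mem_contractionRegion hlam hα hα1 ht ht0
    · exact ⟨by simpa [contractionRegion] using h, by simp [xyPlane]⟩
    · rw [maxAbs_comm, add_comm] at h
      exact ⟨by simpa [contractionRegion] using h, by simp [xyPlane]⟩
  · rintro ⟨⟨h1, h2⟩, h3⟩
    refine ⟨?_, ?_⟩
    · rcases le_total |p 1| |p 0| with h | h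
      · obtain ⟨α, hα, hα1, ht, hy⟩ := exists_petal_of_contraction hlam h h1 h2
        refine Or.inl ⟨p 0, α, hα, hα1, ht, ?_⟩
        rw [← hy]
        exact eq_planePoint h3
      · rw [maxAbs_comm] at h1 h2
        rw [add_comm] at h2
        obtain ⟨α, hα, hα1, ht, hy⟩ := exists_petal_of_contraction hlam h h1 h2
        refine Or.inr ⟨p 1, α, hα, hα1, ht, ?_⟩
        rw [← hy]
        exact eq_planePoint h3
    · rintro rfl
      simp [maxAbs] at h1

theorem petalSet_diff_zero_nonempty {lam : ℝ} (hlam : 0 < lam) (hlam2 : lam < √2) :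
    (petalSet lam \ {0}).Nonempty := by
  have hr : 0 < √2 := Real.sqrt_pos.2 two_pos
  have hμ1 : lam / √2 < 1 := (div_lt_one hr).2 hlam2
  have hμ0 : 0 < lam / √2 := div_pos hlam hr
  -- The witness lies on the diagonal, where the gain `lam / √2` is smallest.
  obtain ⟨x, hx0, hx4, hx⟩ := exists_mul_tan_lt hμ0.le hμ1
    (show 0 < Real.pi / 4 by positivity) (by linarith [Real.pi_pos])
  have hroot : √(x ^ 2 + x ^ 2) = x * √2 := by
    rw [show x ^ 2 + x ^ 2 = x ^ 2 * 2 by ring, Real.sqrt_mul (by positivity), Real.sqrt_sq hx0.le]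
  refine ⟨planePoint (x, x), ?_⟩
  rw [petalSet_diff_zero hlam]
  refine ⟨⟨?_, ?_⟩, by simp [xyPlane, planePoint]⟩
  · simpa [planePoint, maxAbs, abs_of_pos hx0] using ⟨hx0, hx4⟩
  · rw [div_mul_eq_mul_div, div_lt_iff₀ hr] at hx
    simpa [planePoint, maxAbs, abs_of_pos hx0, hroot] using hx

/-- Density would put an escaping point into the open contraction region. That point lies in the
plane, hence in a petal, hence in the basin of `0`, where no orbit escapes. -/
theorem not_xyPlane_subset_closure {lam : ℝ} (hlam : 0 < lam) (hlam2 : lam < √2) :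
    ¬ xyPlane ⊆ closure (escapingSet (genTanScaled lam)) := by
  intro hsub
  obtain ⟨p, hp⟩ := petalSet_diff_zero_nonempty hlam hlam2
  have hp' := hp
  rw [petalSet_diff_zero hlam] at hp'
  obtain ⟨q, hq1, hq2⟩ := mem_closure_iff.1 (hsub hp'.2) _ (isOpen_contractionRegion lam) hp'.1
  have hq3 : q ∈ petalSet lam \ {0} := by
    rw [petalSet_diff_zero hlam]
    exact ⟨hq1, escapingSet_subset_xyPlane hlam hq2⟩
  exact Set.disjoint_left.1 (disjoint_basin_escapingSet _ 0)
    (petalSet_subset_basin hlam hq3.1) hq2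

theorem theorem2p3 :
    (∀ lam : ℝ, √2 < lam → closure (escapingSet (genTanScaled lam)) = xyPlane) ∧
    (∀ lam : ℝ, 0 < lam → lam < √2 →
      petalSet lam ⊆ basin (genTanScaled lam) 0 ∧
      (petalSet lam \ {0}).Nonempty ∧
      (∃ U : Set Space3, IsOpen U ∧ petalSet lam \ {0} = U ∩ xyPlane) ∧
      ¬ xyPlane ⊆ closure (escapingSet (genTanScaled lam))) ∧
    (∀ c : ℝ, c < √2 →
      ¬ ∀ lam : ℝ, 0 < lam → c < lam →
        closure (escapingSet (genTanScaled lam)) = xyPlane) := by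
  refine ⟨fun lam hlam => closure_escapingSet_eq hlam, fun lam hlam hlam2 =>
    ⟨petalSet_subset_basin hlam, petalSet_diff_zero_nonempty hlam hlam2,
      ⟨_, isOpen_contractionRegion lam, petalSet_diff_zero hlam⟩,
      not_xyPlane_subset_closure hlam hlam2⟩, fun c hc h => ?_⟩
  -- The maximum with `0` keeps `lam` positive when `c` is negative.
  obtain ⟨lam, h1, h2⟩ := exists_between (max_lt hc (Real.sqrt_pos.2 two_pos))
  obtain ⟨h3, h4⟩ := max_lt_iff.1 h1
  exact not_xyPlane_subset_closure h4 h2 (h lam h4 h3).ge
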